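/- Conventions. For a locally finite positive Borel measure $\nu$ on $\mathbb{R}$ and a function $f$, let $$H(f\nu)(x)=\int_{\mathbb{R}}\frac{f(y)}{y-x}\,d\nu(y),\qquad H_\nu f=H(f\nu),\qquad H\nu=H(1\cdot\nu),$$ wherever the integral converges absolutely (and $\nu(\{x\})=0$). Let $1<p<\infty$, $p'=p/(p-1)$, and let $\sigma,\omega$ be two such measures. Intervals $I$ are bounded and of positive length $|I|$. * The two-tailed Muckenhoupt condition $\mathcal{A}_p(\sigma,\omega)<\infty$ says that $$\sup_I\left(\int\frac{|I|^{p-1}}{(|I|+\operatorname{dist}(x,I))^{p}}\,d\omega(x)\right)^{1/p}\left(\int\frac{|I|^{p'-1}}{(|I|+\operatorname{dist}(x,I))^{p'}}\,d\sigma(x)\right)^{1/p'}<\infty .$$ * The forward $L^p$ testing condition for $(\sigma,\omega)$ says that there is $T<\infty$ such that, for all $I$, $H(\mathbf 1_I\sigma)$ is given by an absolutely convergent integral $\omega$-a.e. on $I$ and $\int_I|H(\mathbf 1_I\sigma)|^p\,d\omega\le T^p\sigma(I)$. The backward condition is the forward one with $(p,\sigma,\omega)$ replaced by $(p',\omega,\sigma)$.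 * The quadratic constant $\mathcal{A}_p^{\ell^2}(\sigma,\omega)\in[0,\infty]$ is the best $C$ in $$\left\|\Big(\sum_{i=1}^{M}\Big(\mathbf 1_{I_i}\int_{\mathbb{R}\setminus I_i}\frac{f_i(y)}{|y-c_i|}\,d\sigma(y)\Big)^2\Big)^{1/2}\right\|_{L^p(\omega)}\le C\left\|\Big(\sum_{i=1}^{M}f_i^2\Big)^{1/2}\right\|_{L^p(\sigma)}$$ over all $M$, all intervals $I_1,\dots,I_M$ with centres $c_i$, and all nonnegative measurable $f_1,\dots,f_M$. * $H_\sigma$ is bounded from $L^p(\sigma)$ to $L^p(\omega)$ if its truncations to $\varepsilon<|y-x|<R$ satisfy the norm inequality with a constant independent of $0<\varepsilon<R<\infty$. Construction. Let $\omega$ be the middle-third Cantor measure on $[0,1]$: it is the law of $\sum_{n\ge0}2b_n3^{-n-1}$ for independent fair bits $b_n\in\{0,1\}$, and gives mass $2^{-k}$ to each of the $2^k$ closed intervals $I_j^k$ of length $3^{-k}$ ($k\ge0$, $1\le j\le 2^k$) of the $k$-th generation of the Cantor construction. Let $G_j^k$ be the removed open middle third of $I_j^k$. Theorem. (0) The integral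 defining $H\omega$ converges absolutely at every point of every $G_j^k$, and each $G_j^k$ contains exactly one zero $z_j^k$ of $H\omega$. For $1<r<\infty$, $r'=r/(r-1)$, put $$\sigma_r=\sum_{k\ge0}\sum_{j=1}^{2^k}s_j^k\,\delta_{z_j^k},\qquad s_j^k=2^{-k}\left(\tfrac23\right)^{kr'} .$$ Let $1<p<\infty$ with $p\ne2$. Then: (1) The pairs $(\sigma,\omega)=(\sigma_p,\omega)$ and, with the roles of the measures interchanged, $(\omega,\sigma_{p'})$ each consist of locally finite positive Borel measures that satisfy the two-tailed $\mathcal{A}_p$ condition and both the forward and the backward $L^p$ testing conditions for $H$. (2) If $p>2$, then $\mathcal{A}_p^{\ell^2}(\sigma_p,\omega)=\infty$ and $H_{\sigma_p}$ is not bounded from $L^p(\sigma_p)$ to $L^p(\omega)$; there is even $f\in L^p(\sigma_p)$ such that $H(f\sigma_p)$ is given by an absolutely convergent integral $\omega$-a.e. and $\int|H(f\sigma_p)|^p\,d\omega=\infty$. (3) If $1<p<2$, then the same holds for the dual pair: $\mathcal{A}_p^{\ell^2}(\omega,\sigma_{p'})=\infty$ and $H_\omega$ is not bounded from $L^p(\omega)$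 to $L^p(\sigma_{p'})$; there is even $f\in L^p(\omega)$ such that $H(f\omega)$ is given by an absolutely convergent integral $\sigma_{p'}$-a.e. and $\int|H(f\omega)|^p\,d\sigma_{p'}=\infty$. In particular the two-weight $T1$ theorem for the Hilbert transform fails in $L^p$ for every $p\ne2$. -/

import Mathlib

open MeasureTheory Set
open scoped ENNReal NNReal

noncomputable section

/-! ### The Hilbert transform and the conditions on a pair of weights -/

namespace TwoWeight

/-- Bounded intervals (open, closed or half-open) of positive length. -/
def IsInterval (I : Set ℝ) : Prop :=
  I.OrdConnected ∧ Bornology.IsBounded I ∧ (interior I).Nonempty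

/-- The centre of a bounded interval. -/
def center (I : Set ℝ) : ℝ := (sInf I + sSup I) / 2

/-- The Hilbert transform `H(f ν)(x) = ∫ f(y) / (y - x) dν(y)`, an absolutely convergent integral
wherever `Converges ν f x` holds. -/
def hilbert (ν : Measure ℝ) (f : ℝ → ℝ) (x : ℝ) : ℝ := ∫ y, f y / (y - x) ∂ν

/-- The integral which defines `H(f ν)(x)` converges absolutely. The condition `ν {x} = 0` discards
the points at which the kernel is undefined on a set of positive measure. -/
def Converges (ν : Measure ℝ) (f : ℝ → ℝ) (x : ℝ) : Prop :=
  ν {x} = 0 ∧ Integrable (fun y => f y / (y - x)) ν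

/-- The truncated Hilbert transform
`H_{ε,R}(f ν)(x) = ∫_{ε < |y - x| < R} f(y) / (y - x) dν(y)`. -/
def hilbertTrunc (ε R : ℝ) (ν : Measure ℝ) (f : ℝ → ℝ) (x : ℝ) : ℝ :=
  ∫ y in {y | ε < |y - x| ∧ |y - x| < R}, f y / (y - x) ∂ν

/-- `H_σ` is bounded from `L^p(σ)` to `L^p(ω)`: its truncations are bounded uniformly. -/
def HilbertBounded (p : ℝ) (σ ω : Measure ℝ) : Prop :=
  ∃ C : ℝ≥0, ∀ ε R : ℝ, 0 < ε → ε < R → ∀ f : ℝ → ℝ, MemLp f (ENNReal.ofReal p) σ →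
    eLpNorm (hilbertTrunc ε R σ f) (ENNReal.ofReal p) ω ≤ C * eLpNorm f (ENNReal.ofReal p) σ

/-- The `L^p` testing condition for `H` and the pair `(σ, ω)`:
`∫_I |H(1_I σ)|^p dω ≤ T^p σ(I)` for all intervals `I`, where the integrals defining `H(1_I σ)`
converge absolutely at `ω`-almost all points of `I`. -/
def HilbertTesting (p : ℝ) (σ ω : Measure ℝ) : Prop :=
  ∃ T : ℝ≥0, ∀ I : Set ℝ, IsInterval I →
    (∀ᵐ x ∂(ω.restrict I), Converges σ (I.indicator 1) x) ∧
    ∫⁻ x in I, ENNReal.ofReal (|hilbert σ (I.indicator 1) x| ^ p) ∂ω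
      ≤ ENNReal.ofReal ((T : ℝ) ^ p) * σ I

/-- The one-measure factor `∫ |I|^(p-1) / (|I| + dist(x, I))^p dμ(x)`. -/
def tailIntegral (p : ℝ) (μ : Measure ℝ) (I : Set ℝ) : ℝ≥0∞ :=
  ∫⁻ x, ENNReal.ofReal
    (volume.real I ^ (p - 1) / (volume.real I + Metric.infDist x I) ^ p) ∂μ

/-- The two-tailed Muckenhoupt constant `𝒜_p(σ, ω)`: the supremum over all intervals. -/
def muckenhoupt (p : ℝ) (σ ω : Measure ℝ) : ℝ≥0∞ :=
  ⨆ (I : Set ℝ) (_ : IsInterval I),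
    tailIntegral p ω I ^ (1 / p) *
      tailIntegral p.conjExponent σ I ^ (1 / p.conjExponent)

/-- The quadratic Muckenhoupt constant `𝒜_p^{ℓ²}(σ, ω)`: the best constant in the
quadratic inequality, over all finite families of intervals `I i` and of functions `f i`. Passing
from `f i` to `|f i|` does not change the right side and does not decrease the left one, so that
the functions may be taken nonnegative. -/
def quadraticMuckenhoupt (p : ℝ) (σ ω : Measure ℝ) : ℝ≥0∞ :=
  sInf {C : ℝ≥0∞ | ∀ (M : ℕ) (I : Fin M → Set ℝ) (f : Fin M → ℝ → ℝ≥0∞),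
    (∀ i, IsInterval (I i)) → (∀ i, Measurable (f i)) →
    (∫⁻ x, (∑ i, ((I i).indicator
        (fun _ => ∫⁻ y in (I i)ᶜ, f i y / ENNReal.ofReal |y - center (I i)| ∂σ) x) ^ 2)
          ^ (p / 2) ∂ω) ^ (1 / p)
      ≤ C * (∫⁻ y, (∑ i, f i y ^ 2) ^ (p / 2) ∂σ) ^ (1 / p)}

/-- The hypotheses of the `T1` theorem in `L^p` for the pair `(σ, ω)`: the two measures are locally
finite, the two-tailed Muckenhoupt condition holds, and so do both testing conditions. -/
structure T1Hypotheses (p : ℝ) (σ ω : Measure ℝ) : Prop where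
  locallyFinite_left : IsLocallyFiniteMeasure σ
  locallyFinite_right : IsLocallyFiniteMeasure ω
  muckenhoupt_lt_top : muckenhoupt p σ ω < ∞
  testing_forward : HilbertTesting p σ ω
  testing_backward : HilbertTesting p.conjExponent ω σ

/-- The conclusion of the `T1` theorem in `L^p` fails for the pair `(σ, ω)`: the quadratic
Muckenhoupt constant is infinite, `H_σ` is not bounded from `L^p(σ)` to `L^p(ω)`, and there is
even a function `f` in `L^p(σ)` for which `H(f σ)` is given `ω`-almost everywhere by an absolutely
convergent integral, with `∫ |H(f σ)|^p dω = ∞`. -/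
structure T1Failure (p : ℝ) (σ ω : Measure ℝ) : Prop where
  quadratic_eq_top : quadraticMuckenhoupt p σ ω = ∞
  not_bounded : ¬ HilbertBounded p σ ω
  exists_witness : ∃ f : ℝ → ℝ, MemLp f (ENNReal.ofReal p) σ ∧
    (∀ᵐ x ∂ω, Converges σ f x) ∧
    ∫⁻ x, ENNReal.ofReal (|hilbert σ f x| ^ p) ∂ω = ∞

end TwoWeight

/-! ### The Cantor construction -/

namespace Cantor

/-- The left endpoint of the interval of generation `k` that is coded by the word `w`
(`false`: left third, `true`: right third). -/
def leftEnd {k : ℕ} (w : Fin k → Bool) : ℝ :=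
  ∑ i : Fin k, (if w i then 2 else 0) / (3 : ℝ) ^ ((i : ℕ) + 1)

/-- The closed intervals of generation `k`, of length `3^(-k)`. -/
def interval {k : ℕ} (w : Fin k → Bool) : Set ℝ :=
  Icc (leftEnd w) (leftEnd w + 1 / 3 ^ k)

/-- The removed open middle third of `interval w`. -/
def gap {k : ℕ} (w : Fin k → Bool) : Set ℝ :=
  Ioo (leftEnd w + 1 / 3 ^ (k + 1)) (leftEnd w + 2 / 3 ^ (k + 1))

/-- The point `∑ 2 b_n / 3^(n+1)` of the Cantor set. -/
def point (b : ℕ → Bool) : ℝ := ∑' n, (if b n then 2 else 0) / (3 : ℝ) ^ (n + 1)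

/-- The Cantor measure: the law of `∑ 2 b_n / 3^(n+1)` for independent fair bits `b_n`. -/
def measure : Measure ℝ :=
  (Measure.infinitePi fun _ : ℕ => (PMF.uniformOfFintype Bool).toMeasure).map point

theorem summable_digits (b : ℕ → Bool) :
    Summable fun n => (if b n then 2 else 0) / (3 : ℝ) ^ (n + 1) := by
  have h : Summable fun n : ℕ => (2 / 3 : ℝ) * (1 / 3) ^ n :=
    (summable_geometric_of_lt_one (by norm_num) (by norm_num)).mul_left _
  refine Summable.of_nonneg_of_le (fun n => by split_ifs <;> positivity) (fun n => ?_) h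
  have : (2 / 3 : ℝ) * (1 / 3) ^ n = 2 / 3 ^ (n + 1) := by
    rw [div_pow, pow_succ]; field_simp; simp
  rw [this]
  split_ifs
  · exact le_rfl
  · rw [zero_div]; positivity

theorem point_nonneg (b : ℕ → Bool) : 0 ≤ point b :=
  tsum_nonneg fun n => by split_ifs <;> positivity

theorem point_le_one (b : ℕ → Bool) : point b ≤ 1 := by
  have h1 : HasSum (fun n : ℕ => (2 / 3 : ℝ) * (1 / 3) ^ n) 1 := by
    have := (hasSum_geometric_of_lt_one (r := (1 / 3 : ℝ)) (by norm_num) (by norm_num)).mul_left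
      (2 / 3 : ℝ)
    norm_num at this ⊢
    exact this
  refine (hasSum_le (fun n => ?_) (summable_digits b).hasSum h1)
  have : (2 / 3 : ℝ) * (1 / 3) ^ n = 2 / 3 ^ (n + 1) := by
    rw [div_pow, pow_succ]; field_simp; simp
  rw [this]
  split_ifs
  · exact le_rfl
  · rw [zero_div]; positivity

theorem point_succ (b : ℕ → Bool) :
    point b = (if b 0 then 2 else 0) / 3 + point (fun n => b (n + 1)) / 3 := by
  unfold point
  rw [(summable_digits b).tsum_eq_zero_add, ← tsum_div_const]
  congr 1
  · simp
  · refine tsum_congr fun n => ?_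
    rw [div_div, ← pow_succ]

theorem leftEnd_succ {k : ℕ} (w : Fin (k + 1) → Bool) :
    leftEnd w = (if w 0 then 2 else 0) / 3 + leftEnd (fun i => w i.succ) / 3 := by
  unfold leftEnd
  rw [Fin.sum_univ_succ, Finset.sum_div]
  congr 1
  · simp
  · refine Finset.sum_congr rfl fun n _ => ?_
    rw [div_div, ← pow_succ]
    rfl

theorem leftEnd_bounds {k : ℕ} (w : Fin k → Bool) :
    0 ≤ leftEnd w ∧ leftEnd w + 1 / 3 ^ k ≤ 1 := by
  induction k with
  | zero => simp [leftEnd]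
  | succ k ih =>
    rw [leftEnd_succ]
    obtain ⟨h1, h2⟩ := ih (fun i => w i.succ)
    have h3 : (1 : ℝ) / 3 ^ (k + 1) = 1 / 3 ^ k / 3 := by rw [div_div, ← pow_succ]
    rw [h3]
    split_ifs <;> constructor <;> linarith

/-- A point of the Cantor set lies in the interval coded by `w` iff `w` is a prefix of its code. -/
theorem point_mem_interval {k : ℕ} (w : Fin k → Bool) (b : ℕ → Bool) :
    point b ∈ interval w ↔ ∀ i : Fin k, b i = w i := by
  induction k generalizing b with
  | zero => simpa [interval, leftEnd] using ⟨point_nonneg b, point_le_one b⟩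
  | succ k ih =>
    rw [Fin.forall_fin_succ]
    have ih' := ih (fun i => w i.succ) (fun n => b (n + 1))
    obtain ⟨h1, h2⟩ := leftEnd_bounds (fun i : Fin k => w i.succ)
    have h3 : (1 : ℝ) / 3 ^ (k + 1) = 1 / 3 ^ k / 3 := by rw [div_div, ← pow_succ]
    have h4 := point_nonneg (fun n => b (n + 1))
    have h5 := point_le_one (fun n => b (n + 1))
    have h6 : (0 : ℝ) < 1 / 3 ^ k := by positivity
    simp only [interval, mem_Icc] at ih' ⊢
    rw [point_succ, leftEnd_succ, h3]
    have e : (∀ i : Fin k, b ((i.succ : Fin (k + 1)) : ℕ) = w i.succ) ↔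
        ∀ i : Fin k, b ((i : ℕ) + 1) = w i.succ := Iff.rfl
    rw [e, ← ih']
    generalize (1 : ℝ) / 3 ^ k = r at *
    cases hb : b 0 <;> cases hw : w 0 <;>
      simp only [Fin.val_zero, hb, Bool.false_eq_true, if_true, if_false, true_and, false_and,
        Bool.true_eq_false, iff_false, not_and, not_le] <;>
      first
      | (constructor <;> intro h <;> constructor <;> linarith [h.1, h.2])
      | (intro h; linarith)

theorem measurable_point : Measurable point := by
  refine Continuous.measurable ?_
  have h : Summable fun n : ℕ => (2 / 3 : ℝ) * (1 / 3) ^ n :=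
    (summable_geometric_of_lt_one (by norm_num) (by norm_num)).mul_left _
  refine continuous_tsum (fun n => ?_) h fun n b => ?_
  · exact (continuous_of_discreteTopology (f := fun c : Bool =>
      (if c then 2 else 0) / (3 : ℝ) ^ (n + 1))).comp (continuous_apply n)
  · have : (2 / 3 : ℝ) * (1 / 3) ^ n = 2 / 3 ^ (n + 1) := by
      rw [div_pow, pow_succ]; field_simp; simp
    rw [this]
    split_ifs
    · simp
    · simp; positivity

instance : IsProbabilityMeasure measure :=
  Measure.isProbabilityMeasure_map measurable_point.aemeasurable

/-- The Cantor measure is equidistributed among the intervals of each generation. -/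
theorem measure_interval {k : ℕ} (w : Fin k → Bool) : measure (interval w) = 2⁻¹ ^ k := by
  have hI : MeasurableSet (interval w) := measurableSet_Icc
  rw [measure, Measure.map_apply measurable_point hI]
  have : point ⁻¹' interval w = Set.pi (Finset.range k)
      (fun i => if h : i < k then {w ⟨i, h⟩} else univ) := by
    ext b
    simp only [mem_preimage, point_mem_interval, Set.mem_pi, Finset.coe_range, mem_Iio]
    constructor
    · intro h i hi
      simpa [hi] using h ⟨i, hi⟩
    · intro h i
      simpa using h i i.2
  rw [this, Measure.infinitePi_pi _ (fun i _ => by split_ifs <;> measurability)]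
  rw [Finset.prod_eq_pow_card (b := 2⁻¹), Finset.card_range]
  intro i hi
  simp [Finset.mem_range.1 hi]

/-- The Cantor measure is carried by the Cantor set. -/
theorem measure_compl_cantor :
    measure (⋂ k : ℕ, ⋃ w : Fin k → Bool, interval w)ᶜ = 0 := by
  have hE : MeasurableSet (⋂ k : ℕ, ⋃ w : Fin k → Bool, interval w) :=
    MeasurableSet.iInter fun k => MeasurableSet.iUnion fun w => measurableSet_Icc
  rw [measure, Measure.map_apply measurable_point hE.compl]
  convert measure_empty (μ := Measure.infinitePi fun _ : ℕ => (PMF.uniformOfFintype Bool).toMeasure)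
  refine eq_empty_of_forall_notMem fun b hb => hb ?_
  exact mem_iInter.2 fun k => mem_iUnion.2 ⟨fun i => b i, (point_mem_interval _ b).2 fun _ => rfl⟩

/-- The zero of `Hω` in the gap of `interval w`, where `ω` is the Cantor measure. -/
def zero {k : ℕ} (w : Fin k → Bool) : ℝ :=
  Classical.epsilon fun z => z ∈ gap w ∧ TwoWeight.hilbert measure 1 z = 0

/-- The measure `σ_p`: for each word of length `k`, a point mass `2^(-k) (2/3)^(k p')` at the zero
of `Hω` in the corresponding gap, where `p' = p / (p - 1)`. -/
def sigma (p : ℝ) : Measure ℝ :=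
  Measure.sum fun v : (k : ℕ) × (Fin k → Bool) =>
    ENNReal.ofReal ((2 : ℝ)⁻¹ ^ v.1 * (2 / 3 : ℝ) ^ ((v.1 : ℝ) * p.conjExponent)) •
      Measure.dirac (zero v.2)

end Cantor

end

/-! ### The tree of Cantor intervals -/

/-! Write I_w for the Cantor interval of a word w of length k, z_w for the zero of Hω in its gap and
s for the mass at z_w. The masses satisfy ω(I_w)^(1/p) s^(1/p') = 3^(-k), so every pair (I_w, z_w)
is exactly critical for the Muckenhoupt condition, in all generations at once. Moreover z_w keeps a
distance comparable with 3^(-k) from the Cantor set (`zero_mem_Icc`), so the kernel between z_w and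
a Cantor point is at most a constant times 3^n, where n ≤ k counts the common digits of their codes
(`exists_agree_zero`). All upper bounds reduce to geometric series over this tree.

Testing on indicators succeeds. For σ, the kernel sums decay geometrically with the generation, so
an interval feels only its earliest zero, and absolute values suffice (`testing_sig`). For ω,
absolute values would give a fixed multiple of ω(I) in each generation, which diverges. The choice
of the zeros helps: Hω(z) = 0 turns H(1_I ω)(z) into -H(1_{I^c} ω)(z), which is controlled by the
deepest Cantor interval around z that leaves I, and in each generation at most two Cantor intervals
meet I and leave it (`hilbert_indicator_boundary`, `card_zeros_le`, `testing_measure`). In the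
Muckenhoupt condition the only delicate term comes from a zero much closer to I than the Cantor set
is; there is at most one, because Cantor points separate the zeros (`zero_unique_of_infDist`).

Boundedness fails because criticality makes every generation count equally, and L generations add up
differently on the two sides. If p > 2, place signed, normalized values at the zeros of L
generations: the norm in L^p(σ) grows like L^(1/p), since the atoms are disjoint, whereas for
suitable signs the image has size at least L^(1/2), since all L layers overlap on the Cantor set
(`exists_block_sig`). If p < 2, signed sums of Haar functions of L generations have norm at most
L^(1/2) in L^p(ω), by orthogonality, whereas the images at the atoms contribute L^(1/p)
(`exists_block_measure`). The lower bounds need only some choice of signs, made greedily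
(`exists_signs_sq`, `exists_signs_rpow`). Blocks of this kind in disjoint cells are glued into one
function (`exists_witness_of_blocks`). The same count of generations, with square functions in place
of signs, makes the quadratic constant infinite. -/

namespace Cantor

/-- The word formed by the first `n` digits of a sequence. -/
def pre (b : ℕ → Bool) (n : ℕ) : Fin n → Bool := fun i => b i

/-- A word, continued by zeros. -/
def ext {k : ℕ} (w : Fin k → Bool) : ℕ → Bool := fun i => if h : i < k then w ⟨i, h⟩ else false

@[simp] theorem pre_ext {k : ℕ} (w : Fin k → Bool) : pre (ext w) k = w := by
  funext i; simp [pre, ext]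

/-- Two sequences have the same first `n` digits. -/
def Agree (n : ℕ) (b c : ℕ → Bool) : Prop := ∀ i < n, b i = c i

instance (n : ℕ) (b c : ℕ → Bool) : Decidable (Agree n b c) :=
  inferInstanceAs (Decidable (∀ i < n, b i = c i))

theorem Agree.mono {n m : ℕ} {b c : ℕ → Bool} (h : Agree n b c) (hm : m ≤ n) : Agree m b c :=
  fun i hi => h i (hi.trans_le hm)

theorem Agree.symm {n : ℕ} {b c : ℕ → Bool} (h : Agree n b c) : Agree n c b :=
  fun i hi => (h i hi).symm

theorem Agree.trans {n : ℕ} {b c d : ℕ → Bool} (h : Agree n b c) (h' : Agree n c d) :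
    Agree n b d := fun i hi => (h i hi).trans (h' i hi)

theorem agree_self (n : ℕ) (b : ℕ → Bool) : Agree n b b := fun _ _ => rfl

theorem pre_eq_iff {n : ℕ} {b c : ℕ → Bool} : pre b n = pre c n ↔ Agree n b c := by
  constructor
  · intro h i hi
    exact congrFun h ⟨i, hi⟩
  · intro h
    funext i
    exact h i i.2

theorem Agree.pre_eq {n : ℕ} {b c : ℕ → Bool} (h : Agree n b c) : pre b n = pre c n :=
  pre_eq_iff.2 h

/-- The number `n` is the length of the common prefix, cut off at `k`. It is the scale on which two
points of the tree are separated; almost every estimate starts from this dichotomy. -/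
theorem exists_agree (k : ℕ) (b c : ℕ → Bool) :
    ∃ n ≤ k, Agree n b c ∧ (n < k → b n ≠ c n) := by
  induction k with
  | zero => exact ⟨0, le_rfl, fun i hi => absurd hi (Nat.not_lt_zero i), fun h => absurd h (lt_irrefl 0)⟩
  | succ k ih =>
    obtain ⟨n, hn, h1, h2⟩ := ih
    rcases hn.lt_or_eq with h | rfl
    · exact ⟨n, by omega, h1, fun _ => h2 h⟩
    · by_cases hb : b n = c n
      · refine ⟨n + 1, le_rfl, fun i hi => ?_, fun h => absurd h (lt_irrefl _)⟩
        rcases (Nat.lt_succ_iff.1 hi).lt_or_eq with h | rfl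
        · exact h1 i h
        · exact hb
      · exact ⟨n, by omega, h1, fun _ => hb⟩

theorem leftEnd_pre_succ (b : ℕ → Bool) (n : ℕ) :
    leftEnd (pre b (n + 1)) = leftEnd (pre b n) + (if b n then 2 else 0) / 3 ^ (n + 1) := by
  unfold leftEnd pre
  rw [Fin.sum_univ_castSucc]
  simp

theorem one_div_pow_succ (n : ℕ) : (1 : ℝ) / 3 ^ n = 3 / 3 ^ (n + 1) := by
  rw [pow_succ]; field_simp

theorem leftEnd_pre_mono (b : ℕ → Bool) {n k : ℕ} (h : n ≤ k) :
    leftEnd (pre b n) ≤ leftEnd (pre b k) ∧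
      leftEnd (pre b k) + 1 / 3 ^ k ≤ leftEnd (pre b n) + 1 / 3 ^ n := by
  induction k, h using Nat.le_induction with
  | base => exact ⟨le_rfl, le_rfl⟩
  | succ k _ ih =>
    rw [leftEnd_pre_succ]
    have := one_div_pow_succ k
    have h0 : (0 : ℝ) < 1 / 3 ^ (k + 1) := by positivity
    have h3 : (3 : ℝ) / 3 ^ (k + 1) = 3 * (1 / 3 ^ (k + 1)) := by ring
    have h2 : (2 : ℝ) / 3 ^ (k + 1) = 2 * (1 / 3 ^ (k + 1)) := by ring
    split_ifs
    · constructor <;> linarith [ih.1, ih.2]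
    · constructor <;> linarith [ih.1, ih.2, zero_div ((3 : ℝ) ^ (k + 1))]

theorem interval_pre_subset (b : ℕ → Bool) {n k : ℕ} (h : n ≤ k) :
    interval (pre b k) ⊆ interval (pre b n) :=
  Icc_subset_Icc (leftEnd_pre_mono b h).1 (leftEnd_pre_mono b h).2

theorem point_mem_pre {n : ℕ} {b c : ℕ → Bool} : point c ∈ interval (pre b n) ↔ Agree n b c := by
  rw [point_mem_interval]
  exact ⟨fun h i hi => (h ⟨i, hi⟩).symm, fun h i => (h i i.2).symm⟩

theorem gap_subset {k : ℕ} (w : Fin k → Bool) : gap w ⊆ interval w := by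
  intro x hx
  have := one_div_pow_succ k
  have h0 : (0 : ℝ) < 1 / 3 ^ (k + 1) := by positivity
  have h3 : (3 : ℝ) / 3 ^ (k + 1) = 3 * (1 / 3 ^ (k + 1)) := by ring
  have h2 : (2 : ℝ) / 3 ^ (k + 1) = 2 * (1 / 3 ^ (k + 1)) := by ring
  exact ⟨by linarith [hx.1], by linarith [hx.2]⟩

/-- The point at which two sequences part decides on which side of a gap they lie. -/
theorem interval_side {b : ℕ → Bool} {n k : ℕ} (h : n < k) {x : ℝ}
    (hx : x ∈ interval (pre b k)) :
    (b n = false → x ≤ leftEnd (pre b n) + 1 / 3 ^ (n + 1)) ∧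
    (b n = true → leftEnd (pre b n) + 2 / 3 ^ (n + 1) ≤ x) := by
  have := interval_pre_subset b (Nat.succ_le_of_lt h) hx
  simp only [interval, Nat.succ_eq_add_one, mem_Icc, leftEnd_pre_succ] at this
  constructor <;> intro hb <;> simp only [hb, if_true, Bool.false_eq_true, if_false] at this
  · linarith [zero_div ((3 : ℝ) ^ (n + 1))]
  · linarith

theorem mem_interval_point (b : ℕ → Bool) (n : ℕ) : point b ∈ interval (pre b n) :=
  point_mem_pre.2 (agree_self n b)

theorem point_side (b : ℕ → Bool) (n : ℕ) :
    (b n = false → point b ≤ leftEnd (pre b n) + 1 / 3 ^ (n + 1)) ∧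
    (b n = true → leftEnd (pre b n) + 2 / 3 ^ (n + 1) ≤ point b) :=
  interval_side (Nat.lt_succ_self n) (mem_interval_point b _)

theorem point_notMem_gap {k : ℕ} (w : Fin k → Bool) (c : ℕ → Bool) : point c ∉ gap w := by
  intro h
  have h1 : point c ∈ interval (pre (ext w) k) := by rw [pre_ext]; exact gap_subset w h
  have h2 := point_mem_pre.1 h1
  have h3 := point_side c k
  rw [← h2.pre_eq, pre_ext] at h3
  have h4 := h.1
  have h5 := h.2
  cases hc : c k
  · exact absurd h4 (not_lt.2 (h3.1 hc))
  · exact absurd h5 (not_lt.2 (h3.2 hc))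

/-- If two sequences part at the digit `n`, then intervals of later generations along them
are separated by a gap of generation `n`. -/
theorem dist_of_ne {b c : ℕ → Bool} {n k l : ℕ} (ha : Agree n b c) (hne : b n ≠ c n)
    (hk : n < k) (hl : n < l) {x y : ℝ} (hx : x ∈ interval (pre b k))
    (hy : y ∈ interval (pre c l)) : 1 / 3 ^ (n + 1) ≤ |x - y| := by
  have h1 := interval_side hk hx
  have h2 := interval_side hl hy
  rw [← ha.pre_eq] at h2
  have h3 : (2 : ℝ) / 3 ^ (n + 1) = 1 / 3 ^ (n + 1) + 1 / 3 ^ (n + 1) := by ring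
  cases hb : b n <;> cases hc : c n
  · exact absurd (hb.trans hc.symm) hne
  · rw [abs_sub_comm]
    exact le_trans (by linarith [h1.1 hb, h2.2 hc]) (le_abs_self _)
  · exact le_trans (by linarith [h1.2 hb, h2.1 hc]) (le_abs_self _)
  · exact absurd (hb.trans hc.symm) hne

/-! ### The support of the Cantor measure and the number of words with a given prefix -/

theorem continuous_point : Continuous point := by
  have h : Summable fun n : ℕ => (2 / 3 : ℝ) * (1 / 3) ^ n :=
    (summable_geometric_of_lt_one (by norm_num) (by norm_num)).mul_left _
  refine continuous_tsum (fun n => ?_) h fun n b => ?_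
  · exact (continuous_of_discreteTopology (f := fun c : Bool =>
      (if c then 2 else 0) / (3 : ℝ) ^ (n + 1))).comp (continuous_apply n)
  · have : (2 / 3 : ℝ) * (1 / 3) ^ n = 2 / 3 ^ (n + 1) := by
      rw [div_pow, pow_succ]; field_simp; simp
    rw [this]
    split_ifs
    · simp
    · simp; positivity

theorem ae_mem_range : ∀ᵐ x ∂measure, x ∈ range point := by
  rw [ae_iff]
  have h : IsClosed (range point) := (isCompact_range continuous_point).isClosed
  have h2 : MeasurableSet {x | x ∉ range point} := h.measurableSet.compl
  rw [measure, Measure.map_apply measurable_point h2]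
  convert measure_empty (μ := Measure.infinitePi fun _ : ℕ => (PMF.uniformOfFintype Bool).toMeasure)
  ext b
  simp

theorem ae_of_point {P : ℝ → Prop} (h : ∀ b, P (point b)) : ∀ᵐ x ∂measure, P x := by
  filter_upwards [ae_mem_range] with x hx
  obtain ⟨b, rfl⟩ := hx
  exact h b

theorem measure_eq_zero {s : Set ℝ} (h : ∀ b, point b ∉ s) : measure s = 0 := by
  have := ae_of_point (P := fun x => x ∉ s) h
  rw [ae_iff] at this
  simpa using this

theorem measureReal_interval {k : ℕ} (w : Fin k → Bool) :
    measure.real (interval w) = (1 / 2) ^ k := by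
  simp [Measure.real, measure_interval]

theorem card_agree (b : ℕ → Bool) {n k : ℕ} (h : n ≤ k) :
    (Finset.univ.filter fun w : Fin k → Bool => Agree n (ext w) b).card = 2 ^ (k - n) := by
  classical
  have e : (Finset.univ.filter fun w : Fin k → Bool => Agree n (ext w) b) =
      Fintype.piFinset fun i : Fin k => if (i : ℕ) < n then {b i} else Finset.univ := by
    ext w
    simp only [Finset.mem_filter, Finset.mem_univ, true_and, Fintype.mem_piFinset]
    constructor
    · intro hw i
      split_ifs with hi
      · have := hw i hi
        simpa [ext] using this
      · simp
    · intro hw i hi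
      have hik : i < k := hi.trans_le h
      have := hw ⟨i, hik⟩
      simpa [hi, ext, hik] using this
  rw [e, Fintype.card_piFinset]
  have : ∀ i : Fin k, (if (i : ℕ) < n then ({b i} : Finset Bool) else Finset.univ).card =
      (fun i : ℕ => if i < n then 1 else 2) i := by
    intro i; dsimp only; split_ifs <;> simp
  rw [Finset.prod_congr rfl fun i _ => this i,
    Fin.prod_univ_eq_prod_range (fun i : ℕ => if i < n then 1 else 2) k]
  obtain ⟨d, rfl⟩ := Nat.exists_eq_add_of_le h
  rw [Finset.prod_range_add, Finset.prod_congr rfl (g := fun _ => 1)]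
  · simp
  · intro i hi
    simp [Finset.mem_range.1 hi]

/-! ### The zeros of the Hilbert transform of the Cantor measure -/

theorem converges_one_of_le {z δ : ℝ} (hδ : 0 < δ) (h : ∀ b, δ ≤ |point b - z|) :
    TwoWeight.Converges measure 1 z := by
  constructor
  · refine measure_eq_zero fun b hb => ?_
    have := h b
    rw [mem_singleton_iff.1 hb] at this
    simp at this
    linarith
  · refine Integrable.of_bound (C := 1 / δ) ?_ ?_
    · exact (Measurable.div measurable_const (measurable_id.sub_const z)).aestronglyMeasurable
    · refine ae_of_point fun b => ?_
      simp only [Pi.one_apply, norm_div, norm_one, Real.norm_eq_abs]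
      exact one_div_le_one_div_of_le hδ (h b)

theorem exists_dist_of_mem_gap {k : ℕ} {w : Fin k → Bool} {z : ℝ} (hz : z ∈ gap w) :
    ∃ δ > 0, ∀ b, δ ≤ |point b - z| := by
  refine ⟨min (z - (leftEnd w + 1 / 3 ^ (k + 1))) (leftEnd w + 2 / 3 ^ (k + 1) - z),
    lt_min (sub_pos.2 hz.1) (sub_pos.2 hz.2), fun b => ?_⟩
  have h := point_notMem_gap w b
  simp only [gap, mem_Ioo, not_and_or, not_lt] at h
  rcases h with h | h
  · rw [abs_sub_comm]
    exact (min_le_left _ _).trans (le_trans (by linarith) (le_abs_self _))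
  · exact (min_le_right _ _).trans (le_trans (by linarith) (le_abs_self _))

theorem converges_one {k : ℕ} {w : Fin k → Bool} {z : ℝ} (hz : z ∈ gap w) :
    TwoWeight.Converges measure 1 z := by
  obtain ⟨δ, h0, h⟩ := exists_dist_of_mem_gap hz
  exact converges_one_of_le h0 h

theorem hilbert_sub {k : ℕ} {w : Fin k → Bool} {z z' : ℝ} (hz : z ∈ gap w) (hz' : z' ∈ gap w) :
    TwoWeight.hilbert measure 1 z' - TwoWeight.hilbert measure 1 z =
      ∫ y, (z' - z) / ((y - z) * (y - z')) ∂measure := by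
  unfold TwoWeight.hilbert
  rw [← integral_sub (converges_one hz').2 (converges_one hz).2]
  refine integral_congr_ae (ae_of_point fun b => ?_)
  have h1 : point b - z ≠ 0 := fun h => point_notMem_gap w b (sub_eq_zero.1 h ▸ hz)
  have h2 : point b - z' ≠ 0 := fun h => point_notMem_gap w b (sub_eq_zero.1 h ▸ hz')
  simp only [Pi.one_apply]
  field_simp
  ring

theorem integrable_hilbert_sub {k : ℕ} {w : Fin k → Bool} {z z' : ℝ} (hz : z ∈ gap w)
    (hz' : z' ∈ gap w) : Integrable (fun y => (z' - z) / ((y - z) * (y - z'))) measure := by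
  refine ((converges_one hz').2.sub (converges_one hz).2).congr (ae_of_point fun b => ?_)
  have h1 : point b - z ≠ 0 := fun h => point_notMem_gap w b (sub_eq_zero.1 h ▸ hz)
  have h2 : point b - z' ≠ 0 := fun h => point_notMem_gap w b (sub_eq_zero.1 h ▸ hz')
  simp only [Pi.sub_apply, Pi.one_apply]
  field_simp
  ring

theorem gap_subset_unit {k : ℕ} {w : Fin k → Bool} {z : ℝ} (hz : z ∈ gap w) :
    0 ≤ z ∧ z ≤ 1 := by
  have h := gap_subset w hz
  have h2 := leftEnd_bounds w
  exact ⟨h2.1.trans h.1, h.2.trans h2.2⟩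

theorem mul_pos_of_mem_gap {k : ℕ} {w : Fin k → Bool} {z z' : ℝ} (hz : z ∈ gap w)
    (hz' : z' ∈ gap w) (b : ℕ → Bool) : 0 < (point b - z) * (point b - z') := by
  have h := point_notMem_gap w b
  simp only [gap, mem_Ioo, not_and_or, not_lt] at h
  rcases h with h | h
  · exact mul_pos_of_neg_of_neg (by linarith [hz.1]) (by linarith [hz'.1])
  · exact mul_pos (by linarith [hz.2]) (by linarith [hz'.2])

/-- A Cantor point `y` lies on the same side of both points of the gap, so `(y - z) * (y - z')` is
in (0, 1], and the integrand in `hilbert_sub` is at least `z' - z`. -/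
theorem hilbert_strictMonoOn {k : ℕ} (w : Fin k → Bool) :
    StrictMonoOn (TwoWeight.hilbert measure 1) (gap w) := by
  intro z hz z' hz' hlt
  have h : z' - z ≤ TwoWeight.hilbert measure 1 z' - TwoWeight.hilbert measure 1 z := by
    rw [hilbert_sub hz hz']
    have : z' - z = ∫ _, (z' - z) ∂measure := by simp
    rw [this]
    refine integral_mono_ae (integrable_const _) ?_ (ae_of_point fun b => ?_)
    · simpa using integrable_hilbert_sub hz hz'
    · have h1 := mul_pos_of_mem_gap hz hz' b
      have h2 := gap_subset_unit hz
      have h3 := gap_subset_unit hz'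
      have h4 := point_nonneg b
      have h5 := point_le_one b
      have h6 : (point b - z) * (point b - z') ≤ 1 := by
        refine (le_abs_self _).trans ?_
        rw [abs_mul]
        refine mul_le_one₀ (abs_le.2 ⟨by linarith, by linarith⟩) (abs_nonneg _)
          (abs_le.2 ⟨by linarith, by linarith⟩)
      simp only [integral_const, probReal_univ, smul_eq_mul, one_mul]
      rw [le_div_iff₀ h1]
      exact mul_le_of_le_one_right (by linarith) h6
  linarith

theorem hilbert_continuousOn {k : ℕ} (w : Fin k → Bool) :
    ContinuousOn (TwoWeight.hilbert measure 1) (gap w) := by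
  intro z hz
  refine ContinuousAt.continuousWithinAt ?_
  obtain ⟨δ, h0, hδ⟩ := exists_dist_of_mem_gap hz
  refine continuousAt_of_dominated (bound := fun _ => 2 / δ) ?_ ?_ (integrable_const _) ?_
  · exact Filter.Eventually.of_forall fun x =>
      (Measurable.div measurable_const (measurable_id.sub_const x)).aestronglyMeasurable
  · filter_upwards [Metric.ball_mem_nhds z (half_pos h0)] with x hx
    refine ae_of_point fun b => ?_
    have h1 := hδ b
    have h2 : δ / 2 ≤ |point b - x| := by
      have h3 : |x - z| < δ / 2 := by simpa [Real.dist_eq] using hx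
      have h4 := abs_sub_le (point b) x z
      linarith
    simp only [Pi.one_apply, norm_div, norm_one, Real.norm_eq_abs]
    calc 1 / |point b - x| ≤ 1 / (δ / 2) := one_div_le_one_div_of_le (by linarith) h2
      _ = 2 / δ := by field_simp
  · refine ae_of_point fun b => ?_
    have h1 : point b - z ≠ 0 := fun h => point_notMem_gap w b (sub_eq_zero.1 h ▸ hz)
    exact ContinuousAt.div continuousAt_const (continuousAt_const.sub continuousAt_id) h1

end Cantor

/-! ### The sign of Hω near the ends of a gap -/

namespace Cantor

/-- The constant is the value of r / (r - 1) at the smallest ratio 3/2, that is, three times the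
Cantor density 1/2. Sums along a branch are thus dominated by their last term. -/
theorem geom_sum_le {r : ℝ} (hr : 3 / 2 ≤ r) (k : ℕ) :
    ∑ n ∈ Finset.range (k + 1), r ^ n ≤ 3 * r ^ k := by
  induction k with
  | zero => simp
  | succ k ih =>
    rw [Finset.sum_range_succ, pow_succ]
    have h : 0 < r ^ k := by positivity
    nlinarith

theorem leftEnd_pre_of_false {b : ℕ → Bool} {m n : ℕ} (h : m ≤ n) (hb : ∀ i ≥ m, b i = false) :
    leftEnd (pre b n) = leftEnd (pre b m) := by
  induction n, h using Nat.le_induction with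
  | base => rfl
  | succ n hn ih => rw [leftEnd_pre_succ, ih, hb n hn]; simp

theorem leftEnd_pre_of_true {b : ℕ → Bool} {m n : ℕ} (h : m ≤ n) (hb : ∀ i ≥ m, b i = true) :
    leftEnd (pre b n) + 1 / 3 ^ n = leftEnd (pre b m) + 1 / 3 ^ m := by
  induction n, h using Nat.le_induction with
  | base => rfl
  | succ n hn ih =>
    rw [leftEnd_pre_succ, ← ih, hb n hn, one_div_pow_succ n]
    simp only [if_true]
    ring

/-- These step functions along a branch serve as integrable majorants: by `le_tree` they dominate
any quantity that is at most `f n` at the points that part from `b` at scale `n`. -/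
theorem integral_tree (b : ℕ → Bool) (f : ℕ → ℝ) (k : ℕ) :
    Integrable (fun y => ∑ n ∈ Finset.range (k + 1),
      f n * (interval (pre b n)).indicator 1 y) measure ∧
    ∫ y, ∑ n ∈ Finset.range (k + 1), f n * (interval (pre b n)).indicator 1 y ∂measure =
      ∑ n ∈ Finset.range (k + 1), f n * (1 / 2) ^ n := by
  have h : ∀ n, Integrable (fun y => f n * (interval (pre b n)).indicator (1 : ℝ → ℝ) y) measure :=
    fun n => ((integrable_const (1 : ℝ)).indicator measurableSet_Icc).const_mul _
  refine ⟨integrable_finsetSum _ fun n _ => h n, ?_⟩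
  rw [integral_finsetSum _ fun n _ => h n]
  refine Finset.sum_congr rfl fun n _ => ?_
  rw [integral_const_mul, integral_indicator_one (by exact measurableSet_Icc), measureReal_interval]

theorem le_tree {b c : ℕ → Bool} {f : ℕ → ℝ} (hf : ∀ n, 0 ≤ f n) {n k : ℕ} (hn : n ≤ k)
    (h : Agree n b c) :
    f n ≤ ∑ n ∈ Finset.range (k + 1), f n * (interval (pre b n)).indicator 1 (point c) := by
  refine le_trans ?_ (Finset.single_le_sum (f := fun n => f n *
    (interval (pre b n)).indicator (1 : ℝ → ℝ) (point c)) (fun i _ => ?_)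
    (Finset.mem_range.2 (Nat.lt_succ_of_le hn)))
  · simp [point_mem_pre.2 h]
  · exact mul_nonneg (hf i) (indicator_nonneg (fun _ _ => zero_le_one) _)

theorem tree_nonneg {b : ℕ → Bool} {f : ℕ → ℝ} (hf : ∀ n, 0 ≤ f n) (k : ℕ) (y : ℝ) :
    0 ≤ ∑ n ∈ Finset.range (k + 1), f n * (interval (pre b n)).indicator 1 y :=
  Finset.sum_nonneg fun i _ => mul_nonneg (hf i) (indicator_nonneg (fun _ _ => zero_le_one) _)

/-- A point of a gap whose distance from the endpoints is at least `δ` is far from the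
Cantor set. -/
theorem exists_agree_dist {k : ℕ} (b c : ℕ → Bool) {z δ : ℝ} (hδ : 1 ≤ δ)
    (h1 : leftEnd (pre b k) + 1 / 3 ^ (k + 1) < z) (h2 : z < leftEnd (pre b k) + 2 / 3 ^ (k + 1))
    (h3 : point c < z → 1 / 3 ^ (k + 1) / δ ≤ z - (leftEnd (pre b k) + 1 / 3 ^ (k + 1)))
    (h4 : z < point c → 1 / 3 ^ (k + 1) / δ ≤ leftEnd (pre b k) + 2 / 3 ^ (k + 1) - z) :
    ∃ n ≤ k, Agree n b c ∧ 1 / 3 ^ (n + 1) / δ ≤ |point c - z| := by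
  obtain ⟨n, hn, ha, hne⟩ := exists_agree k b c
  refine ⟨n, hn, ha, ?_⟩
  rcases hn.lt_or_eq with h | rfl
  · have hz : z ∈ interval (pre b k) := gap_subset _ ⟨h1, h2⟩
    have := dist_of_ne ha (hne h) h (Nat.lt_succ_self n) hz (mem_interval_point c _)
    rw [abs_sub_comm]
    exact (div_le_self (by positivity) hδ).trans this
  · have hs := point_side c n
    rw [← ha.pre_eq] at hs
    cases hc : c n
    · rw [abs_sub_comm]
      exact le_trans (by linarith [hs.1 hc, h3 (by linarith [hs.1 hc])]) (le_abs_self _)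
    · exact le_trans (by linarith [hs.2 hc, h4 (by linarith [hs.2 hc])]) (le_abs_self _)

/-- This fixes the number 10: the left side is at most 27 (3/2)^k, and 10 is the first exponent with
(3/2)^10 / 2 ≥ 27. It compares the whole mass on one side of a gap with a tiny Cantor interval at
the other end. -/
theorem pow_ten_bound (k : ℕ) :
    ∑ n ∈ Finset.range (k + 1), (3 : ℝ) ^ (n + 2) * (1 / 2) ^ n ≤
      3 ^ (k + 10) / 2 * (1 / 2) ^ (k + 10) := by
  have h := geom_sum_le (r := 3 / 2) le_rfl k
  have e : ∀ n : ℕ, (3 : ℝ) ^ (n + 2) * (1 / 2) ^ n = 9 * (3 / 2) ^ n := by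
    intro n
    rw [pow_add, div_pow, div_pow, one_pow]
    ring
  have e2 : (3 : ℝ) ^ (k + 10) / 2 * (1 / 2) ^ (k + 10) = (3 / 2) ^ 10 / 2 * (3 / 2) ^ k := by
    rw [pow_add, pow_add, div_pow _ _ k, div_pow _ _ k, div_pow, one_pow]
    ring
  rw [Finset.sum_congr rfl fun n _ => e n, ← Finset.mul_sum, e2]
  have : (0 : ℝ) < (3 / 2) ^ k := by positivity
  calc 9 * ∑ n ∈ Finset.range (k + 1), (3 / 2 : ℝ) ^ n ≤ 27 * (3 / 2) ^ k := by linarith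
    _ ≤ _ := mul_le_mul_of_nonneg_right (by norm_num) this.le

theorem scale_facts (k : ℕ) : (0 : ℝ) < 1 / 3 ^ (k + 10) ∧
    (1 : ℝ) / 3 ^ (k + 1) = 3 ^ 9 * (1 / 3 ^ (k + 10)) ∧
    (2 : ℝ) / 3 ^ (k + 1) = 2 * 3 ^ 9 * (1 / 3 ^ (k + 10)) := by
  refine ⟨by positivity, ?_, ?_⟩
  · rw [show k + 10 = k + 1 + 9 by ring, pow_add _ (k + 1) 9]; field_simp
  · rw [show k + 10 = k + 1 + 9 by ring, pow_add _ (k + 1) 9]; field_simp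

/-- The evaluation point is so close to the right end of the gap that the Cantor interval of
generation `k + 10` starting there outweighs everything on the left. All other mass on the right has
a positive kernel and is dropped. -/
theorem hilbert_right_nonneg {k : ℕ} (w : Fin k → Bool) :
    0 ≤ TwoWeight.hilbert measure 1 (leftEnd w + 2 / 3 ^ (k + 1) - 1 / 3 ^ (k + 10)) := by
  set z := leftEnd w + 2 / 3 ^ (k + 1) - 1 / 3 ^ (k + 10) with hz
  obtain ⟨h0, h1, h2⟩ := scale_facts k
  have hgap : z ∈ gap w := ⟨by linarith, by linarith⟩
  set b := ext w with hb
  have hw : pre b k = w := pre_ext w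
  -- The code w 1 0 0 0 ... of the right end of the gap: `ext w` already continues by zeros.
  set b' : ℕ → Bool := fun i => if i = k then true else b i with hb'
  have hbb : Agree k b b' := fun i hi => by simp [hb', hi.ne]
  have hJ : leftEnd (pre b' (k + 10)) = leftEnd w + 2 / 3 ^ (k + 1) := by
    rw [leftEnd_pre_of_false (m := k + 1) (by omega), leftEnd_pre_succ, ← hbb.pre_eq, hw]
    · simp [hb']
    · intro i hi
      have : ¬ i < k := by omega
      have : i ≠ k := by omega
      simp [ext, *]
  obtain ⟨i1, e1⟩ := integral_tree b (fun n => 3 ^ (n + 2)) k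
  have i2 : Integrable ((interval (pre b' (k + 10))).indicator
      fun _ => (3 : ℝ) ^ (k + 10) / 2) measure :=
    (integrable_const _).indicator measurableSet_Icc
  have e2 : ∫ y, (interval (pre b' (k + 10))).indicator (fun _ => (3 : ℝ) ^ (k + 10) / 2) y ∂measure
      = 3 ^ (k + 10) / 2 * (1 / 2) ^ (k + 10) := by
    rw [integral_indicator (by exact measurableSet_Icc), setIntegral_const, measureReal_interval,
      smul_eq_mul, mul_comm]
  have key := integral_mono_ae (i2.sub i1) (converges_one hgap).2 (ae_of_point fun c => ?_)
  · simp only [Pi.sub_apply] at key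
    rw [integral_sub i2 i1, e1, e2] at key
    exact le_trans (by linarith [pow_ten_bound k]) key
  · simp only [Pi.sub_apply, Pi.one_apply]
    have hne : point c ≠ z := fun h => point_notMem_gap w c (h ▸ hgap)
    rcases lt_or_gt_of_ne hne with hlt | hlt
    · have hnot : point c ∉ interval (pre b' (k + 10)) := by
        intro h
        have := h.1
        rw [hJ] at this
        linarith
      rw [indicator_of_notMem hnot]
      have : ∃ n ≤ k, Agree n b c ∧ 1 / 3 ^ (n + 1) / 3 ≤ |point c - z| := by
        exact exists_agree_dist b c (by norm_num) (by rw [hw]; exact hgap.1)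
          (by rw [hw]; exact hgap.2) (fun _ => by rw [hw]; linarith) fun hc => absurd hc hlt.not_gt
      obtain ⟨n, hn, ha, hd⟩ := this
      have h3 := le_tree (f := fun n => (3 : ℝ) ^ (n + 2)) (fun n => by positivity) hn ha
      have h4 : 1 / |point c - z| ≤ 3 ^ (n + 2) := by
        rw [div_le_iff₀ (abs_pos.2 (sub_ne_zero.2 hne))]
        rw [div_div, ← pow_succ, div_le_iff₀ (by positivity)] at hd
        linarith
      have h5 : 1 / (point c - z) = -(1 / |point c - z|) := by
        rw [abs_of_neg (sub_neg.2 hlt), div_neg, neg_neg]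
      rw [h5]
      linarith
    · have h3 := tree_nonneg (b := b) (f := fun n => (3 : ℝ) ^ (n + 2)) (fun n => by positivity) k
        (point c)
      have h4 : (interval (pre b' (k + 10))).indicator (fun _ => (3 : ℝ) ^ (k + 10) / 2) (point c)
          ≤ 1 / (point c - z) := by
        have hpos : 0 < point c - z := sub_pos.2 hlt
        by_cases hy : point c ∈ interval (pre b' (k + 10))
        -- Both the distance from `z` to the end of the gap and the length of the small interval are
        -- 3^(-(k+10)), whence the factor 1/2 in the kernel bound.
        · rw [indicator_of_mem hy, le_div_iff₀ hpos]
          have h6 := hy.2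
          rw [hJ] at h6
          have h7 : (3 : ℝ) ^ (k + 10) * (1 / 3 ^ (k + 10)) = 1 := by field_simp
          nlinarith [pow_pos (zero_lt_three' ℝ) (k + 10)]
        · rw [indicator_of_notMem hy]
          positivity
      linarith

/-- The mirror image of `hilbert_right_nonneg`; the left end of the gap has the code w 0 1 1 1 ...
-/
theorem hilbert_left_nonpos {k : ℕ} (w : Fin k → Bool) :
    TwoWeight.hilbert measure 1 (leftEnd w + 1 / 3 ^ (k + 1) + 1 / 3 ^ (k + 10)) ≤ 0 := by
  set z := leftEnd w + 1 / 3 ^ (k + 1) + 1 / 3 ^ (k + 10) with hz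
  obtain ⟨h0, h1, h2⟩ := scale_facts k
  have hgap : z ∈ gap w := ⟨by linarith, by linarith⟩
  set b := ext w with hb
  have hw : pre b k = w := pre_ext w
  set b' : ℕ → Bool := fun i => if i < k then b i else decide (i ≠ k) with hb'
  have hbb : Agree k b b' := fun i hi => by simp [hb', hi]
  have hJ : leftEnd (pre b' (k + 10)) + 1 / 3 ^ (k + 10) = leftEnd w + 1 / 3 ^ (k + 1) := by
    rw [leftEnd_pre_of_true (m := k + 1) (by omega), leftEnd_pre_succ, ← hbb.pre_eq, hw]
    · simp [hb']
    · intro i hi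
      have h3 : ¬ i < k := by omega
      have h4 : i ≠ k := by omega
      simp [hb', h3, h4]
  obtain ⟨i1, e1⟩ := integral_tree b (fun n => 3 ^ (n + 2)) k
  have i2 : Integrable ((interval (pre b' (k + 10))).indicator
      fun _ => (3 : ℝ) ^ (k + 10) / 2) measure :=
    (integrable_const _).indicator measurableSet_Icc
  have e2 : ∫ y, (interval (pre b' (k + 10))).indicator (fun _ => (3 : ℝ) ^ (k + 10) / 2) y ∂measure
      = 3 ^ (k + 10) / 2 * (1 / 2) ^ (k + 10) := by
    rw [integral_indicator (by exact measurableSet_Icc), setIntegral_const, measureReal_interval,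
      smul_eq_mul, mul_comm]
  have key := integral_mono_ae (converges_one hgap).2 (i1.sub i2) (ae_of_point fun c => ?_)
  · simp only [Pi.sub_apply] at key
    rw [integral_sub i1 i2, e1, e2] at key
    exact key.trans (by linarith [pow_ten_bound k])
  · simp only [Pi.sub_apply, Pi.one_apply]
    have hne : point c ≠ z := fun h => point_notMem_gap w c (h ▸ hgap)
    rcases lt_or_gt_of_ne hne.symm with hlt | hlt
    · have hnot : point c ∉ interval (pre b' (k + 10)) := by
        intro h
        have := h.2
        rw [hJ] at this
        linarith
      rw [indicator_of_notMem hnot]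
      have : ∃ n ≤ k, Agree n b c ∧ 1 / 3 ^ (n + 1) / 3 ≤ |point c - z| := by
        exact exists_agree_dist b c (by norm_num) (by rw [hw]; exact hgap.1)
          (by rw [hw]; exact hgap.2) (fun hc => absurd hc hlt.not_gt) fun _ => by rw [hw]; linarith
      obtain ⟨n, hn, ha, hd⟩ := this
      have h3 := le_tree (f := fun n => (3 : ℝ) ^ (n + 2)) (fun n => by positivity) hn ha
      have h4 : 1 / |point c - z| ≤ 3 ^ (n + 2) := by
        rw [div_le_iff₀ (abs_pos.2 (sub_ne_zero.2 hne))]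
        rw [div_div, ← pow_succ, div_le_iff₀ (by positivity)] at hd
        linarith
      rw [abs_of_pos (sub_pos.2 hlt)] at h4
      linarith
    · have h3 := tree_nonneg (b := b) (f := fun n => (3 : ℝ) ^ (n + 2)) (fun n => by positivity) k
        (point c)
      have h4 : (interval (pre b' (k + 10))).indicator (fun _ => (3 : ℝ) ^ (k + 10) / 2) (point c)
          ≤ 1 / (z - point c) := by
        have hpos : 0 < z - point c := sub_pos.2 hlt
        by_cases hy : point c ∈ interval (pre b' (k + 10))
        · rw [indicator_of_mem hy, le_div_iff₀ hpos]
          have h6 := hy.1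
          have h7 : (3 : ℝ) ^ (k + 10) * (1 / 3 ^ (k + 10)) = 1 := by field_simp
          nlinarith [pow_pos (zero_lt_three' ℝ) (k + 10)]
        · rw [indicator_of_notMem hy]
          positivity
      have h5 : 1 / (point c - z) = -(1 / (z - point c)) := by
        rw [← neg_sub, div_neg]
      rw [h5]
      linarith

theorem zero_endpoints {k : ℕ} (w : Fin k → Bool) :
    leftEnd w + 1 / 3 ^ (k + 1) + 1 / 3 ^ (k + 10) ∈ gap w ∧
    leftEnd w + 2 / 3 ^ (k + 1) - 1 / 3 ^ (k + 10) ∈ gap w := by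
  obtain ⟨h0, h1, h2⟩ := scale_facts k
  exact ⟨⟨by linarith, by linarith⟩, ⟨by linarith, by linarith⟩⟩

theorem existsUnique_zero {k : ℕ} (w : Fin k → Bool) :
    ∃! z : ℝ, z ∈ gap w ∧ TwoWeight.hilbert measure 1 z = 0 := by
  obtain ⟨h0, h1, h2⟩ := scale_facts k
  obtain ⟨m1, m2⟩ := zero_endpoints w
  have hsub : Icc (leftEnd w + 1 / 3 ^ (k + 1) + 1 / 3 ^ (k + 10))
      (leftEnd w + 2 / 3 ^ (k + 1) - 1 / 3 ^ (k + 10)) ⊆ gap w :=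
    fun x hx => ⟨m1.1.trans_le hx.1, hx.2.trans_lt m2.2⟩
  obtain ⟨z, hz, h⟩ := intermediate_value_Icc (by linarith) ((hilbert_continuousOn w).mono hsub)
    ⟨hilbert_left_nonpos w, hilbert_right_nonneg w⟩
  exact ⟨z, ⟨hsub hz, h⟩, fun y hy =>
    (hilbert_strictMonoOn w).injOn hy.1 (hsub hz) (hy.2.trans h.symm)⟩

/-! ### Position of the zeros relative to the Cantor set -/

theorem zero_spec {k : ℕ} (w : Fin k → Bool) :
    zero w ∈ gap w ∧ TwoWeight.hilbert measure 1 (zero w) = 0 :=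
  Classical.epsilon_spec (existsUnique_zero w).exists

/-- Monotonicity turns the signs of Hω at two points near the ends into a location of the zero, with
a uniform relative distance from the ends. -/
theorem zero_mem_Icc {k : ℕ} (w : Fin k → Bool) :
    zero w ∈ Icc (leftEnd w + 1 / 3 ^ (k + 1) + 1 / 3 ^ (k + 10))
      (leftEnd w + 2 / 3 ^ (k + 1) - 1 / 3 ^ (k + 10)) := by
  obtain ⟨m1, m2⟩ := zero_endpoints w
  obtain ⟨h1, h2⟩ := zero_spec w
  constructor
  · exact ((hilbert_strictMonoOn w).le_iff_le m1 h1).1 (h2.symm ▸ hilbert_left_nonpos w)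
  · exact ((hilbert_strictMonoOn w).le_iff_le h1 m2).1 (h2.symm ▸ hilbert_right_nonneg w)

theorem zero_mem_interval {k : ℕ} (w : Fin k → Bool) : zero w ∈ interval w :=
  gap_subset w (zero_spec w).1

/-- The zero in a gap along `b` and the points of the Cantor set are separated on the scale
at which their codes part. -/
theorem exists_agree_zero (k : ℕ) (b c : ℕ → Bool) :
    ∃ n ≤ k, Agree n b c ∧ 1 / |point c - zero (pre b k)| ≤ 3 ^ 10 * 3 ^ n := by
  obtain ⟨h0, h1, h2⟩ := scale_facts k
  have h := zero_mem_Icc (pre b k)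
  have hg := (zero_spec (pre b k)).1
  -- The gap has length 3^(-(k+1)) and the zero is 3^(-(k+10)) away from its ends: hence `δ = 3 ^
  -- 9`, and the final constant 3^10 includes the shift from `n + 1` to `n`.
  have e : (1 : ℝ) / 3 ^ (k + 1) / 3 ^ 9 = 1 / 3 ^ (k + 10) := by
    rw [div_div, ← pow_add]
  obtain ⟨n, hn, ha, hd⟩ := exists_agree_dist b c (δ := 3 ^ 9) (by norm_num) hg.1 hg.2
    (fun _ => by rw [e]; linarith [h.1]) (fun _ => by rw [e]; linarith [h.2])
  refine ⟨n, hn, ha, ?_⟩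
  have hpos : 0 < |point c - zero (pre b k)| := lt_of_lt_of_le (by positivity) hd
  rw [div_div, ← pow_add, div_le_iff₀ (by positivity)] at hd
  rw [div_le_iff₀ hpos, ← pow_add, show 10 + n = n + 1 + 9 by ring]
  linarith

theorem point_ne_zero (k : ℕ) (w : Fin k → Bool) (c : ℕ → Bool) : point c ≠ zero w :=
  fun h => point_notMem_gap w c (h ▸ (zero_spec w).1)

/-- Of two zeros whose codes part at the digit `n`, the zero of the gap of generation `n` lies
between them; the same holds for points of the Cantor set. -/
theorem zero_between {b c : ℕ → Bool} {n k l : ℕ} (ha : Agree n b c) (hne : b n ≠ c n)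
    (hk : n < k) (hl : n < l) {x y : ℝ} (hx : x ∈ interval (pre b k))
    (hy : y ∈ interval (pre c l)) : zero (pre b n) ∈ uIcc x y := by
  have h1 := interval_side hk hx
  have h2 := interval_side hl hy
  rw [← ha.pre_eq] at h2
  have h3 := (zero_spec (pre b n)).1
  cases hb : b n <;> cases hc : c n
  · exact absurd (hb.trans hc.symm) hne
  · exact mem_uIcc.2 (Or.inl ⟨by linarith [h1.1 hb, h3.1], by linarith [h2.2 hc, h3.2]⟩)
  · exact mem_uIcc.2 (Or.inr ⟨by linarith [h2.1 hc, h3.1], by linarith [h1.2 hb, h3.2]⟩)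
  · exact absurd (hb.trans hc.symm) hne

end Cantor

/-! ### The discrete measure on the zeros -/

namespace TwoWeight

theorem IsInterval.measurableSet {I : Set ℝ} (h : IsInterval I) : MeasurableSet I :=
  h.1.measurableSet

theorem enorm_hilbert_le (ν : Measure ℝ) (f : ℝ → ℝ) (x : ℝ) :
    ‖hilbert ν f x‖ₑ ≤ ∫⁻ y, ‖f y / (y - x)‖ₑ ∂ν :=
  enorm_integral_le_lintegral_enorm _

theorem ofReal_abs_rpow (a : ℝ) {p : ℝ} (hp : 0 ≤ p) :
    ENNReal.ofReal (|a| ^ p) = ‖a‖ₑ ^ p := by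
  rw [← ENNReal.ofReal_rpow_of_nonneg (abs_nonneg a) hp, Real.enorm_eq_ofReal_abs]

/-- With truncated subtraction, `(k - m) + (m - k)` is |k - m|: geometric decay away from a critical
generation `m`, in both directions. -/
theorem tsum_le_of_two_sided {f : ℕ → ℝ≥0∞} {K ρ : ℝ} (m : ℕ) (hK : 0 ≤ K) (h0 : 0 < ρ)
    (h1 : ρ < 1) (h : ∀ k, f k ≤ ENNReal.ofReal (K * ρ ^ ((k - m) + (m - k)))) :
    ∑' k, f k ≤ ENNReal.ofReal (2 * K / (1 - ρ)) := by
  have hs : HasSum (fun k : ℕ => K * ρ ^ k) (K * (1 - ρ)⁻¹) :=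
    (hasSum_geometric_of_lt_one h0.le h1).mul_left K
  have hnn : ∀ k : ℕ, 0 ≤ K * ρ ^ k := fun k => by positivity
  have hinv : 0 < (1 - ρ)⁻¹ := inv_pos.2 (sub_pos.2 h1)
  rw [← Summable.sum_add_tsum_nat_add' (k := m) ENNReal.summable,
    show 2 * K / (1 - ρ) = K * (1 - ρ)⁻¹ + K * (1 - ρ)⁻¹ by ring,
    ENNReal.ofReal_add (by positivity) (by positivity)]
  refine add_le_add ?_ ?_
  · rw [← Finset.sum_range_reflect]
    refine (Finset.sum_le_sum (g := fun j => ENNReal.ofReal (K * ρ ^ j)) fun j hj => ?_).trans ?_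
    · have hj' := Finset.mem_range.1 hj
      refine (h _).trans (ENNReal.ofReal_le_ofReal ?_)
      refine mul_le_mul_of_nonneg_left (pow_le_pow_of_le_one h0.le h1.le ?_) hK
      omega
    · rw [← ENNReal.ofReal_sum_of_nonneg fun j _ => hnn j]
      exact ENNReal.ofReal_le_ofReal (sum_le_hasSum _ (fun j _ => hnn j) hs)
  · rw [← hs.tsum_eq, ENNReal.ofReal_tsum_of_nonneg hnn hs.summable]
    refine ENNReal.tsum_le_tsum fun k => (h _).trans (le_of_eq ?_)
    congr 3
    omega

end TwoWeight

namespace Cantor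

open TwoWeight

/-- The mass of the point of generation `k` of the discrete measure with exponent `t`. -/
noncomputable def mass (t : ℝ) (k : ℕ) : ℝ := (2 : ℝ)⁻¹ ^ k * (2 / 3 : ℝ) ^ ((k : ℝ) * t)

/-- The discrete measure on the zeros, parametrized by the exponent of its masses. -/
noncomputable def sig (t : ℝ) : Measure ℝ :=
  Measure.sum fun v : (k : ℕ) × (Fin k → Bool) =>
    ENNReal.ofReal (mass t v.1) • Measure.dirac (zero v.2)

theorem sigma_eq (p : ℝ) : sigma p = sig p.conjExponent := rfl

theorem mass_eq (t : ℝ) (k : ℕ) : mass t k = ((2 / 3 : ℝ) ^ t / 2) ^ k := by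
  rw [mass, mul_comm (k : ℝ), Real.rpow_mul (by norm_num), Real.rpow_natCast, div_pow, inv_pow]
  ring

theorem mass_pos (t : ℝ) (k : ℕ) : 0 < mass t k := by
  rw [mass_eq]; positivity

theorem lintegral_sig (t : ℝ) (g : ℝ → ℝ≥0∞) :
    ∫⁻ x, g x ∂(sig t) = ∑' k, ∑ w : Fin k → Bool, ENNReal.ofReal (mass t k) * g (zero w) := by
  rw [sig, lintegral_sum_measure, ENNReal.tsum_sigma']
  refine tsum_congr fun k => ?_
  rw [tsum_fintype]
  refine Finset.sum_congr rfl fun w _ => ?_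
  rw [lintegral_smul_measure, lintegral_dirac, smul_eq_mul]

theorem ae_sig {t : ℝ} {P : ℝ → Prop} (h : ∀ k (w : Fin k → Bool), P (zero w)) :
    ∀ᵐ x ∂(sig t), P x := by
  rw [sig, Measure.ae_sum_iff]
  rintro ⟨k, w⟩
  refine Measure.ae_smul_measure ?_ _
  rw [ae_dirac_eq]
  exact h k w

theorem mass_le_sig {t : ℝ} {k : ℕ} {w : Fin k → Bool} {s : Set ℝ} (h : zero w ∈ s)
    (hs : MeasurableSet s) : ENNReal.ofReal (mass t k) ≤ sig t s := by
  rw [← lintegral_indicator_one hs, lintegral_sig]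
  refine le_trans ?_ (ENNReal.le_tsum k)
  refine le_trans ?_ (Finset.single_le_sum (fun _ _ => zero_le) (Finset.mem_univ w))
  simp [h]

theorem sig_singleton_point (t : ℝ) (c : ℕ → Bool) : sig t {point c} = 0 := by
  rw [← lintegral_indicator_one (measurableSet_singleton _), lintegral_sig]
  simp only [ENNReal.tsum_eq_zero]
  intro k
  refine Finset.sum_eq_zero fun w _ => ?_
  simp [(point_ne_zero k w c).symm]

theorem rpow_two_thirds_lt {t : ℝ} (ht : 1 < t) : (2 / 3 : ℝ) ^ t < 2 / 3 := by
  have := Real.rpow_lt_rpow_of_exponent_gt (x := 2 / 3) (by norm_num) (by norm_num) ht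
  rwa [Real.rpow_one] at this

/-- The words of length `k` are grouped by a scale `n` on which they share digits with `c`; there
are 2^(k-n) words sharing the first `n` digits. -/
theorem level_sum_le {k : ℕ} (c : ℕ → Bool) {h : (Fin k → Bool) → ℝ} {f : ℕ → ℝ}
    (hf : ∀ n, 0 ≤ f n) (hh : ∀ w, ∃ n ≤ k, Agree n (ext w) c ∧ h w ≤ f n) :
    ∑ w, h w ≤ ∑ n ∈ Finset.range (k + 1), f n * 2 ^ (k - n) := by
  have h1 : ∀ w, h w ≤ ∑ n ∈ Finset.range (k + 1), if Agree n (ext w) c then f n else 0 := by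
    intro w
    obtain ⟨n, hn, ha, hle⟩ := hh w
    refine hle.trans ?_
    have := Finset.single_le_sum (f := fun n => if Agree n (ext w) c then f n else 0)
      (fun i _ => by split_ifs; exacts [hf i, le_rfl])
      (Finset.mem_range.2 (Nat.lt_succ_of_le hn))
    simpa [ha] using this
  refine (Finset.sum_le_sum fun w _ => h1 w).trans ?_
  rw [Finset.sum_comm]
  refine Finset.sum_le_sum fun n hn => ?_
  rw [← Finset.sum_filter, Finset.sum_const,
    card_agree c (Nat.lt_succ_iff.1 (Finset.mem_range.1 hn)), nsmul_eq_mul, mul_comm]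
  push_cast
  exact le_rfl

theorem two_pow_sub {n k : ℕ} (h : n ≤ k) : (2 : ℝ) ^ (k - n) = 2 ^ k * (1 / 2) ^ n := by
  rw [pow_sub₀ _ two_ne_zero h, one_div, inv_pow]

/-- Scale `n` contributes 3^n 2^(k-n), which increases in `n`, so the sum over a generation is
comparable with its nearest term. -/
theorem level_kernel_le (k : ℕ) (c : ℕ → Bool) :
    ∑ w : Fin k → Bool, 1 / |point c - zero w| ≤ 3 ^ 11 * 3 ^ k := by
  refine (level_sum_le c (f := fun n => 3 ^ 10 * 3 ^ n) (fun n => by positivity) fun w => ?_).trans ?_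
  · have := exists_agree_zero k (ext w) c
    rwa [pre_ext] at this
  · have e : ∀ n ∈ Finset.range (k + 1), (3 : ℝ) ^ 10 * 3 ^ n * 2 ^ (k - n) =
        3 ^ 10 * 2 ^ k * (3 / 2) ^ n := by
      intro n hn
      rw [two_pow_sub (Nat.lt_succ_iff.1 (Finset.mem_range.1 hn)), div_pow, div_pow]
      ring
    rw [Finset.sum_congr rfl e, ← Finset.mul_sum]
    refine (mul_le_mul_of_nonneg_left (geom_sum_le le_rfl k) (by positivity)).trans (le_of_eq ?_)
    rw [div_pow]
    field_simp

/-- The kernel is integrable for the discrete measure at the points of the Cantor set; if a set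
contains no zeros of generation below `m`, the integral over it is small. -/
theorem lintegral_kernel_sig {t : ℝ} (ht : 1 < t) (c : ℕ → Bool) {I : Set ℝ} {m : ℕ}
    (hI : ∀ k < m, ∀ w : Fin k → Bool, zero w ∉ I) :
    ∫⁻ y, ‖I.indicator 1 y / (y - point c)‖ₑ ∂(sig t) ≤
      ENNReal.ofReal (2 * 3 ^ 11 * (3 / 2 * (2 / 3 : ℝ) ^ t) ^ m / (1 - 3 / 2 * (2 / 3 : ℝ) ^ t)) := by
  have h1 := rpow_two_thirds_lt ht
  have h0 : (0 : ℝ) < (2 / 3 : ℝ) ^ t := by positivity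
  set ρ : ℝ := 3 / 2 * (2 / 3 : ℝ) ^ t with hρ
  rw [lintegral_sig, mul_assoc]
  -- Generation `k` contributes a constant times `mass t k * 3 ^ k = ρ ^ k`, and `ρ < 1` because `t
  -- > 1`. Generations below `m` contribute nothing, so only one side of the two-sided bound is
  -- used.
  refine tsum_le_of_two_sided m (by positivity) (by positivity) (by linarith) fun k => ?_
  by_cases hk : k < m
  · rw [Finset.sum_eq_zero]
    · exact zero_le
    · intro w _
      simp [hI k hk w]
  · have e : k - m + (m - k) + m = k := by omega
    rw [mul_assoc, ← pow_add, add_comm m, e]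
    have hle : ∀ w : Fin k → Bool, ‖I.indicator (1 : ℝ → ℝ) (zero w) / (zero w - point c)‖ₑ ≤
        ENNReal.ofReal (1 / |point c - zero w|) := by
      intro w
      rw [Real.enorm_eq_ofReal_abs, abs_div, abs_sub_comm]
      refine ENNReal.ofReal_le_ofReal (div_le_div_of_nonneg_right ?_ (abs_nonneg _))
      by_cases hw : zero w ∈ I <;> simp [hw]
    refine (Finset.sum_le_sum fun w _ => mul_le_mul_right (hle w) _).trans ?_
    rw [← Finset.mul_sum, ← ENNReal.ofReal_sum_of_nonneg fun w _ => by positivity,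
      ← ENNReal.ofReal_mul (mass_pos t k).le]
    refine ENNReal.ofReal_le_ofReal ?_
    refine (mul_le_mul_of_nonneg_left (level_kernel_le k c) (mass_pos t k).le).trans (le_of_eq ?_)
    rw [mass_eq, hρ, mul_pow, div_pow, div_pow]
    ring

theorem converges_sig {t : ℝ} (ht : 1 < t) (c : ℕ → Bool) {I : Set ℝ} (hI : MeasurableSet I) :
    Converges (sig t) (I.indicator 1) (point c) := by
  refine ⟨sig_singleton_point t c, ?_, ?_⟩
  · exact (((measurable_const (a := (1 : ℝ))).indicator hI).div
      (measurable_id.sub_const _)).aestronglyMeasurable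
  · exact (lintegral_kernel_sig ht c (m := 0) (fun k hk => absurd hk (Nat.not_lt_zero k))).trans_lt
      ENNReal.ofReal_lt_top

theorem isFiniteMeasure_sig {t : ℝ} (ht : 1 < t) : IsFiniteMeasure (sig t) := by
  have h1 := rpow_two_thirds_lt ht
  have h0 : (0 : ℝ) < (2 / 3 : ℝ) ^ t := by positivity
  refine ⟨?_⟩
  rw [← lintegral_one, lintegral_sig]
  refine (tsum_le_of_two_sided (K := 1) 0 zero_le_one h0 (by linarith) fun k => ?_).trans_lt
    ENNReal.ofReal_lt_top
  rw [Finset.sum_const, Finset.card_univ, Fintype.card_fun, Fintype.card_bool, Fintype.card_fin,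
    mul_one, nsmul_eq_mul, ← ENNReal.ofReal_natCast, ← ENNReal.ofReal_mul (by positivity)]
  refine ENNReal.ofReal_le_ofReal (le_of_eq ?_)
  rw [mass_eq, div_pow]
  push_cast
  simp
  field_simp

/-- The testing condition for the discrete measure holds already without cancellation. -/
theorem testing_sig {p q : ℝ} (h : p.HolderConjugate q) : HilbertTesting p (sig q) measure := by
  have hq := h.symm.lt
  have hp := h.lt
  have h1 := rpow_two_thirds_lt hq
  have h0 : (0 : ℝ) < (2 / 3 : ℝ) ^ q := by positivity
  set ρ : ℝ := 3 / 2 * (2 / 3 : ℝ) ^ q with hρ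
  have hρ1 : 0 < 1 - ρ := by linarith
  refine ⟨⟨2 * 3 ^ 11 / (1 - ρ), by positivity⟩, fun I hI => ⟨?_, ?_⟩⟩
  · exact ae_restrict_of_ae (ae_of_point fun c => converges_sig hq c hI.measurableSet)
  · simp only [ofReal_abs_rpow _ h.pos.le]
    by_cases hz : ∃ k, ∃ w : Fin k → Bool, zero w ∈ I
    · classical
      obtain ⟨m, ⟨w₀, hw₀⟩, hmin⟩ : ∃ m, (∃ w : Fin m → Bool, zero w ∈ I) ∧
          ∀ k < m, ∀ w : Fin k → Bool, zero w ∉ I :=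
        ⟨Nat.find hz, Nat.find_spec hz, fun k hk w hw => Nat.find_min hz hk ⟨w, hw⟩⟩
      -- A Cantor point of `I` outside the interval of `w₀` would be separated from `zero w₀` by a
      -- zero of an earlier generation, which would lie in `I` and contradict the minimality of `m`.
      have hsub : I ≤ᵐ[measure] interval w₀ := by
        refine ae_of_point fun c hc => ?_
        obtain ⟨n, hn, ha, hne⟩ := exists_agree m (ext w₀) c
        rcases hn.lt_or_eq with hlt | rfl
        · refine absurd ?_ (hmin n hlt (pre (ext w₀) n))
          refine hI.1.uIcc_subset hw₀ hc (zero_between ha (hne hlt) hlt (Nat.lt_succ_self n)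
            ?_ (mem_interval_point c _))
          rw [pre_ext]
          exact zero_mem_interval _
        · have := point_mem_pre.2 ha
          rwa [pre_ext] at this
      calc ∫⁻ x in I, ‖hilbert (sig q) (I.indicator 1) x‖ₑ ^ p ∂measure
          ≤ ∫⁻ x in I, ENNReal.ofReal (2 * 3 ^ 11 * ρ ^ m / (1 - ρ)) ^ p ∂measure := by
            refine lintegral_mono_ae (ae_restrict_of_ae (ae_of_point fun c => ?_))
            exact ENNReal.rpow_le_rpow ((enorm_hilbert_le _ _ _).trans
              (lintegral_kernel_sig hq c hmin)) h.pos.le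
        _ = ENNReal.ofReal (2 * 3 ^ 11 * ρ ^ m / (1 - ρ)) ^ p * measure I := by
            rw [setLIntegral_const]
        _ ≤ ENNReal.ofReal (2 * 3 ^ 11 * ρ ^ m / (1 - ρ)) ^ p * ENNReal.ofReal ((1 / 2) ^ m) := by
            refine mul_le_mul_right ((measure_mono_ae hsub).trans (le_of_eq ?_)) _
            rw [← measureReal_interval w₀, ofReal_measureReal]
        _ = ENNReal.ofReal ((2 * 3 ^ 11 / (1 - ρ)) ^ p) * ENNReal.ofReal (mass q m) := by
            rw [ENNReal.ofReal_rpow_of_nonneg (by positivity) h.pos.le,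
              ← ENNReal.ofReal_mul (by positivity), ← ENNReal.ofReal_mul (by positivity)]
            congr 1
            have hpow : (ρ ^ m) ^ p = ((2 / 3 : ℝ) ^ q) ^ m := by
              rw [← Real.rpow_natCast ρ, ← Real.rpow_mul (by positivity), mul_comm (m : ℝ),
                Real.rpow_mul (by positivity), Real.rpow_natCast]
              congr 1
              -- As (q - 1) p = q, the estimate ρ^(mp) 2^(-m) is exactly the mass of the single atom
              -- at `zero w₀`, which lies in `I`.
              have e : ρ = (2 / 3 : ℝ) ^ (q - 1) := by
                rw [Real.rpow_sub_one (by norm_num), hρ]; ring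
              rw [e, ← Real.rpow_mul (by norm_num)]
              congr 1
              exact h.symm.sub_one_mul_conj
            rw [mul_div_right_comm, Real.mul_rpow (by positivity) (by positivity), hpow, mass_eq,
              div_pow, div_pow]
            ring
        _ ≤ _ := mul_le_mul_right (mass_le_sig hw₀ hI.measurableSet) _
    · push Not at hz
      have : ∀ x, hilbert (sig q) (I.indicator 1) x = 0 := by
        intro x
        refine integral_eq_zero_of_ae (ae_sig fun k w => ?_)
        simp [hz k w]
      simp [this, h.pos]

end Cantor

/-! ### The testing condition for the Cantor measure -/

namespace Cantor

open TwoWeight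

theorem interval_separated {k : ℕ} {w w' : Fin k → Bool} (h : w ≠ w') :
    (∀ x ∈ interval w, ∀ y ∈ interval w', x < y) ∨ (∀ x ∈ interval w, ∀ y ∈ interval w', y < x) := by
  obtain ⟨n, hn, ha, hne⟩ := exists_agree k (ext w) (ext w')
  rcases hn.lt_or_eq with hlt | rfl
  · have hpos : (1 : ℝ) / 3 ^ (n + 1) < 2 / 3 ^ (n + 1) :=
      div_lt_div_of_pos_right (by norm_num) (by positivity)
    have key : ∀ x ∈ interval w, ∀ y ∈ interval w',
        (ext w n = false → ext w' n = true → x < y) ∧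
        (ext w n = true → ext w' n = false → y < x) := by
      intro x hx y hy
      rw [← pre_ext w] at hx
      rw [← pre_ext w'] at hy
      have h1 := interval_side hlt hx
      have h2 := interval_side hlt hy
      rw [← ha.pre_eq] at h2
      exact ⟨fun e1 e2 => by linarith [h1.1 e1, h2.2 e2], fun e1 e2 => by linarith [h1.2 e1, h2.1 e2]⟩
    have hne' := hne hlt
    cases h1 : ext w n <;> cases h2 : ext w' n
    · exact absurd (h1.trans h2.symm) hne'
    · exact Or.inl fun x hx y hy => (key x hx y hy).1 h1 h2
    · exact Or.inr fun x hx y hy => (key x hx y hy).2 h1 h2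
    · exact absurd (h1.trans h2.symm) hne'
  · have := ha.pre_eq
    rw [pre_ext, pre_ext] at this
    exact absurd this h

theorem leftEnd_mem {k : ℕ} (w : Fin k → Bool) : leftEnd w ∈ interval w :=
  ⟨le_rfl, by linarith [show (0 : ℝ) < 1 / 3 ^ k by positivity]⟩

/-- At most two Cantor intervals of a generation meet an interval without lying in it. -/
theorem card_boundary_le {k : ℕ} {I : Set ℝ} (hI : I.OrdConnected) {S : Finset (Fin k → Bool)}
    (hS : ∀ w ∈ S, (interval w ∩ I).Nonempty ∧ ¬ interval w ⊆ I) : S.card ≤ 2 := by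
  rcases S.eq_empty_or_nonempty with rfl | hne
  · simp
  obtain ⟨u, hu, humin⟩ := S.exists_min_image leftEnd hne
  obtain ⟨v, hv, hvmax⟩ := S.exists_max_image leftEnd hne
  refine (Finset.card_le_card (t := {u, v}) fun w hw => ?_).trans Finset.card_le_two
  by_contra hcon
  simp only [Finset.mem_insert, Finset.mem_singleton, not_or] at hcon
  refine (hS w hw).2 fun y hy => ?_
  obtain ⟨x₁, h1, h1'⟩ := (hS u hu).1
  obtain ⟨x₂, h2, h2'⟩ := (hS v hv).1
  have e1 : x₁ < y := by
    rcases interval_separated hcon.1 with h | h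
    · exact absurd (h _ (leftEnd_mem w) _ (leftEnd_mem u)) (humin w hw).not_gt
    · exact h _ hy _ h1
  have e2 : y < x₂ := by
    rcases interval_separated hcon.2 with h | h
    · exact h _ hy _ h2
    · exact absurd (h _ (leftEnd_mem w) _ (leftEnd_mem v)) (hvmax w hw).not_gt
  exact hI.out h1' h2' ⟨e1.le, e2.le⟩

theorem card_subset_le {k : ℕ} {I : Set ℝ} {S : Finset (Fin k → Bool)}
    (hS : ∀ w ∈ S, interval w ⊆ I) : (S.card : ℝ) ≤ 2 ^ k * measure.real I := by
  have hd : (S : Set (Fin k → Bool)).PairwiseDisjoint interval := by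
    intro w _ w' _ h
    refine Set.disjoint_left.2 fun x hx hx' => ?_
    rcases interval_separated h with h | h
    · exact lt_irrefl x (h x hx x hx')
    · exact lt_irrefl x (h x hx x hx')
  have h1 : measure.real (⋃ w ∈ S, interval w) ≤ measure.real I :=
    measureReal_mono (iUnion₂_subset hS)
  rw [measureReal_biUnion_finset hd fun w _ => measurableSet_Icc,
    Finset.sum_congr rfl fun w _ => measureReal_interval w, Finset.sum_const, nsmul_eq_mul,
    one_div, inv_pow, ← div_eq_mul_inv, div_le_iff₀ (by positivity)] at h1
  linarith

theorem converges_indicator {k : ℕ} (w : Fin k → Bool) {S : Set ℝ} (hS : MeasurableSet S) :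
    Converges measure (S.indicator 1) (zero w) := by
  obtain ⟨h1, h2⟩ := converges_one (zero_spec w).1
  refine ⟨h1, (h2.indicator hS).congr (Filter.Eventually.of_forall fun y => ?_)⟩
  by_cases hy : y ∈ S <;> simp [hy]

/-- A point of `S` that parts from the zero at scale `n` lies in the ancestor of generation `n` and
has kernel at most 3^10 3^n. -/
theorem abs_hilbert_indicator_le {S : Set ℝ} (hS : MeasurableSet S) (b : ℕ → Bool) (k : ℕ) :
    |hilbert measure (S.indicator 1) (zero (pre b k))| ≤
      ∑ n ∈ Finset.range (k + 1), 3 ^ 10 * 3 ^ n * measure.real (S ∩ interval (pre b n)) := by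
  have hm : ∀ n, MeasurableSet (S ∩ interval (pre b n)) := fun n => hS.inter measurableSet_Icc
  have hi : ∀ n, Integrable (fun y => (3 : ℝ) ^ 10 * 3 ^ n *
      (S ∩ interval (pre b n)).indicator (1 : ℝ → ℝ) y) measure :=
    fun n => ((integrable_const (1 : ℝ)).indicator (hm n)).const_mul _
  have e : ∫ y, ∑ n ∈ Finset.range (k + 1), (3 : ℝ) ^ 10 * 3 ^ n *
      (S ∩ interval (pre b n)).indicator 1 y ∂measure =
      ∑ n ∈ Finset.range (k + 1), 3 ^ 10 * 3 ^ n * measure.real (S ∩ interval (pre b n)) := by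
    rw [integral_finsetSum _ fun n _ => hi n]
    refine Finset.sum_congr rfl fun n _ => ?_
    rw [integral_const_mul, integral_indicator_one (hm n)]
  rw [← e, ← Real.norm_eq_abs]
  refine norm_integral_le_of_norm_le (integrable_finsetSum _ fun n _ => hi n) (ae_of_point fun c => ?_)
  have hnn : ∀ n, 0 ≤ (3 : ℝ) ^ 10 * 3 ^ n *
      (S ∩ interval (pre b n)).indicator (1 : ℝ → ℝ) (point c) := fun n =>
    mul_nonneg (by positivity) (indicator_nonneg (fun _ _ => zero_le_one) _)
  by_cases hc : point c ∈ S
  · obtain ⟨n, hn, ha, hd⟩ := exists_agree_zero k b c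
    refine le_trans ?_ (Finset.single_le_sum (fun n _ => hnn n)
      (Finset.mem_range.2 (Nat.lt_succ_of_le hn)))
    simpa [hc, point_mem_pre.2 ha] using hd
  · simp only [indicator_of_notMem hc, zero_div, norm_zero]
    exact Finset.sum_nonneg fun n _ => hnn n

theorem abs_hilbert_indicator_le_measure {S : Set ℝ} (hS : MeasurableSet S) {k : ℕ}
    (w : Fin k → Bool) :
    |hilbert measure (S.indicator 1) (zero w)| ≤ 3 ^ 10 * 3 ^ k * measure.real S := by
  have e : ∫ y, (3 : ℝ) ^ 10 * 3 ^ k * S.indicator 1 y ∂measure =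
      3 ^ 10 * 3 ^ k * measure.real S := by
    rw [integral_const_mul, integral_indicator_one hS]
  rw [← e, ← Real.norm_eq_abs]
  refine norm_integral_le_of_norm_le (((integrable_const (1 : ℝ)).indicator hS).const_mul _)
    (ae_of_point fun c => ?_)
  by_cases hc : point c ∈ S
  · obtain ⟨n, hn, ha, hd⟩ := exists_agree_zero k (ext w) c
    rw [pre_ext] at hd
    have h3 : (3 : ℝ) ^ n ≤ 3 ^ k := pow_le_pow_right₀ (by norm_num) hn
    simp only [indicator_of_mem hc, Pi.one_apply, norm_div, norm_one, Real.norm_eq_abs]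
    linarith
  · simp [hc]

/-- The cancellation behind the testing condition for ω: mass inside `S` can be traded for mass
outside because Hω vanishes at the zeros. -/
theorem hilbert_indicator_compl {S : Set ℝ} (hS : MeasurableSet S) {k : ℕ} (w : Fin k → Bool) :
    hilbert measure (S.indicator 1) (zero w) = - hilbert measure (Sᶜ.indicator 1) (zero w) := by
  have h := (zero_spec w).2
  rw [eq_neg_iff_add_eq_zero, ← h]
  unfold hilbert
  rw [← integral_add (converges_indicator w hS).2 (converges_indicator w hS.compl).2]
  refine integral_congr_ae (Filter.Eventually.of_forall fun y => ?_)
  by_cases hy : y ∈ S <;> simp [hy]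

/-- The last index at which `P` holds dominates the increasing geometric sum. -/
theorem sum_geom_filter {P : ℕ → Prop} [DecidablePred P] (k : ℕ) :
    (∑ n ∈ Finset.range (k + 1), if P n then (3 / 2 : ℝ) ^ n else 0) = 0 ∨
    ∃ n ≤ k, P n ∧ (∑ n ∈ Finset.range (k + 1), if P n then (3 / 2 : ℝ) ^ n else 0) ≤
      3 * (3 / 2) ^ n := by
  induction k with
  | zero => by_cases h : P 0 <;> simp [h]
  | succ k ih =>
    by_cases h : P (k + 1)
    · refine Or.inr ⟨k + 1, le_rfl, h, le_trans (Finset.sum_le_sum fun n _ => ?_)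
        (geom_sum_le (r := 3 / 2) le_rfl (k + 1))⟩
      split_ifs
      · exact le_rfl
      · positivity
    · rw [Finset.sum_range_succ, if_neg h, add_zero]
      rcases ih with h0 | ⟨n, hn, hP, hle⟩
      · exact Or.inl h0
      · exact Or.inr ⟨n, hn.trans (Nat.le_succ k), hP, hle⟩

/-- Since `Hω` vanishes at the zeros, only Cantor intervals that leave `I` contribute
to `H(1_I ω)` there. -/
theorem hilbert_indicator_boundary {I : Set ℝ} (hI : MeasurableSet I) {k : ℕ} (w : Fin k → Bool) :
    hilbert measure (I.indicator 1) (zero w) = 0 ∨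
    ∃ n ≤ k, ¬ interval (pre (ext w) n) ⊆ I ∧
      |hilbert measure (I.indicator 1) (zero w)| ≤ 3 ^ 11 * (3 / 2) ^ n := by
  classical
  have h1 := abs_hilbert_indicator_le hI.compl (ext w) k
  rw [pre_ext, ← abs_neg, ← hilbert_indicator_compl hI] at h1
  have h2 : ∑ n ∈ Finset.range (k + 1), 3 ^ 10 * 3 ^ n *
      measure.real (Iᶜ ∩ interval (pre (ext w) n)) ≤ 3 ^ 10 *
      ∑ n ∈ Finset.range (k + 1), if ¬ interval (pre (ext w) n) ⊆ I then (3 / 2 : ℝ) ^ n else 0 := by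
    rw [Finset.mul_sum]
    refine Finset.sum_le_sum fun n _ => ?_
    rw [mul_assoc]
    refine mul_le_mul_of_nonneg_left ?_ (by positivity)
    split_ifs with h
    · have : Iᶜ ∩ interval (pre (ext w) n) = ∅ := by
        ext x; simp only [mem_inter_iff, mem_compl_iff, mem_empty_iff_false, iff_false, not_and]
        exact fun hx hx' => hx (h hx')
      simp [this]
    · have : measure.real (Iᶜ ∩ interval (pre (ext w) n)) ≤ (1 / 2) ^ n := by
        rw [← measureReal_interval (pre (ext w) n)]
        exact measureReal_mono inter_subset_right
      refine (mul_le_mul_of_nonneg_left this (by positivity)).trans (le_of_eq ?_)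
      rw [← mul_pow]; norm_num
  rcases sum_geom_filter (P := fun n => ¬ interval (pre (ext w) n) ⊆ I) k with h0 | ⟨n, hn, hP, hle⟩
  · left
    rw [h0, mul_zero] at h2
    exact abs_eq_zero.1 (le_antisymm (h1.trans h2) (abs_nonneg _))
  · refine Or.inr ⟨n, hn, hP, (h1.trans h2).trans ?_⟩
    rw [show (3 : ℝ) ^ 11 = 3 ^ 10 * 3 by norm_num, mul_assoc]
    exact mul_le_mul_of_nonneg_left hle (by positivity)

/-! ### Counting zeros and summing the testing integral by generations -/

open Classical in
/-- The number of zeros of generation `k` in `I` whose ancestor of generation `n` leaves `I`. -/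
theorem card_zeros_le {I : Set ℝ} (hI : I.OrdConnected) {N n k : ℕ} (hN : N ≤ k) (hn : n ≤ k)
    (hω : measure.real I ≤ (1 / 2) ^ N) :
    ((Finset.univ.filter fun w : Fin k → Bool =>
      zero w ∈ I ∧ ¬ interval (pre (ext w) n) ⊆ I).card : ℝ) ≤
      3 * (3 / 2) ^ (k - N) * (4 / 3) ^ (k - n) := by
  set S := Finset.univ.filter fun w : Fin k → Bool =>
      zero w ∈ I ∧ ¬ interval (pre (ext w) n) ⊆ I with hS
  rcases le_total N n with h | h
  -- For `n ≥ N`, at most two ancestors of generation `n` meet `I` without lying in it, and each has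
  -- 2^(k-n) descendants. The factorization 2 = (3/2)(4/3) puts this case and the next into one
  -- bound that decays in both variables after multiplication by the masses.
  · have h1 : S.card ≤ 2 ^ (k - n) * (S.image fun w => pre (ext w) n).card := by
      refine Finset.card_le_mul_card_image S _ fun u _ => ?_
      rw [← card_agree (ext u) hn]
      refine Finset.card_le_card fun w hw => ?_
      rw [Finset.mem_filter] at hw ⊢
      refine ⟨Finset.mem_univ _, pre_eq_iff.1 ?_⟩
      rw [hw.2, pre_ext]
    have h2 : (S.image fun w => pre (ext w) n).card ≤ 2 := by
      refine card_boundary_le hI fun u hu => ?_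
      obtain ⟨w, hw, rfl⟩ := Finset.mem_image.1 hu
      obtain ⟨_, hw1, hw2⟩ := Finset.mem_filter.1 hw
      refine ⟨⟨zero w, interval_pre_subset (ext w) hn ?_, hw1⟩, hw2⟩
      rw [pre_ext]
      exact zero_mem_interval w
    have h3 : (S.card : ℝ) ≤ 2 ^ (k - n) * 2 := by
      exact_mod_cast h1.trans (Nat.mul_le_mul_left _ h2)
    have h4 : (3 / 2 : ℝ) ^ (k - n) ≤ (3 / 2) ^ (k - N) :=
      pow_le_pow_right₀ (by norm_num) (by omega)
    have h5 : (2 : ℝ) ^ (k - n) = (3 / 2) ^ (k - n) * (4 / 3) ^ (k - n) := by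
      rw [← mul_pow]; norm_num
    have h6 : (0 : ℝ) < (4 / 3) ^ (k - n) := by positivity
    have h7 : (0 : ℝ) < (3 / 2) ^ (k - n) := by positivity
    nlinarith
  -- For `n ≤ N` the condition on the ancestor is discarded: all zeros of generation `k` in `I`
  -- number at most 2^k ω(I) + 2 ≤ 3 · 2^(k-N).
  · have h1 : (S.filter fun w => ¬ interval w ⊆ I).card ≤ 2 := by
      refine card_boundary_le hI fun w hw => ?_
      obtain ⟨hw1, hw2⟩ := Finset.mem_filter.1 hw
      exact ⟨⟨zero w, zero_mem_interval w, (Finset.mem_filter.1 hw1).2.1⟩, hw2⟩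
    have h2 : ((S.filter fun w => interval w ⊆ I).card : ℝ) ≤ 2 ^ k * measure.real I :=
      card_subset_le fun w hw => (Finset.mem_filter.1 hw).2
    have h3 := Finset.card_filter_add_card_filter_not (s := S) (fun w => interval w ⊆ I)
    have h4 : (S.card : ℝ) ≤ 2 ^ k * measure.real I + 2 := by
      rw [← h3]; push_cast
      have : ((S.filter fun w => ¬ interval w ⊆ I).card : ℝ) ≤ 2 := by exact_mod_cast h1
      linarith
    have h5 : (2 : ℝ) ^ k * measure.real I ≤ 2 ^ (k - N) := by
      rw [two_pow_sub hN]
      exact mul_le_mul_of_nonneg_left hω (by positivity)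
    have h6 : (1 : ℝ) ≤ 2 ^ (k - N) := one_le_pow₀ (by norm_num)
    have h7 : (4 / 3 : ℝ) ^ (k - N) ≤ (4 / 3) ^ (k - n) :=
      pow_le_pow_right₀ (by norm_num) (by omega)
    have h8 : (2 : ℝ) ^ (k - N) = (3 / 2) ^ (k - N) * (4 / 3) ^ (k - N) := by
      rw [← mul_pow]; norm_num
    have h9 : (0 : ℝ) < (3 / 2) ^ (k - N) := by positivity
    nlinarith


theorem mass_mul_rpow (t : ℝ) (k : ℕ) (a : ℝ) (ha : 0 ≤ a) :
    mass t k * (3 ^ k * a) ^ t = ((2 : ℝ) ^ t / 2) ^ k * a ^ t := by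
  have h : ((3 : ℝ) ^ k) ^ t = ((3 : ℝ) ^ t) ^ k := by
    rw [← Real.rpow_natCast, ← Real.rpow_natCast, ← Real.rpow_mul (by norm_num),
      ← Real.rpow_mul (by norm_num), mul_comm]
  rw [Real.mul_rpow (by positivity) ha, h, mass_eq, ← mul_assoc, ← mul_pow]
  congr 2
  rw [div_mul_eq_mul_div, ← Real.mul_rpow (by norm_num) (by norm_num)]
  norm_num

theorem pow_rpow_comm {a : ℝ} (ha : 0 ≤ a) (k : ℕ) (t : ℝ) : (a ^ k) ^ t = (a ^ t) ^ k := by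
  rw [← Real.rpow_natCast, ← Real.rpow_natCast, ← Real.rpow_mul ha, ← Real.rpow_mul ha, mul_comm]

/-- In generations too coarse for `I` no Cantor interval fits into `I`, so at most two zeros occur,
and the bound 3^k ω(I) without cancellation is good enough: the result decays like 2^(-(t-1)(N-k)).
-/
theorem level_testing_low {t : ℝ} (ht : 1 < t) {I : Set ℝ} (hI : IsInterval I) {N k : ℕ}
    (hk : k < N) (hω : measure.real I ≤ (1 / 2) ^ N) :
    ∑ w : Fin k → Bool, mass t k *
      (I.indicator (fun x => |hilbert measure (I.indicator 1) x| ^ t) (zero w)) ≤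
      2 * (3 ^ 10) ^ t * measure.real I * ((1 / 2 : ℝ) ^ (t - 1)) ^ (N - k) := by
  classical
  have h0 : 0 ≤ measure.real I := measureReal_nonneg
  rw [← Finset.mul_sum]
  have hcard : (Finset.univ.filter fun w : Fin k → Bool => zero w ∈ I).card ≤ 2 := by
    refine card_boundary_le hI.1 fun w hw => ⟨⟨zero w, zero_mem_interval w,
      (Finset.mem_filter.1 hw).2⟩, fun hsub => ?_⟩
    have h1 : measure.real (interval w) ≤ measure.real I := measureReal_mono hsub
    rw [measureReal_interval] at h1
    have h2 : (1 / 2 : ℝ) ^ N < (1 / 2) ^ k :=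
      pow_lt_pow_right_of_lt_one₀ (by norm_num) (by norm_num) hk
    linarith
  have hterm : ∀ w : Fin k → Bool, (I.indicator
      (fun x => |hilbert measure (I.indicator 1) x| ^ t) (zero w)) ≤
      if zero w ∈ I then (3 ^ 10 * (3 ^ k * measure.real I)) ^ t else 0 := by
    intro w
    split_ifs with h
    · rw [indicator_of_mem h, ← mul_assoc]
      exact Real.rpow_le_rpow (abs_nonneg _)
        (abs_hilbert_indicator_le_measure hI.measurableSet w) (by linarith)
    · rw [indicator_of_notMem h]
  have hsum : ∑ w : Fin k → Bool, (I.indicator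
      (fun x => |hilbert measure (I.indicator 1) x| ^ t) (zero w)) ≤
      2 * (3 ^ 10 * (3 ^ k * measure.real I)) ^ t := by
    refine (Finset.sum_le_sum fun w _ => hterm w).trans ?_
    rw [← Finset.sum_filter, Finset.sum_const, nsmul_eq_mul]
    refine mul_le_mul_of_nonneg_right ?_ (by positivity)
    exact_mod_cast hcard
  refine (mul_le_mul_of_nonneg_left hsum (mass_pos t k).le).trans ?_
  rw [Real.mul_rpow (by positivity) (by positivity)]
  have e : mass t k * (2 * ((3 ^ 10) ^ t * (3 ^ k * measure.real I) ^ t)) =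
      2 * (3 ^ 10) ^ t * (mass t k * (3 ^ k * measure.real I) ^ t) := by ring
  rw [e, mass_mul_rpow t k _ h0, mul_assoc (2 * (3 ^ 10 : ℝ) ^ t)]
  refine mul_le_mul_of_nonneg_left ?_ (by positivity)
  have h3 : measure.real I ^ t ≤ measure.real I * ((1 / 2 : ℝ) ^ (t - 1)) ^ N := by
    rcases h0.eq_or_lt with h | h
    · rw [← h, Real.zero_rpow (by linarith), zero_mul]
    · rw [show t = 1 + (t - 1) by ring, Real.rpow_add h, Real.rpow_one, add_sub_cancel_left,
        ← pow_rpow_comm (by norm_num)]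
      exact mul_le_mul_of_nonneg_left (Real.rpow_le_rpow h0 hω (by linarith)) h0
  have h4 : ((2 : ℝ) ^ t / 2) ^ k * ((1 / 2 : ℝ) ^ (t - 1)) ^ N = ((1 / 2 : ℝ) ^ (t - 1)) ^ (N - k) := by
    have h5 : (2 : ℝ) ^ t / 2 * (1 / 2 : ℝ) ^ (t - 1) = 1 := by
      rw [← Real.rpow_sub_one (by norm_num), ← Real.mul_rpow (by norm_num) (by norm_num)]
      norm_num
    conv_lhs => rw [← Nat.add_sub_cancel' hk.le, pow_add, ← mul_assoc, ← mul_pow, h5, one_pow,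
      one_mul]
  calc ((2 : ℝ) ^ t / 2) ^ k * measure.real I ^ t
      ≤ ((2 : ℝ) ^ t / 2) ^ k * (measure.real I * ((1 / 2 : ℝ) ^ (t - 1)) ^ N) :=
        mul_le_mul_of_nonneg_left h3 (by positivity)
    _ = _ := by rw [← h4]; ring

/-- Each zero is charged to an ancestor of some generation `n` that leaves `I` and bounds H(1_I ω)
there by a multiple of (3/2)^n. With the count `card_zeros_le`, the sum over `n` has ratio at most
(2/3)(4/3) = 8/9 in `k - n`, and the rest decays like (3/4)^(k-N). -/
theorem level_testing_high {t : ℝ} (ht : 1 < t) {I : Set ℝ} (hI : IsInterval I) {N k : ℕ}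
    (hk : N ≤ k) (hω : measure.real I ≤ (1 / 2) ^ N) :
    ∑ w : Fin k → Bool, mass t k *
      (I.indicator (fun x => |hilbert measure (I.indicator 1) x| ^ t) (zero w)) ≤
      27 * (3 ^ 11) ^ t * (1 / 2) ^ N * (3 / 4) ^ (k - N) := by
  classical
  rw [← Finset.mul_sum]
  set A : ℝ := (3 ^ 11) ^ t with hA
  set r : ℝ := (3 / 2) ^ t with hr
  have hr0 : 0 < r := by positivity
  have hA0 : 0 < A := by positivity
  have hterm : ∀ w : Fin k → Bool, (I.indicator
      (fun x => |hilbert measure (I.indicator 1) x| ^ t) (zero w)) ≤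
      ∑ n ∈ Finset.range (k + 1),
        if zero w ∈ I ∧ ¬ interval (pre (ext w) n) ⊆ I then A * r ^ n else 0 := by
    intro w
    have hnn : ∀ n ∈ Finset.range (k + 1),
        0 ≤ if zero w ∈ I ∧ ¬ interval (pre (ext w) n) ⊆ I then A * r ^ n else 0 := by
      intro n _
      split_ifs
      · positivity
      · exact le_rfl
    by_cases h : zero w ∈ I
    · rw [indicator_of_mem h]
      rcases hilbert_indicator_boundary hI.measurableSet w with h0 | ⟨n, hn, hn', hle⟩
      · rw [h0, abs_zero, Real.zero_rpow (by linarith)]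
        exact Finset.sum_nonneg hnn
      · refine le_trans ?_ (Finset.single_le_sum hnn (Finset.mem_range.2 (Nat.lt_succ_of_le hn)))
        rw [if_pos ⟨h, hn'⟩, hA, hr, ← pow_rpow_comm (by norm_num),
          ← Real.mul_rpow (by positivity) (by positivity)]
        exact Real.rpow_le_rpow (abs_nonneg _) hle (by linarith)
    · rw [indicator_of_notMem h]
      exact Finset.sum_nonneg hnn
  have hsum : ∑ w : Fin k → Bool, (I.indicator
      (fun x => |hilbert measure (I.indicator 1) x| ^ t) (zero w)) ≤
      ∑ n ∈ Finset.range (k + 1), A * r ^ n * (3 * (3 / 2) ^ (k - N) * (4 / 3) ^ (k - n)) := by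
    refine (Finset.sum_le_sum fun w _ => hterm w).trans ?_
    rw [Finset.sum_comm]
    refine Finset.sum_le_sum fun n hn => ?_
    rw [← Finset.sum_filter, Finset.sum_const, nsmul_eq_mul, mul_comm]
    refine mul_le_mul_of_nonneg_left ?_ (by positivity)
    convert card_zeros_le hI.1 hk (Nat.lt_succ_iff.1 (Finset.mem_range.1 hn)) hω
  refine (mul_le_mul_of_nonneg_left hsum (mass_pos t k).le).trans ?_
  have hτ : (2 / 3 : ℝ) ^ t * r = 1 := by
    rw [hr, ← Real.mul_rpow (by norm_num) (by norm_num)]; norm_num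
  have hτ1 : (2 / 3 : ℝ) ^ t ≤ 2 / 3 := (rpow_two_thirds_lt ht).le
  have hτ0 : 0 < (2 / 3 : ℝ) ^ t := by positivity
  rw [Finset.mul_sum]
  have e : ∀ n ∈ Finset.range (k + 1),
      mass t k * (A * r ^ n * (3 * (3 / 2) ^ (k - N) * (4 / 3) ^ (k - n))) ≤
      3 * A * ((1 / 2) ^ N * (3 / 4) ^ (k - N)) * (8 / 9) ^ (k + 1 - 1 - n) := by
    intro n hn
    have hn' := Nat.lt_succ_iff.1 (Finset.mem_range.1 hn)
    have h1 : mass t k * r ^ n = (1 / 2) ^ k * ((2 / 3 : ℝ) ^ t) ^ (k - n) := by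
      rw [mass_eq, div_eq_mul_one_div, mul_pow]
      conv_lhs => rw [← Nat.add_sub_cancel' hn', pow_add ((2 / 3 : ℝ) ^ t)]
      rw [Nat.add_sub_cancel' hn']
      have : ((2 / 3 : ℝ) ^ t) ^ n * r ^ n = 1 := by rw [← mul_pow, hτ, one_pow]
      linear_combination ((2 / 3 : ℝ) ^ t) ^ (k - n) * (1 / 2) ^ k * this
    have h2 : ((2 / 3 : ℝ) ^ t) ^ (k - n) * (4 / 3) ^ (k - n) ≤ (8 / 9) ^ (k - n) := by
      rw [← mul_pow]
      exact pow_le_pow_left₀ (by positivity) (by linarith) _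
    have h3 : (1 / 2 : ℝ) ^ k * (3 / 2) ^ (k - N) = (1 / 2) ^ N * (3 / 4) ^ (k - N) := by
      conv_lhs => rw [← Nat.add_sub_cancel' hk, pow_add]
      rw [Nat.add_sub_cancel' hk, mul_assoc, ← mul_pow]
      norm_num
    rw [Nat.add_sub_cancel]
    calc mass t k * (A * r ^ n * (3 * (3 / 2) ^ (k - N) * (4 / 3) ^ (k - n)))
        = 3 * A * ((1 / 2 : ℝ) ^ k * (3 / 2) ^ (k - N)) *
          (((2 / 3 : ℝ) ^ t) ^ (k - n) * (4 / 3) ^ (k - n)) := by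
          linear_combination (A * 3 * (3 / 2) ^ (k - N) * (4 / 3) ^ (k - n)) * h1
      _ ≤ _ := by
          rw [h3]
          exact mul_le_mul_of_nonneg_left h2 (by positivity)
  refine (Finset.sum_le_sum e).trans ?_
  rw [← Finset.mul_sum, Finset.sum_range_reflect (fun n => (8 / 9 : ℝ) ^ n)]
  have hg : ∑ n ∈ Finset.range (k + 1), (8 / 9 : ℝ) ^ n ≤ 9 := by
    have := sum_le_hasSum (Finset.range (k + 1)) (fun n _ => by positivity)
      (hasSum_geometric_of_lt_one (r := (8 / 9 : ℝ)) (by norm_num) (by norm_num))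
    exact this.trans (by norm_num)
  calc 3 * A * ((1 / 2) ^ N * (3 / 4) ^ (k - N)) * ∑ n ∈ Finset.range (k + 1), (8 / 9 : ℝ) ^ n
      ≤ 3 * A * ((1 / 2) ^ N * (3 / 4) ^ (k - N)) * 9 :=
        mul_le_mul_of_nonneg_left hg (by positivity)
    _ = _ := by ring

/-- The testing condition for the Cantor measure, where the zeros enter. -/
theorem testing_measure {t : ℝ} (ht : 1 < t) : HilbertTesting t measure (sig t) := by
  set ρ : ℝ := max (3 / 4) ((1 / 2 : ℝ) ^ (t - 1)) with hρ
  have hρ0 : 0 < ρ := lt_max_of_lt_left (by norm_num)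
  have hρ1 : ρ < 1 := max_lt (by norm_num)
    (Real.rpow_lt_one (by norm_num) (by norm_num) (by linarith))
  set K : ℝ := 54 * (3 ^ 11) ^ t with hK
  have hK0 : 0 < K := by positivity
  have hsub : 0 < 1 - ρ := by linarith
  refine ⟨((2 * K / (1 - ρ)) ^ (1 / t)).toNNReal, fun I hI => ⟨?_, ?_⟩⟩
  · exact ae_restrict_of_ae (ae_sig fun k w => converges_indicator w hI.measurableSet)
  have eT : ((2 * K / (1 - ρ)) ^ (1 / t)) ^ t = 2 * K / (1 - ρ) := by
    rw [← Real.rpow_mul (by positivity), one_div_mul_cancel (by linarith), Real.rpow_one]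
  rw [Real.coe_toNNReal _ (by positivity), eT, ← lintegral_indicator hI.measurableSet, lintegral_sig]
  rcases (measureReal_nonneg : 0 ≤ measure.real I).eq_or_lt with h0 | h0
  · have hz : measure I = 0 := (measureReal_eq_zero_iff (measure_ne_top _ _)).1 h0.symm
    have : ∀ x, hilbert measure (I.indicator 1) x = 0 := fun x => by
      refine integral_eq_zero_of_ae ?_
      have hI0 := measure_eq_zero_iff_ae_notMem.1 hz
      filter_upwards [hI0] with y hy
      simp [hy]
    simp [this, Real.zero_rpow (show t ≠ 0 by linarith)]
  -- The critical generation: 2^(-(N+1)) < ω(I) ≤ 2^(-N).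
  obtain ⟨N, hN1, hN2⟩ := exists_nat_pow_near_of_lt_one h0 measureReal_le_one
    (show (0 : ℝ) < 1 / 2 by norm_num) (by norm_num)
  have key : ∀ k, ∑ w : Fin k → Bool, ENNReal.ofReal (mass t k) * I.indicator
      (fun x => ENNReal.ofReal (|hilbert measure (I.indicator 1) x| ^ t)) (zero w) ≤
      ENNReal.ofReal (K * measure.real I * ρ ^ ((k - N) + (N - k))) := by
    intro k
    have e : ∀ w : Fin k → Bool, ENNReal.ofReal (mass t k) * I.indicator
        (fun x => ENNReal.ofReal (|hilbert measure (I.indicator 1) x| ^ t)) (zero w) =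
        ENNReal.ofReal (mass t k *
          I.indicator (fun x => |hilbert measure (I.indicator 1) x| ^ t) (zero w)) := by
      intro w
      rw [ENNReal.ofReal_mul (mass_pos t k).le]
      by_cases hw : zero w ∈ I <;> simp [hw]
    rw [Finset.sum_congr rfl fun w _ => e w, ← ENNReal.ofReal_sum_of_nonneg]
    · refine ENNReal.ofReal_le_ofReal ?_
      rcases lt_or_ge k N with hk | hk
      · refine (level_testing_low ht hI hk hN2).trans ?_
        rw [show k - N + (N - k) = N - k by omega]
        have h1 : ((3 : ℝ) ^ 10) ^ t ≤ (3 ^ 11) ^ t :=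
          Real.rpow_le_rpow (by norm_num) (by norm_num) (by linarith)
        have h2 : ((1 / 2 : ℝ) ^ (t - 1)) ^ (N - k) ≤ ρ ^ (N - k) :=
          pow_le_pow_left₀ (by positivity) (le_max_right _ _) _
        have h3 : (0 : ℝ) < (3 ^ 11) ^ t := by positivity
        refine mul_le_mul ?_ h2 (by positivity) (by positivity)
        exact mul_le_mul_of_nonneg_right (by linarith) h0.le
      · refine (level_testing_high ht hI hk hN2).trans ?_
        rw [show k - N + (N - k) = k - N by omega]
        have h2 : (3 / 4 : ℝ) ^ (k - N) ≤ ρ ^ (k - N) :=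
          pow_le_pow_left₀ (by positivity) (le_max_left _ _) _
        have h3 : (0 : ℝ) < (3 ^ 11) ^ t := by positivity
        refine mul_le_mul ?_ h2 (by positivity) (by positivity)
        rw [pow_succ] at hN1
        calc 27 * ((3 : ℝ) ^ 11) ^ t * (1 / 2) ^ N
            = K * ((1 / 2) ^ N * (1 / 2)) := by rw [hK]; ring
          _ ≤ K * measure.real I := mul_le_mul_of_nonneg_left hN1.le hK0.le
    · exact fun w _ => mul_nonneg (mass_pos t k).le
        (indicator_nonneg (fun _ _ => by positivity) _)
  refine (tsum_le_of_two_sided N (by positivity) hρ0 hρ1 key).trans (le_of_eq ?_)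
  rw [← ofReal_measureReal (μ := measure) (s := I), ← ENNReal.ofReal_mul (by positivity)]
  congr 1
  ring

end Cantor

/-! ### The two-tailed Muckenhoupt condition -/

namespace TwoWeight

/-! ### Elementary bounds for intervals and the tail kernel -/

theorem IsInterval.nonempty {I : Set ℝ} (hI : IsInterval I) : I.Nonempty :=
  hI.2.2.mono interior_subset

theorem IsInterval.volume_lt_top {I : Set ℝ} (hI : IsInterval I) : volume I < ∞ :=
  hI.2.1.measure_lt_top

theorem IsInterval.length_pos {I : Set ℝ} (hI : IsInterval I) : 0 < volume.real I := by
  refine ENNReal.toReal_pos (ne_of_gt ?_) hI.volume_lt_top.ne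
  exact (isOpen_interior.measure_pos volume hI.2.2).trans_le (measure_mono interior_subset)

theorem IsInterval.abs_sub_le {I : Set ℝ} (hI : IsInterval I) {x y : ℝ} (hx : x ∈ I) (hy : y ∈ I) :
    |x - y| ≤ volume.real I := by
  have h : volume.real (uIcc y x) ≤ volume.real I :=
    measureReal_mono (hI.1.uIcc_subset hy hx) hI.volume_lt_top.ne
  rwa [measureReal_def, Real.volume_interval, ENNReal.toReal_ofReal (abs_nonneg _)] at h

theorem IsInterval.abs_sub_le_infDist {I : Set ℝ} (hI : IsInterval I) (x y : ℝ) :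
    |x - y| ≤ Metric.infDist x I + volume.real I + Metric.infDist y I := by
  refine le_of_forall_pos_le_add fun ε hε => ?_
  obtain ⟨a, ha, hxa⟩ := (Metric.infDist_lt_iff hI.nonempty (x := x)).1
    (lt_add_of_pos_right _ (half_pos hε))
  obtain ⟨b, hb, hyb⟩ := (Metric.infDist_lt_iff hI.nonempty (x := y)).1
    (lt_add_of_pos_right _ (half_pos hε))
  have h1 := hI.abs_sub_le ha hb
  rw [Real.dist_eq] at hxa hyb
  have h2 : |x - y| ≤ |x - a| + |a - b| + |b - y| := by
    calc |x - y| ≤ |x - a| + |a - y| := _root_.abs_sub_le _ _ _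
      _ ≤ |x - a| + (|a - b| + |b - y|) := by gcongr; exact _root_.abs_sub_le _ _ _
      _ = _ := by ring
  rw [abs_sub_comm b y] at h2
  linarith

theorem tailKernel_le {I : Set ℝ} (hI : IsInterval I) {p D x : ℝ} (hp : 0 < p) (hD : 0 < D)
    (h : D ≤ volume.real I + Metric.infDist x I) :
    volume.real I ^ (p - 1) / (volume.real I + Metric.infDist x I) ^ p ≤
      volume.real I ^ (p - 1) * (1 / D) ^ p := by
  have h0 := hI.length_pos
  rw [Real.div_rpow zero_le_one hD.le, Real.one_rpow, mul_one_div]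
  exact div_le_div_of_nonneg_left (by positivity) (by positivity)
    (Real.rpow_le_rpow hD.le h hp.le)

theorem tailKernel_le_inv {I : Set ℝ} (hI : IsInterval I) {p : ℝ} (hp : 0 < p) (x : ℝ) :
    volume.real I ^ (p - 1) / (volume.real I + Metric.infDist x I) ^ p ≤ 1 / volume.real I := by
  have h0 := hI.length_pos
  refine (tailKernel_le hI hp h0 (le_add_of_nonneg_right Metric.infDist_nonneg)).trans (le_of_eq ?_)
  rw [Real.div_rpow zero_le_one h0.le, Real.one_rpow, Real.rpow_sub_one h0.ne']
  field_simp

theorem tailIntegral_le_of_one_le {I : Set ℝ} (hI : IsInterval I) {p : ℝ} (hp : 0 < p)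
    (h1 : 1 ≤ volume.real I) (μ : Measure ℝ) : tailIntegral p μ I ≤ μ univ := by
  rw [← lintegral_one]
  refine lintegral_mono fun x => ?_
  rw [← ENNReal.ofReal_one]
  refine ENNReal.ofReal_le_ofReal ((tailKernel_le_inv hI hp x).trans ?_)
  rw [div_le_one hI.length_pos]
  exact h1

/-- Since 1/p + 1/q = 1, the common denominator ν reappears to the first power. Both tail integrals
are brought to this form. -/
theorem rpow_mul_rpow_le {p q A B ν C₁ C₂ : ℝ} (h : p.HolderConjugate q) (hA : 0 ≤ A) (hB : 0 ≤ B)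
    (hν : 0 < ν) (h₁ : 0 ≤ C₁) (h₂ : 0 ≤ C₂) {s r : ℝ≥0∞}
    (hs : s ≤ ENNReal.ofReal (C₁ * (A ^ p / ν))) (hr : r ≤ ENNReal.ofReal (C₂ * (B ^ q / ν))) :
    s ^ (1 / p) * r ^ (1 / q) ≤ ENNReal.ofReal (C₁ ^ (1 / p) * C₂ ^ (1 / q) * (A * B / ν)) := by
  have hp := h.pos
  have hq := h.symm.pos
  have e : ∀ {A p : ℝ}, 0 ≤ A → 0 < p → (A ^ p) ^ (1 / p) = A := fun hA hp => by
    rw [← Real.rpow_mul hA, mul_one_div_cancel hp.ne', Real.rpow_one]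
  have e2 : ν ^ (1 / p) * ν ^ (1 / q) = ν := by
    rw [← Real.rpow_add hν, one_div, one_div, h.inv_add_inv_eq_one, Real.rpow_one]
  refine (mul_le_mul' (ENNReal.rpow_le_rpow hs (by positivity))
    (ENNReal.rpow_le_rpow hr (by positivity))).trans (le_of_eq ?_)
  rw [ENNReal.ofReal_rpow_of_nonneg (by positivity) (by positivity),
    ENNReal.ofReal_rpow_of_nonneg (by positivity) (by positivity),
    ← ENNReal.ofReal_mul (by positivity)]
  congr 1
  rw [Real.mul_rpow h₁ (by positivity), Real.mul_rpow h₂ (by positivity),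
    Real.div_rpow (by positivity) hν.le, Real.div_rpow (by positivity) hν.le, e hA hp, e hB hq]
  conv_rhs => rw [← e2]
  have : ν ^ (1 / p) ≠ 0 := by positivity
  have : ν ^ (1 / q) ≠ 0 := by positivity
  field_simp

end TwoWeight

namespace Cantor

open TwoWeight

/-! ### Tail integrals of the Cantor measure and of the discrete measure -/

theorem lintegral_sig' (t : ℝ) (g : ℝ → ℝ≥0∞) :
    ∫⁻ x, g x ∂(sig t) =
      ∑' v : (k : ℕ) × (Fin k → Bool), ENNReal.ofReal (mass t v.1) * g (zero v.2) := by
  rw [lintegral_sig, ENNReal.tsum_sigma']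
  exact tsum_congr fun k => (tsum_fintype _).symm

theorem exists_points_around (b : ℕ → Bool) (l : ℕ) :
    (∃ c, point c ∈ interval (pre b l) ∧ point c < zero (pre b l)) ∧
    (∃ c, point c ∈ interval (pre b l) ∧ zero (pre b l) < point c) := by
  have key : ∀ v, Agree l b (Function.update b l v) := fun v i hi => by
    rw [Function.update_of_ne hi.ne]
  have hz := (zero_spec (pre b l)).1
  constructor
  · refine ⟨Function.update b l false, point_mem_pre.2 (key _), ?_⟩
    have := (point_side (Function.update b l false) l).1 (by simp)
    rw [← (key false).pre_eq] at this
    exact this.trans_lt hz.1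
  · refine ⟨Function.update b l true, point_mem_pre.2 (key _), ?_⟩
    have := (point_side (Function.update b l true) l).2 (by simp)
    rw [← (key true).pre_eq] at this
    exact hz.2.trans_le this

/-- Between two of the zeros there is a point of the Cantor set. -/
theorem exists_point_between {k l : ℕ} (w : Fin k → Bool) (w' : Fin l → Bool) (hkl : k ≤ l)
    (hne : (⟨k, w⟩ : (k : ℕ) × (Fin k → Bool)) ≠ ⟨l, w'⟩) :
    ∃ c, point c ∈ uIcc (zero w) (zero w') := by
  obtain ⟨n, hn, ha, hd⟩ := exists_agree k (ext w) (ext w')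
  have hnl : n < l := by
    rcases hn.lt_or_eq with h | rfl
    · exact h.trans_le hkl
    · refine lt_of_le_of_ne hkl fun h => hne ?_
      subst h
      have := ha.pre_eq
      rw [pre_ext, pre_ext] at this
      rw [this]
  have hpos : (1 : ℝ) / 3 ^ (n + 1) < 2 / 3 ^ (n + 1) :=
    div_lt_div_of_pos_right (by norm_num) (by positivity)
  have hz : (ext w' n = false → leftEnd (pre (ext w') n) + 1 / 3 ^ (n + 1) ≤ zero w) ∧
      (ext w' n = true → zero w ≤ leftEnd (pre (ext w') n) + 2 / 3 ^ (n + 1)) := by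
    rw [← ha.pre_eq]
    rcases hn.lt_or_eq with h | rfl
    · have h1 := interval_side (b := ext w) h (x := zero w) (by rw [pre_ext]; exact zero_mem_interval w)
      have h2 := hd h
      constructor <;> intro h3 <;> rw [h3] at h2
      · linarith [h1.2 (by simpa using h2)]
      · linarith [h1.1 (by simpa using h2)]
    · rw [pre_ext]
      exact ⟨fun _ => (zero_spec w).1.1.le, fun _ => (zero_spec w).1.2.le⟩
  obtain ⟨⟨c₁, h1, h1'⟩, ⟨c₂, h2, h2'⟩⟩ := exists_points_around (ext w') l
  rw [pre_ext] at h1' h2'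
  cases hb : ext w' n
  · exact ⟨c₂, mem_uIcc.2 (Or.inr ⟨h2'.le, ((interval_side hnl h2).1 hb).trans (hz.1 hb)⟩)⟩
  · exact ⟨c₁, mem_uIcc.2 (Or.inl ⟨(hz.2 hb).trans ((interval_side hnl h1).2 hb), h1'.le⟩)⟩

/-- An interval at distance at least `d` from the Cantor set is closer than `d / 2` to at most
one of the zeros. -/
theorem zero_unique_of_infDist {I : Set ℝ} (hI : IsInterval I) {d : ℝ}
    (hd : ∀ c, d ≤ Metric.infDist (point c) I) {v v' : (k : ℕ) × (Fin k → Bool)}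
    (hv : Metric.infDist (zero v.2) I < d / 2) (hv' : Metric.infDist (zero v'.2) I < d / 2) :
    v = v' := by
  by_contra hne
  obtain ⟨c, hc⟩ : ∃ c, point c ∈ uIcc (zero v.2) (zero v'.2) := by
    rcases le_total v.1 v'.1 with h | h
    · exact exists_point_between v.2 v'.2 h hne
    · rw [uIcc_comm]
      exact exists_point_between v'.2 v.2 h (Ne.symm hne)
  obtain ⟨a, ha, hxa⟩ := (Metric.infDist_lt_iff hI.nonempty).1 hv
  obtain ⟨b, hb, hyb⟩ := (Metric.infDist_lt_iff hI.nonempty).1 hv'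
  rw [Real.dist_eq, abs_lt] at hxa hyb
  have hd0 : 0 < d := by linarith [Metric.infDist_nonneg (x := zero v.2) (s := I)]
  -- The points `a`, `b` of `I` are within d/2 of the two zeros. Either `point c` lies between `a`
  -- and `b`, hence in `I`, or it lies between one zero and the point of `I` chosen near it.
  have key : ∃ e ∈ I, |point c - e| < d := by
    by_cases h : point c ∈ uIcc a b
    · exact ⟨point c, hI.1.uIcc_subset ha hb h, by simpa using hd0⟩
    · rw [mem_uIcc, not_or, not_and_or, not_and_or] at h
      simp only [not_le] at h
      rw [mem_uIcc] at hc
      by_cases h1 : |point c - a| < d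
      · exact ⟨a, ha, h1⟩
      · refine ⟨b, hb, ?_⟩
        rw [abs_lt] at h1 ⊢
        rw [not_and_or, not_lt, not_lt] at h1
        rcases hc with hc | hc <;> rcases h with ⟨h2 | h2, h3 | h3⟩ <;> rcases h1 with h1 | h1 <;>
          constructor <;> linarith
  obtain ⟨e, he, hlt⟩ := key
  have := Metric.infDist_le_dist_of_mem (x := point c) he
  rw [Real.dist_eq] at this
  linarith [hd c]

/-- A point of the Cantor set almost closest to an interval, and the scale `3^(-m)` of its
distance. -/
theorem exists_base {I : Set ℝ} (hI : IsInterval I) (h1 : volume.real I < 1) :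
    ∃ (d : ℝ) (b : ℕ → Bool) (m : ℕ), 0 ≤ d ∧ (∀ c, d ≤ Metric.infDist (point c) I) ∧
      Metric.infDist (point b) I ≤ d + volume.real I ∧
      (1 / 3) ^ (m + 1) ≤ volume.real I + d ∧ volume.real I ≤ (1 / 3) ^ m ∧
      (m = 0 ∨ volume.real I + d ≤ (1 / 3) ^ m) := by
  have h0 := hI.length_pos
  set d := ⨅ b, Metric.infDist (point b) I with hd
  have hbdd : BddBelow (range fun b => Metric.infDist (point b) I) :=
    ⟨0, by rintro _ ⟨b, rfl⟩; exact Metric.infDist_nonneg⟩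
  have hd0 : 0 ≤ d := le_ciInf fun b => Metric.infDist_nonneg
  obtain ⟨b, hb⟩ := exists_lt_of_ciInf_lt (show d < d + volume.real I by linarith)
  rcases le_total 1 (volume.real I + d) with h | h
  · exact ⟨d, b, 0, hd0, fun c => ciInf_le hbdd c, hb.le, by norm_num; linarith,
      by simpa using h1.le, Or.inl rfl⟩
  · obtain ⟨m, h2, h3⟩ := exists_nat_pow_near_of_lt_one (x := volume.real I + d) (by linarith) h
      (show (0 : ℝ) < 1 / 3 by norm_num) (by norm_num)
    exact ⟨d, b, m, hd0, fun c => ciInf_le hbdd c, hb.le, h2.le, by linarith, Or.inr h3⟩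

/-- Points that part from the nearly closest point `b` at scale `n ≤ m` have |I| + dist at least
3^(-(n+2)). The sum of (3^p/2)^n is dominated by n = m. -/
theorem tailIntegral_measure_le {I : Set ℝ} (hI : IsInterval I) {p d : ℝ} (hp : 1 < p)
    {b : ℕ → Bool} {m : ℕ} (hd : ∀ c, d ≤ Metric.infDist (point c) I)
    (hb : Metric.infDist (point b) I ≤ d + volume.real I)
    (hm : (1 / 3) ^ (m + 1) ≤ volume.real I + d) :
    tailIntegral p measure I ≤ ENNReal.ofReal (3 * 9 ^ p *
      ((volume.real I * 3 ^ m) ^ p / (volume.real I * 2 ^ m))) := by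
  have h0 := hI.length_pos
  set l := volume.real I with hl
  obtain ⟨hi, he⟩ := integral_tree b (fun n => l ^ (p - 1) * (9 ^ p * ((3 : ℝ) ^ p) ^ n)) m
  have hnn : ∀ n, 0 ≤ l ^ (p - 1) * (9 ^ p * ((3 : ℝ) ^ p) ^ n) := fun n => by positivity
  calc tailIntegral p measure I
      ≤ ∫⁻ x, ENNReal.ofReal (∑ n ∈ Finset.range (m + 1), l ^ (p - 1) * (9 ^ p * ((3 : ℝ) ^ p) ^ n) *
          (interval (pre b n)).indicator 1 x) ∂measure := by
        refine lintegral_mono_ae (ae_of_point fun c => ENNReal.ofReal_le_ofReal ?_)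
        obtain ⟨n, hn, ha, hne⟩ := exists_agree m b c
        refine le_trans ?_ (le_tree hnn hn ha)
        have hD : 1 / 3 ^ (n + 2) ≤ l + Metric.infDist (point c) I := by
          have h3 : (1 : ℝ) / 3 ^ (n + 2) = 1 / 3 ^ (n + 1) / 3 := by rw [div_div, ← pow_succ]
          have h4 : (0 : ℝ) < 1 / 3 ^ (n + 1) := by positivity
          have hdc := hd c
          rw [h3]
          rcases hn.lt_or_eq with hlt | rfl
          · have h5 := dist_of_ne ha (hne hlt) (Nat.lt_succ_self n) (Nat.lt_succ_self n)
              (mem_interval_point b _) (mem_interval_point c _)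
            have h6 := hI.abs_sub_le_infDist (point b) (point c)
            rw [← hl] at h6
            linarith
          · rw [one_div_pow] at hm
            linarith
        refine (tailKernel_le hI (by linarith) (by positivity) hD).trans (le_of_eq ?_)
        rw [one_div_one_div, pow_add, Real.mul_rpow (by positivity) (by positivity),
          pow_rpow_comm (by norm_num), mul_comm ((3 ^ p) ^ n)]
        rw [show (3 : ℝ) ^ 2 = 9 by norm_num]
    _ = ENNReal.ofReal (∑ n ∈ Finset.range (m + 1), l ^ (p - 1) * (9 ^ p * ((3 : ℝ) ^ p) ^ n) *
          (1 / 2) ^ n) := by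
        rw [← he, ofReal_integral_eq_lintegral_ofReal hi
          (Filter.Eventually.of_forall fun x => tree_nonneg hnn m x)]
    _ ≤ _ := by
        refine ENNReal.ofReal_le_ofReal ?_
        have e : ∀ n : ℕ, l ^ (p - 1) * (9 ^ p * ((3 : ℝ) ^ p) ^ n) * (1 / 2) ^ n =
            l ^ (p - 1) * 9 ^ p * ((3 : ℝ) ^ p / 2) ^ n := fun n => by
          rw [div_pow, div_pow, one_pow]; ring
        have hr : (3 : ℝ) / 2 ≤ 3 ^ p / 2 := by
          have := Real.rpow_le_rpow_of_exponent_le (show (1 : ℝ) ≤ 3 by norm_num) hp.le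
          rw [Real.rpow_one] at this
          linarith
        rw [Finset.sum_congr rfl fun n _ => e n, ← Finset.mul_sum]
        refine (mul_le_mul_of_nonneg_left (geom_sum_le hr m) (by positivity)).trans (le_of_eq ?_)
        rw [Real.mul_rpow h0.le (by positivity), pow_rpow_comm (by norm_num), div_pow,
          Real.rpow_sub_one h0.ne']
        field_simp

/-- Only zeros at distance at least d/2 from `I` are counted; for them |I| + dist is never much
smaller than 3^(-m). Generation `m` is critical: finer ones decay through their masses, by (2/3)^q,
and coarser ones because the kernel cannot see below their own scale, by 2/2^q. -/
theorem level_tail_le {I : Set ℝ} (hI : IsInterval I) {q d : ℝ} (hq : 1 < q)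
    {b : ℕ → Bool} {m : ℕ}
    (hb : Metric.infDist (point b) I ≤ d + volume.real I)
    (hm : (1 / 3) ^ (m + 1) ≤ volume.real I + d) (k : ℕ) :
    ∑ w : Fin k → Bool, mass q k * {x | d / 2 ≤ Metric.infDist x I}.indicator (fun x =>
      volume.real I ^ (q - 1) / (volume.real I + Metric.infDist x I) ^ q) (zero w) ≤
      3 * (3 ^ 11) ^ q * ((volume.real I * 2 ^ m) ^ q / (volume.real I * 2 ^ m)) *
        (max ((2 / 3 : ℝ) ^ q) (2 / 2 ^ q)) ^ ((k - m) + (m - k)) := by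
  have h0 := hI.length_pos
  set l := volume.real I with hl
  set ρ := max ((2 / 3 : ℝ) ^ q) (2 / 2 ^ q) with hρ
  have hA : (0 : ℝ) < (3 ^ 11) ^ q := by positivity
  set A : ℝ := (3 ^ 11) ^ q
  rw [← Finset.mul_sum]
  have hr : (3 : ℝ) / 2 ≤ 3 ^ q / 2 := by
    have := Real.rpow_le_rpow_of_exponent_le (show (1 : ℝ) ≤ 3 by norm_num) hq.le
    rw [Real.rpow_one] at this
    linarith
  have hsum : ∑ w : Fin k → Bool, {x | d / 2 ≤ Metric.infDist x I}.indicator (fun x =>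
      l ^ (q - 1) / (l + Metric.infDist x I) ^ q) (zero w) ≤
      ∑ n ∈ Finset.range (k + 1),
        (if n ≤ m then l ^ (q - 1) * (A * ((3 : ℝ) ^ q) ^ n) else 0) * 2 ^ (k - n) := by
    refine level_sum_le b (fun n => by split_ifs <;> positivity) fun w => ?_
    obtain ⟨n, hn, ha, hdist⟩ := exists_agree_zero k (ext w) b
    rw [pre_ext] at hdist
    by_cases hmem : zero w ∈ {x | d / 2 ≤ Metric.infDist x I}
    · rw [indicator_of_mem hmem]
      have hmem' : d / 2 ≤ Metric.infDist (zero w) I := hmem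
      -- The scale of separation is replaced by its minimum with `m`, below which the restriction to
      -- distances ≥ d/2 gives the bound.
      have key : ∃ n ≤ k, Agree n (ext w) b ∧ n ≤ m ∧
          1 / (3 ^ 11 * 3 ^ n) ≤ l + Metric.infDist (zero w) I := by
        rcases le_total n m with h | h
        · refine ⟨n, hn, ha, h, ?_⟩
          have h6 := hI.abs_sub_le_infDist (point b) (zero w)
          have hpos : 0 < |point b - zero w| :=
            abs_pos.2 (sub_ne_zero.2 (point_ne_zero k w b))
          rw [div_le_iff₀ hpos] at hdist
          rw [div_le_iff₀ (by positivity)]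
          have h7 : |point b - zero w| ≤ 3 * (l + Metric.infDist (zero w) I) := by linarith
          have h8 : (0 : ℝ) < 3 ^ n := by positivity
          nlinarith
        · refine ⟨m, h.trans hn, ha.mono h, le_rfl, ?_⟩
          have h7 : (1 / 3 : ℝ) ^ (m + 1) / 2 ≤ l + Metric.infDist (zero w) I := by linarith
          refine le_trans ?_ h7
          rw [one_div_pow, div_div]
          refine one_div_le_one_div_of_le (by positivity) ?_
          rw [pow_succ]
          nlinarith [pow_pos (zero_lt_three' ℝ) m]
      obtain ⟨n, hn, ha, hnm, hD⟩ := key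
      refine ⟨n, hn, ha, ?_⟩
      rw [if_pos hnm]
      refine (tailKernel_le hI (by linarith) (by positivity) hD).trans (le_of_eq ?_)
      rw [one_div_one_div, Real.mul_rpow (by positivity) (by positivity),
        pow_rpow_comm (a := 3) (by norm_num) n]
    · rw [indicator_of_notMem hmem]
      exact ⟨n, hn, ha, by split_ifs <;> positivity⟩
  refine (mul_le_mul_of_nonneg_left hsum (mass_pos q k).le).trans ?_
  have e : ∀ n ∈ Finset.range (k + 1),
      (if n ≤ m then l ^ (q - 1) * (A * ((3 : ℝ) ^ q) ^ n) else 0) * 2 ^ (k - n) =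
      l ^ (q - 1) * A * 2 ^ k * if n ≤ m then ((3 : ℝ) ^ q / 2) ^ n else 0 := by
    intro n hn
    rw [two_pow_sub (Nat.lt_succ_iff.1 (Finset.mem_range.1 hn)), div_pow, div_pow, one_pow]
    split_ifs <;> ring
  rw [Finset.sum_congr rfl e, ← Finset.mul_sum]
  have hmin : (∑ n ∈ Finset.range (k + 1), if n ≤ m then ((3 : ℝ) ^ q / 2) ^ n else 0) ≤
      3 * ((3 : ℝ) ^ q / 2) ^ (min k m) := by
    rw [← Finset.sum_filter]
    refine (Finset.sum_le_sum_of_subset_of_nonneg (t := Finset.range (min k m + 1)) ?_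
      fun n _ _ => by positivity).trans (geom_sum_le hr _)
    intro n hn
    simp only [Finset.mem_filter, Finset.mem_range] at hn ⊢
    omega
  refine (mul_le_mul_of_nonneg_left (mul_le_mul_of_nonneg_left hmin (by positivity))
    (mass_pos q k).le).trans ?_
  have hτ : (2 / 3 : ℝ) ^ q * (3 ^ q / 2) = 2 ^ q / 2 := by
    rw [mul_div_assoc', ← Real.mul_rpow (by norm_num) (by norm_num)]; norm_num
  have hG : (0 : ℝ) < 2 ^ q / 2 := by positivity
  have key : ((2 / 3 : ℝ) ^ q) ^ k * ((3 : ℝ) ^ q / 2) ^ (min k m) ≤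
      ((2 : ℝ) ^ q / 2) ^ m * ρ ^ ((k - m) + (m - k)) := by
    rcases le_total k m with h | h
    · rw [min_eq_left h, ← mul_pow, hτ, show k - m + (m - k) = m - k by omega]
      have h1 : (2 / (2 : ℝ) ^ q) ^ (m - k) ≤ ρ ^ (m - k) :=
        pow_le_pow_left₀ (by positivity) (le_max_right _ _) _
      have h2 : ((2 : ℝ) ^ q / 2) ^ k = ((2 : ℝ) ^ q / 2) ^ m * (2 / (2 : ℝ) ^ q) ^ (m - k) := by
        obtain ⟨j, rfl⟩ := Nat.exists_eq_add_of_le h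
        rw [Nat.add_sub_cancel_left, pow_add, mul_assoc, ← mul_pow, div_mul_div_cancel₀ (by positivity),
          div_self (by positivity), one_pow, mul_one]
      rw [h2]
      exact mul_le_mul_of_nonneg_left h1 (by positivity)
    · rw [min_eq_right h, show k - m + (m - k) = k - m by omega]
      have h1 : ((2 / 3 : ℝ) ^ q) ^ (k - m) ≤ ρ ^ (k - m) :=
        pow_le_pow_left₀ (by positivity) (le_max_left _ _) _
      have h2 : ((2 / 3 : ℝ) ^ q) ^ k * ((3 : ℝ) ^ q / 2) ^ m =
          ((2 : ℝ) ^ q / 2) ^ m * ((2 / 3 : ℝ) ^ q) ^ (k - m) := by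
        rw [← hτ, mul_pow]
        conv_lhs => rw [← Nat.add_sub_cancel' h, pow_add]
        ring
      rw [h2]
      exact mul_le_mul_of_nonneg_left h1 (by positivity)
  calc mass q k * (l ^ (q - 1) * A * 2 ^ k * (3 * ((3 : ℝ) ^ q / 2) ^ (min k m)))
      = 3 * A * l ^ (q - 1) * (((2 / 3 : ℝ) ^ q) ^ k * ((3 : ℝ) ^ q / 2) ^ (min k m)) := by
        rw [mass_eq, div_pow _ (2 : ℝ) k]
        field_simp
    _ ≤ 3 * A * l ^ (q - 1) * (((2 : ℝ) ^ q / 2) ^ m * ρ ^ ((k - m) + (m - k))) :=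
        mul_le_mul_of_nonneg_left key (by positivity)
    _ = _ := by
        rw [Real.mul_rpow h0.le (by positivity), pow_rpow_comm (by norm_num) m, div_pow,
          Real.rpow_sub_one h0.ne']
        field_simp

theorem tailIntegral_sig_le {I : Set ℝ} (hI : IsInterval I) {q d : ℝ} (hq : 1 < q)
    {b : ℕ → Bool} {m : ℕ}
    (hb : Metric.infDist (point b) I ≤ d + volume.real I)
    (hm : (1 / 3) ^ (m + 1) ≤ volume.real I + d) :
    tailIntegral q (sig q) I ≤ ENNReal.ofReal
      (2 * 3 * (3 ^ 11) ^ q / (1 - max ((2 / 3 : ℝ) ^ q) (2 / 2 ^ q)) *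
        ((volume.real I * 2 ^ m) ^ q / (volume.real I * 2 ^ m))) +
      ∫⁻ x, {x | Metric.infDist x I < d / 2}.indicator
        (fun _ => ENNReal.ofReal (1 / volume.real I)) x ∂(sig q) := by
  have h0 := hI.length_pos
  have hmeas : MeasurableSet {x | Metric.infDist x I < d / 2} :=
    measurableSet_lt (Metric.continuous_infDist_pt I).measurable measurable_const
  have hρ1 : max ((2 / 3 : ℝ) ^ q) (2 / 2 ^ q) < 1 := by
    refine max_lt (by linarith [rpow_two_thirds_lt hq]) ?_
    rw [div_lt_one (by positivity)]
    have := Real.rpow_lt_rpow_of_exponent_lt (show (1 : ℝ) < 2 by norm_num) hq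
    rwa [Real.rpow_one] at this
  have hρ0 : 0 < max ((2 / 3 : ℝ) ^ q) (2 / 2 ^ q) := lt_max_of_lt_left (by positivity)
  set κ : ℝ → ℝ := fun x => volume.real I ^ (q - 1) / (volume.real I + Metric.infDist x I) ^ q with hκ
  have hκ0 : ∀ x, 0 ≤ κ x := fun x => by
    have := Metric.infDist_nonneg (x := x) (s := I)
    positivity
  have hsplit : tailIntegral q (sig q) I ≤
      (∫⁻ x, ENNReal.ofReal ({x | d / 2 ≤ Metric.infDist x I}.indicator κ x) ∂(sig q)) +
      ∫⁻ x, {x | Metric.infDist x I < d / 2}.indicator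
        (fun _ => ENNReal.ofReal (1 / volume.real I)) x ∂(sig q) := by
    rw [← lintegral_add_right _ (measurable_const.indicator hmeas)]
    refine lintegral_mono fun x => ?_
    by_cases hx : Metric.infDist x I < d / 2
    · rw [indicator_of_mem (show x ∈ {x | Metric.infDist x I < d / 2} from hx)]
      exact le_add_left (ENNReal.ofReal_le_ofReal (tailKernel_le_inv hI (by linarith) x))
    · rw [indicator_of_mem (show x ∈ {x | d / 2 ≤ Metric.infDist x I} from not_lt.1 hx)]
      exact le_add_right le_rfl
  refine hsplit.trans (add_le_add_left ?_ _)
  rw [lintegral_sig]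
  refine (tsum_le_of_two_sided (K := 3 * (3 ^ 11) ^ q * ((volume.real I * 2 ^ m) ^ q /
    (volume.real I * 2 ^ m))) m (by positivity) hρ0 hρ1 fun k => ?_).trans (le_of_eq ?_)
  · have hnn : ∀ x, 0 ≤ {x | d / 2 ≤ Metric.infDist x I}.indicator κ x :=
      fun x => indicator_nonneg (fun x _ => hκ0 x) x
    rw [Finset.sum_congr rfl fun w _ => (ENNReal.ofReal_mul (mass_pos q k).le).symm,
      ← ENNReal.ofReal_sum_of_nonneg fun w _ => mul_nonneg (mass_pos q k).le (hnn _)]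
    exact ENNReal.ofReal_le_ofReal (level_tail_le hI hq hb hm k)
  · congr 1
    ring

/-- The σ-tail is split into zeros at distance at least d/2 and the possible nearer one. The first
part gives |I| 3^m ≤ 1 after multiplication by the ω-tail; for the second, criticality of the atom
gives (2/3)^k 3^k 2^(-k) = 1. -/
theorem muckenhoupt_le {p q : ℝ} (h : p.HolderConjugate q) :
    ∃ C : ℝ, ∀ I, IsInterval I → volume.real I < 1 →
      tailIntegral p measure I ^ (1 / p) * tailIntegral q (sig q) I ^ (1 / q) ≤
        ENNReal.ofReal C := by
  have hp := h.lt
  have hq := h.symm.lt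
  have hρ1 : 0 < 1 - max ((2 / 3 : ℝ) ^ q) (2 / 2 ^ q) := by
    refine sub_pos.2 (max_lt (by linarith [rpow_two_thirds_lt hq]) ?_)
    rw [div_lt_one (by positivity)]
    have := Real.rpow_lt_rpow_of_exponent_lt (show (1 : ℝ) < 2 by norm_num) hq
    rwa [Real.rpow_one] at this
  set C₁ : ℝ := 3 * 9 ^ p with hC₁
  set C₂ : ℝ := 2 * 3 * (3 ^ 11) ^ q / (1 - max ((2 / 3 : ℝ) ^ q) (2 / 2 ^ q)) with hC₂
  set C₃ : ℝ := C₁ * ((3 : ℝ) ^ p / 2) ^ 11 with hC₃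
  have p1 : 0 < C₁ := by positivity
  have p2 : 0 < C₂ := by positivity
  have p3 : 0 < C₃ := by positivity
  refine ⟨C₁ ^ (1 / p) * C₂ ^ (1 / q) + C₃ ^ (1 / p) * 1 ^ (1 / q), fun I hI hlt => ?_⟩
  have h0 := hI.length_pos
  obtain ⟨d, b, m, hd0, hd, hb, hm, hlm, hmr⟩ := exists_base hI hlt
  have hω := tailIntegral_measure_le hI hp hd hb hm
  have hσ := tailIntegral_sig_le hI hq hb hm
  have hq1 : 1 / q ≤ 1 := by
    rw [div_le_one (by linarith)]
    exact hq.le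
  refine (mul_le_mul_right (ENNReal.rpow_le_rpow hσ (by positivity)) _).trans ?_
  refine (mul_le_mul_right (ENNReal.rpow_add_le_add_rpow _ _ (by positivity) hq1) _).trans ?_
  rw [mul_add, ENNReal.ofReal_add (by positivity) (by positivity)]
  refine add_le_add ?_ ?_
  · refine (rpow_mul_rpow_le h (by positivity) (by positivity) (by positivity) p1.le p2.le
      hω le_rfl).trans (ENNReal.ofReal_le_ofReal (mul_le_of_le_one_right (by positivity) ?_))
    rw [mul_div_assoc, div_self (by positivity), mul_one]
    have h3 : (1 / 3 : ℝ) ^ m * 3 ^ m = 1 := by rw [← mul_pow]; norm_num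
    nlinarith [pow_pos (zero_lt_three' ℝ) m]
  · by_cases hex : ∃ v : (k : ℕ) × (Fin k → Bool), Metric.infDist (zero v.2) I < d / 2
    · obtain ⟨⟨k, w⟩, hv⟩ := hex
      have hS : ∫⁻ x, {x | Metric.infDist x I < d / 2}.indicator
          (fun _ => ENNReal.ofReal (1 / volume.real I)) x ∂(sig q) =
          ENNReal.ofReal (1 * (((2 / 3 : ℝ) ^ k) ^ q / (volume.real I * 2 ^ k))) := by
        rw [lintegral_sig', tsum_eq_single ⟨k, w⟩]
        · rw [indicator_of_mem (by exact hv), ← ENNReal.ofReal_mul (mass_pos q k).le]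
          congr 1
          rw [mass_eq, div_pow, pow_rpow_comm (by norm_num)]
          field_simp
        · intro v hne
          have hnot : zero v.2 ∉ {x | Metric.infDist x I < d / 2} :=
            fun hmem => hne (zero_unique_of_infDist hI hd hmem hv)
          rw [indicator_of_notMem hnot, mul_zero]
      -- A zero of generation `k` is at least about 3^(-k) away from `point b`. If it is near `I`,
      -- then the scale 3^(-m) cannot be much smaller than that.
      have hmk : m ≤ k + 11 := by
        rcases hmr with rfl | hmr
        · omega
        obtain ⟨n, hn, ha, hdist⟩ := exists_agree_zero k (ext w) b
        rw [pre_ext] at hdist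
        have h6 := hI.abs_sub_le_infDist (point b) (zero w)
        have hpos : 0 < |point b - zero w| := abs_pos.2 (sub_ne_zero.2 (point_ne_zero k w b))
        rw [div_le_iff₀ hpos] at hdist
        have hnk : (3 : ℝ) ^ n ≤ 3 ^ k := pow_le_pow_right₀ (by norm_num) hn
        have hv' : Metric.infDist (zero w) I < d / 2 := hv
        have h7 : |point b - zero w| ≤ 2 * (1 / 3) ^ m := by linarith
        have h8 : 1 ≤ 3 ^ 10 * 3 ^ k * (2 * (1 / 3 : ℝ) ^ m) := by
          refine hdist.trans (mul_le_mul ?_ h7 hpos.le (by positivity))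
          linarith
        have h9 : (3 : ℝ) ^ m ≤ 3 ^ (k + 11) := by
          have h3 : (1 / 3 : ℝ) ^ m * 3 ^ m = 1 := by rw [← mul_pow]; norm_num
          have h10 : (0 : ℝ) < 3 ^ m := by positivity
          calc (3 : ℝ) ^ m ≤ 3 ^ 10 * 3 ^ k * (2 * (1 / 3 : ℝ) ^ m) * 3 ^ m :=
                le_mul_of_one_le_left h10.le h8
            _ = 3 ^ 10 * 3 ^ k * 2 := by rw [mul_assoc, mul_assoc 2, h3, mul_one]
            _ ≤ 3 ^ (k + 11) := by rw [pow_add]; nlinarith [pow_pos (zero_lt_three' ℝ) k]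
        exact (pow_le_pow_iff_right₀ (by norm_num)).1 h9
      -- The ω-tail is rewritten at the scale of the near zero; since 3^p/2 ≥ 1, passing from `m` to
      -- `k + 11` only increases it, at the cost of the constant in `C₃`.
      have hω' : tailIntegral p measure I ≤ ENNReal.ofReal
          (C₃ * ((volume.real I * 3 ^ k) ^ p / (volume.real I * 2 ^ k))) := by
        refine hω.trans (ENNReal.ofReal_le_ofReal ?_)
        have e : ∀ j : ℕ, (volume.real I * 3 ^ j) ^ p / (volume.real I * 2 ^ j) =
            volume.real I ^ p / volume.real I * ((3 : ℝ) ^ p / 2) ^ j := fun j => by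
          rw [Real.mul_rpow h0.le (by positivity), pow_rpow_comm (by norm_num), div_pow]
          field_simp
        rw [e, e, hC₃, mul_assoc C₁]
        refine mul_le_mul_of_nonneg_left ?_ p1.le
        rw [mul_left_comm, ← pow_add, add_comm 11]
        refine mul_le_mul_of_nonneg_left (pow_le_pow_right₀ ?_ hmk) (by positivity)
        have := Real.rpow_le_rpow_of_exponent_le (show (1 : ℝ) ≤ 3 by norm_num) hp.le
        rw [Real.rpow_one] at this
        linarith
      refine (rpow_mul_rpow_le h (by positivity) (by positivity) (by positivity) p3.le zero_le_one
        hω' hS.le).trans (ENNReal.ofReal_le_ofReal (mul_le_of_le_one_right (by positivity) ?_))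
      rw [mul_assoc, ← mul_pow, mul_div_mul_left _ _ h0.ne']
      norm_num
    · push Not at hex
      have hS : ∫⁻ x, {x | Metric.infDist x I < d / 2}.indicator
          (fun _ => ENNReal.ofReal (1 / volume.real I)) x ∂(sig q) = 0 := by
        rw [lintegral_sig']
        simp only [ENNReal.tsum_eq_zero]
        intro v
        rw [indicator_of_notMem (by simpa using hex v), mul_zero]
      rw [hS, ENNReal.zero_rpow_of_pos (by positivity), mul_zero]
      exact zero_le

theorem muckenhoupt_sig_lt_top {p q : ℝ} (h : p.HolderConjugate q) :
    muckenhoupt p (sig q) measure < ∞ := by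
  have hp := h.lt
  have hq := h.symm.lt
  obtain ⟨C, hC⟩ := muckenhoupt_le h
  have := isFiniteMeasure_sig hq
  unfold muckenhoupt
  rw [h.conjExponent_eq]
  refine lt_of_le_of_lt (b := max (ENNReal.ofReal C) (sig q univ ^ (1 / q))) ?_
    (max_lt ENNReal.ofReal_lt_top (ENNReal.rpow_lt_top_of_nonneg (by positivity) (measure_ne_top _ _)))
  refine iSup₂_le fun I hI => ?_
  rcases lt_or_ge (volume.real I) 1 with h1 | h1
  · exact (hC I hI h1).trans (le_max_left _ _)
  · refine le_trans ?_ (le_max_right _ _)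
    calc _ ≤ measure univ ^ (1 / p) * sig q univ ^ (1 / q) :=
          mul_le_mul' (ENNReal.rpow_le_rpow (tailIntegral_le_of_one_le hI h.pos h1 _)
            (by positivity)) (ENNReal.rpow_le_rpow (tailIntegral_le_of_one_le hI h.symm.pos h1 _)
            (by positivity))
      _ = _ := by rw [measure_univ, ENNReal.one_rpow, one_mul]

theorem T1Hypotheses_sig {p q : ℝ} (h : p.HolderConjugate q) :
    T1Hypotheses p (sig q) measure where
  locallyFinite_left := by
    have := isFiniteMeasure_sig h.symm.lt
    infer_instance
  locallyFinite_right := inferInstance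
  muckenhoupt_lt_top := muckenhoupt_sig_lt_top h
  testing_forward := testing_sig h
  testing_backward := by
    rw [h.conjExponent_eq]
    exact testing_measure h.symm.lt

theorem T1Hypotheses_measure {p q : ℝ} (h : p.HolderConjugate q) :
    T1Hypotheses p measure (sig p) where
  locallyFinite_left := inferInstance
  locallyFinite_right := by
    have := isFiniteMeasure_sig h.lt
    infer_instance
  muckenhoupt_lt_top := by
    have := muckenhoupt_sig_lt_top h.symm
    unfold muckenhoupt at this ⊢
    rw [h.symm.conjExponent_eq] at this
    rw [h.conjExponent_eq]
    simpa only [mul_comm] using this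
  testing_forward := testing_measure h.lt
  testing_backward := by
    rw [h.conjExponent_eq]
    exact testing_sig h.symm

end Cantor

/-! ### Failure of boundedness from a single function, and the construction of such functions -/

namespace TwoWeight

theorem measurable_hilbertTrunc {σ : Measure ℝ} [SFinite σ] {f : ℝ → ℝ} (hf : Measurable f)
    (ε R : ℝ) : StronglyMeasurable (hilbertTrunc ε R σ f) := by
  have hd : Measurable fun z : ℝ × ℝ => |z.2 - z.1| :=
    (measurable_snd.sub measurable_fst).abs
  have hS : MeasurableSet {z : ℝ × ℝ | ε < |z.2 - z.1| ∧ |z.2 - z.1| < R} :=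
    (measurableSet_lt measurable_const hd).inter (measurableSet_lt hd measurable_const)
  have hm : Measurable ({z : ℝ × ℝ | ε < |z.2 - z.1| ∧ |z.2 - z.1| < R}.indicator
      fun z => f z.2 / (z.2 - z.1)) :=
    ((hf.comp measurable_snd).div (measurable_snd.sub measurable_fst)).indicator hS
  have e : hilbertTrunc ε R σ f = fun x => ∫ y, {z : ℝ × ℝ | ε < |z.2 - z.1| ∧ |z.2 - z.1| < R}.indicator
      (fun z => f z.2 / (z.2 - z.1)) (x, y) ∂σ := by
    funext x
    have hm' : MeasurableSet {y | ε < |y - x| ∧ |y - x| < R} :=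
      hS.preimage (measurable_prodMk_left (x := x))
    rw [hilbertTrunc, ← integral_indicator hm']
    rfl
  rw [e]
  exact StronglyMeasurable.integral_prod_right (f := fun x y =>
    {z : ℝ × ℝ | ε < |z.2 - z.1| ∧ |z.2 - z.1| < R}.indicator (fun z => f z.2 / (z.2 - z.1)) (x, y))
    hm.stronglyMeasurable

theorem tendsto_hilbertTrunc {σ : Measure ℝ} {f : ℝ → ℝ} {x : ℝ} (h : Converges σ f x) :
    Filter.Tendsto (fun n : ℕ => hilbertTrunc (1 / ((n : ℝ) + 1)) ((n : ℝ) + 2) σ f x) Filter.atTop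
      (nhds (hilbert σ f x)) := by
  have hd : Measurable fun y : ℝ => |y - x| := (measurable_id.sub_const x).abs
  have hU : (⋃ n : ℕ, {y | 1 / ((n : ℝ) + 1) < |y - x| ∧ |y - x| < (n : ℝ) + 2}) = {x}ᶜ := by
    ext y
    simp only [mem_iUnion, mem_ofPred_eq, mem_compl_iff, mem_singleton_iff]
    constructor
    · rintro ⟨n, h1, -⟩ rfl
      rw [sub_self, abs_zero] at h1
      have : (0 : ℝ) < 1 / ((n : ℝ) + 1) := by positivity
      linarith
    · intro hy
      obtain ⟨n, hn⟩ := exists_nat_one_div_lt (abs_pos.2 (sub_ne_zero.2 hy))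
      obtain ⟨m, hm⟩ := exists_nat_gt |y - x|
      refine ⟨max n m, lt_of_le_of_lt (one_div_le_one_div_of_le (by positivity) ?_) hn, ?_⟩
      · gcongr
        exact le_max_left _ _
      · have : (m : ℝ) ≤ (max n m : ℕ) := by exact_mod_cast le_max_right n m
        linarith
  have key := tendsto_setIntegral_of_monotone (μ := σ) (f := fun y => f y / (y - x))
    (s := fun n : ℕ => {y | 1 / ((n : ℝ) + 1) < |y - x| ∧ |y - x| < (n : ℝ) + 2})
    (fun n => (measurableSet_lt measurable_const hd).inter (measurableSet_lt hd measurable_const))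
    (fun n m hnm y hy => ⟨lt_of_le_of_lt (one_div_le_one_div_of_le (by positivity) (by gcongr)) hy.1,
      hy.2.trans_le (by gcongr)⟩) h.2.integrableOn
  have e : hilbert σ f x = ∫ y in {x}ᶜ, f y / (y - x) ∂σ := by
    have : ({x}ᶜ : Set ℝ) =ᵐ[σ] univ := by
      rw [ae_eq_univ, compl_compl]
      exact h.1
    rw [setIntegral_congr_set this, setIntegral_univ]
    rfl
  rw [hU, ← e] at key
  exact key

/-- Where the integral converges absolutely, the truncations tend to it, so Fatou's lemma would
transfer a uniform bound to Hf itself. -/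
theorem not_hilbertBounded {p : ℝ} (hp : 0 < p) {σ ω : Measure ℝ} [SFinite σ] {f : ℝ → ℝ}
    (hf : Measurable f) (hfp : MemLp f (ENNReal.ofReal p) σ) (hc : ∀ᵐ x ∂ω, Converges σ f x)
    (htop : ∫⁻ x, ENNReal.ofReal (|hilbert σ f x| ^ p) ∂ω = ∞) : ¬ HilbertBounded p σ ω := by
  rintro ⟨C, hC⟩
  have h1 : eLpNorm (hilbert σ f) (ENNReal.ofReal p) ω ≤ C * eLpNorm f (ENNReal.ofReal p) σ := by
    refine (Lp.eLpNorm_lim_le_liminf_eLpNorm (f := fun n : ℕ =>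
      hilbertTrunc (1 / ((n : ℝ) + 1)) ((n : ℝ) + 2) σ f)
      (fun n => (measurable_hilbertTrunc hf _ _).aestronglyMeasurable) (hilbert σ f) ?_).trans ?_
    · filter_upwards [hc] with x hx using tendsto_hilbertTrunc hx
    · refine (Filter.liminf_le_liminf (v := fun _ : ℕ => C * eLpNorm f (ENNReal.ofReal p) σ)
        (Filter.Eventually.of_forall fun n => hC _ _ (by positivity) ?_ f hfp)).trans
        (le_of_eq (Filter.liminf_const _))
      have : 1 / ((n : ℝ) + 1) ≤ 1 := by
        rw [div_le_one (by positivity)]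
        linarith [(Nat.cast_nonneg n : (0 : ℝ) ≤ n)]
      linarith [(Nat.cast_nonneg n : (0 : ℝ) ≤ n)]
  have h2 : eLpNorm (hilbert σ f) (ENNReal.ofReal p) ω < ∞ :=
    h1.trans_lt (ENNReal.mul_lt_top ENNReal.coe_lt_top hfp.2)
  rw [eLpNorm_lt_top_iff_lintegral_rpow_enorm_lt_top (ENNReal.ofReal_pos.2 hp).ne'
    ENNReal.ofReal_ne_top, ENNReal.toReal_ofReal hp.le] at h2
  simp only [ofReal_abs_rpow _ hp.le] at htop
  exact h2.ne htop

/-- Functions with disjoint supports on which `H` is large locally, and which interact weakly,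
add up to a function on which `H` is infinite. -/
theorem exists_witness_of_blocks {p : ℝ} (hp : 1 ≤ p) {σ ω : Measure ℝ} [IsFiniteMeasure ω]
    {R : ℕ → Set ℝ} (hR : Pairwise fun i j => Disjoint (R i) (R j)) (hRm : ∀ i, MeasurableSet (R i))
    {f : ℕ → ℝ → ℝ} (hf : ∀ i, Measurable (f i)) (hsupp : ∀ i x, x ∉ R i → f i x = 0)
    (hnorm : ∀ i, ∫⁻ y, ‖f i y‖ₑ ^ p ∂σ ≤ 2⁻¹ ^ i) {C : ℝ≥0}
    (hconv : ∀ᵐ x ∂ω, σ {x} = 0 ∧ ∀ i, ∫⁻ y, ‖f i y / (y - x)‖ₑ ∂σ < ∞ ∧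
      (x ∉ R i → ∫⁻ y, ‖f i y / (y - x)‖ₑ ∂σ ≤ C * 2⁻¹ ^ i))
    (hlarge : ∀ i : ℕ, (i : ℝ≥0∞) ≤ ∫⁻ x in R i, ‖hilbert σ (f i) x‖ₑ ^ p ∂ω) :
    ∃ F : ℝ → ℝ, Measurable F ∧ MemLp F (ENNReal.ofReal p) σ ∧ (∀ᵐ x ∂ω, Converges σ F x) ∧
      ∫⁻ x, ENNReal.ofReal (|hilbert σ F x| ^ p) ∂ω = ∞ := by
  classical
  have hp0 : 0 < p := by linarith
  have hgeom : ∑' i : ℕ, (2⁻¹ : ℝ≥0∞) ^ i = 2 := ENNReal.tsum_geometric_two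
  have huniq : ∀ {i j x}, x ∈ R i → x ∈ R j → i = j := by
    intro i j x hi hj
    by_contra hne
    exact (Set.disjoint_left.1 (hR hne)) hi hj
  set F : ℝ → ℝ := fun y => ∑' i, f i y with hF
  have hval : ∀ {j y}, y ∈ R j → F y = f j y := by
    intro j y hy
    exact tsum_eq_single j fun i hi => hsupp i y fun h => hi (huniq h hy)
  have hval0 : ∀ {y}, (∀ j, y ∉ R j) → F y = 0 := by
    intro y hy
    simp only [hF, hsupp _ y (hy _), tsum_zero]
  have hFm : Measurable F := by
    refine measurable_of_tendsto_metrizable (f := fun n y => ∑ i ∈ Finset.range n, f i y)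
      (fun n => Finset.measurable_sum _ fun i _ => hf i) (tendsto_pi_nhds.2 fun y => ?_)
    refine HasSum.tendsto_sum_nat (Summable.hasSum ?_)
    by_cases hy : ∃ j, y ∈ R j
    · obtain ⟨j, hj⟩ := hy
      exact (hasSum_single j fun i hi => hsupp i y fun h => hi (huniq h hj)).summable
    · push Not at hy
      simp only [hsupp _ y (hy _)]
      exact summable_zero
  have hFp : MemLp F (ENNReal.ofReal p) σ := by
    refine ⟨hFm.aestronglyMeasurable, ?_⟩
    rw [eLpNorm_lt_top_iff_lintegral_rpow_enorm_lt_top (ENNReal.ofReal_pos.2 hp0).ne'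
      ENNReal.ofReal_ne_top, ENNReal.toReal_ofReal hp0.le]
    calc ∫⁻ y, ‖F y‖ₑ ^ p ∂σ ≤ ∫⁻ y, ∑' i, ‖f i y‖ₑ ^ p ∂σ := by
          refine lintegral_mono fun y => ?_
          by_cases hy : ∃ j, y ∈ R j
          · obtain ⟨j, hj⟩ := hy
            rw [hval hj]
            exact ENNReal.le_tsum j
          · push Not at hy
            simp [hval0 hy, hp0]
      _ = ∑' i, ∫⁻ y, ‖f i y‖ₑ ^ p ∂σ :=
          lintegral_tsum fun i => ((hf i).enorm.pow_const p).aemeasurable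
      _ ≤ ∑' i : ℕ, 2⁻¹ ^ i := ENNReal.tsum_le_tsum hnorm
      _ < ∞ := by rw [hgeom]; exact ENNReal.ofNat_lt_top
  have hmk : ∀ x i, Measurable fun y => f i y / (y - x) := fun x i =>
    (hf i).div (measurable_id.sub_const x)
  have hFb : ∀ x, ∫⁻ y, ‖F y / (y - x)‖ₑ ∂σ ≤ ∑' i, ∫⁻ y, ‖f i y / (y - x)‖ₑ ∂σ := by
    intro x
    rw [← lintegral_tsum fun i => (hmk x i).enorm.aemeasurable]
    refine lintegral_mono fun y => ?_
    by_cases hy : ∃ j, y ∈ R j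
    · obtain ⟨j, hj⟩ := hy
      rw [hval hj]
      exact ENNReal.le_tsum j
    · push Not at hy
      simp [hval0 hy]
  -- The influence of the other blocks on block `j`; by `hconv` and ∑ 2^(-i) = 2 it is at most 2C
  -- there.
  have hoff : ∀ j x, ∫⁻ y, ‖(F y - f j y) / (y - x)‖ₑ ∂σ ≤
      ∑' i, if i = j then 0 else ∫⁻ y, ‖f i y / (y - x)‖ₑ ∂σ := by
    intro j x
    have e : ∀ i, (if i = j then 0 else ∫⁻ y, ‖f i y / (y - x)‖ₑ ∂σ) =
        ∫⁻ y, (if i = j then 0 else ‖f i y / (y - x)‖ₑ) ∂σ := by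
      intro i
      split_ifs <;> simp
    simp only [e]
    rw [← lintegral_tsum fun i => by
      split_ifs
      exacts [aemeasurable_const, (hmk x i).enorm.aemeasurable]]
    refine lintegral_mono fun y => ?_
    by_cases hy : ∃ i, y ∈ R i
    · obtain ⟨i, hi⟩ := hy
      rw [hval hi]
      by_cases hij : i = j
      · simp [hij]
      · have : f j y = 0 := hsupp j y fun h => hij (huniq hi h)
        rw [this, sub_zero]
        refine le_trans (le_of_eq ?_) (ENNReal.le_tsum i)
        rw [if_neg hij]
    · push Not at hy
      simp [hval0 hy, hsupp j y (hy j)]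
  have hsum : ∀ᵐ x ∂ω, σ {x} = 0 ∧ (∀ i, ∫⁻ y, ‖f i y / (y - x)‖ₑ ∂σ < ∞) ∧ ∀ j,
      (x ∈ R j ∨ ∀ i, x ∉ R i) →
      (∑' i, if i = j then 0 else ∫⁻ y, ‖f i y / (y - x)‖ₑ ∂σ) ≤ C * 2 := by
    filter_upwards [hconv] with x hx
    refine ⟨hx.1, fun i => (hx.2 i).1, fun j hj => ?_⟩
    rw [← hgeom, ← ENNReal.tsum_mul_left]
    refine ENNReal.tsum_le_tsum fun i => ?_
    split_ifs with hij
    · exact zero_le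
    · refine (hx.2 i).2 fun hi => ?_
      rcases hj with hj | hj
      · exact hij (huniq hi hj)
      · exact hj i hi
  have hcF : ∀ᵐ x ∂ω, Converges σ F x := by
    filter_upwards [hsum] with x hx
    refine ⟨hx.1, (hFm.div (measurable_id.sub_const x)).aestronglyMeasurable,
      (hFb x).trans_lt ?_⟩
    obtain ⟨j, hj⟩ : ∃ j, x ∈ R j ∨ ∀ i, x ∉ R i := by
      by_cases h : ∃ j, x ∈ R j
      · exact ⟨h.choose, Or.inl h.choose_spec⟩
      · exact ⟨0, Or.inr (by simpa using h)⟩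
    calc ∑' i, ∫⁻ y, ‖f i y / (y - x)‖ₑ ∂σ
        ≤ ∑' i, ((if i = j then 0 else ∫⁻ y, ‖f i y / (y - x)‖ₑ ∂σ) +
          if i = j then ∫⁻ y, ‖f i y / (y - x)‖ₑ ∂σ else 0) := by
          refine ENNReal.tsum_le_tsum fun i => ?_
          split_ifs <;> simp
      _ = (∑' i, if i = j then 0 else ∫⁻ y, ‖f i y / (y - x)‖ₑ ∂σ) +
          ∫⁻ y, ‖f j y / (y - x)‖ₑ ∂σ := by
          rw [ENNReal.tsum_add, tsum_ite_eq]
      _ ≤ C * 2 + ∫⁻ y, ‖f j y / (y - x)‖ₑ ∂σ := add_le_add_left (hx.2.2 j hj) _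
      _ < ∞ := ENNReal.add_lt_top.2 ⟨ENNReal.mul_lt_top ENNReal.coe_lt_top ENNReal.ofNat_lt_top,
          hx.2.1 j⟩
  refine ⟨F, hFm, hFp, hcF, ?_⟩
  simp only [ofReal_abs_rpow _ hp0.le]
  by_contra hne
  set X := ∫⁻ x, ‖hilbert σ F x‖ₑ ^ p ∂ω with hX
  -- On block `j` the function H(f j) differs from HF by at most 2C, so a finite integral `X` would
  -- bound all the integrals in `hlarge` at once.
  have hkey : ∀ j : ℕ, (j : ℝ≥0∞) ≤ 2 ^ (p - 1) * (X + (C * 2) ^ p * ω univ) := by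
    intro j
    refine (hlarge j).trans ?_
    calc ∫⁻ x in R j, ‖hilbert σ (f j) x‖ₑ ^ p ∂ω
        ≤ ∫⁻ x in R j, 2 ^ (p - 1) * (‖hilbert σ F x‖ₑ ^ p + (C * 2) ^ p) ∂ω := by
          refine setLIntegral_mono_ae' (hRm j) ?_
          filter_upwards [hsum, hcF] with x hx hxF hxj
          have hfj : Integrable (fun y => f j y / (y - x)) σ :=
            ⟨(hmk x j).aestronglyMeasurable, hx.2.1 j⟩
          have e : hilbert σ (f j) x = hilbert σ F x - hilbert σ (fun y => F y - f j y) x := by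
            unfold hilbert
            have hdiff : Integrable (fun y => (F y - f j y) / (y - x)) σ := by
              simp only [sub_div]
              exact hxF.2.sub hfj
            rw [← integral_sub hxF.2 hdiff]
            congr 1
            funext y
            ring
          have h1 : ‖hilbert σ (fun y => F y - f j y) x‖ₑ ≤ C * 2 :=
            (enorm_hilbert_le _ _ _).trans ((hoff j x).trans (hx.2.2 j (Or.inl hxj)))
          rw [e]
          refine le_trans (ENNReal.rpow_le_rpow (enorm_sub_le.trans (add_le_add_right h1 _)) hp0.le) ?_
          exact ENNReal.rpow_add_le_mul_rpow_add_rpow _ _ hp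
      _ ≤ ∫⁻ x, 2 ^ (p - 1) * (‖hilbert σ F x‖ₑ ^ p + (C * 2) ^ p) ∂ω := setLIntegral_le_lintegral _ _
      _ = _ := by
          rw [lintegral_const_mul' _ _ (ENNReal.rpow_ne_top_of_nonneg (by linarith) ENNReal.ofNat_ne_top),
            lintegral_add_right _ measurable_const, lintegral_const]
  have hfin : 2 ^ (p - 1) * (X + (C * 2) ^ p * ω univ) ≠ ∞ := by
    refine ENNReal.mul_ne_top (ENNReal.rpow_ne_top_of_nonneg (by linarith) ENNReal.ofNat_ne_top)
      (ENNReal.add_ne_top.2 ⟨hne, ENNReal.mul_ne_top ?_ (measure_ne_top _ _)⟩)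
    exact ENNReal.rpow_ne_top_of_nonneg hp0.le (ENNReal.mul_ne_top ENNReal.coe_ne_top
      ENNReal.ofNat_ne_top)
  obtain ⟨n, hn⟩ := ENNReal.exists_nat_gt hfin
  exact absurd (hkey n) (not_le.2 hn)

end TwoWeight

/-! ### Blocks of words, and large functions on the discrete measure -/

namespace TwoWeight

/-- Used to compare L² with L^p in both regimes: lower bounds in L² pass up to p > 2, and upper
bounds in L² pass down to p < 2. -/
theorem lintegral_rpow_le_of_measure_le_one {α : Type*} [MeasurableSpace α] {μ : Measure α}
    (hμ : μ univ ≤ 1) {r : ℝ} (hr : 1 ≤ r) {F : α → ℝ≥0∞} (hF : AEMeasurable F μ) :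
    (∫⁻ x, F x ∂μ) ^ r ≤ ∫⁻ x, F x ^ r ∂μ := by
  rcases hr.eq_or_lt with rfl | hr
  · simp
  have hc := Real.HolderConjugate.conjExponent hr
  have h := ENNReal.lintegral_mul_le_Lp_mul_Lq μ hc hF (aemeasurable_const (b := (1 : ℝ≥0∞)))
  simp only [Pi.mul_apply, mul_one, ENNReal.one_rpow, lintegral_one] at h
  have h1 : μ univ ^ (1 / r.conjExponent) ≤ 1 :=
    ENNReal.rpow_le_one hμ (by have := hc.symm.pos; positivity)
  have h2 : ∫⁻ x, F x ∂μ ≤ (∫⁻ x, F x ^ r ∂μ) ^ (1 / r) := by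
    calc _ ≤ (∫⁻ x, F x ^ r ∂μ) ^ (1 / r) * μ univ ^ (1 / r.conjExponent) := h
      _ ≤ (∫⁻ x, F x ^ r ∂μ) ^ (1 / r) * 1 := mul_le_mul_right h1 _
      _ = _ := mul_one _
  calc (∫⁻ x, F x ∂μ) ^ r ≤ ((∫⁻ x, F x ^ r ∂μ) ^ (1 / r)) ^ r :=
        ENNReal.rpow_le_rpow h2 (by linarith)
    _ = _ := by rw [← ENNReal.rpow_mul, one_div_mul_cancel (by linarith), ENNReal.rpow_one]

/-- Signs can be chosen such that the square norm of a sum is at least the sum of the squares. -/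
theorem exists_signs_sq {α ι : Type*} [MeasurableSpace α] {μ : Measure α} (s : Finset ι)
    {g : ι → α → ℝ} (hg : ∀ i ∈ s, MemLp (g i) 2 μ) :
    ∃ ε : ι → ℝ, (∀ i, |ε i| = 1) ∧
      ∑ i ∈ s, ∫ x, g i x ^ 2 ∂μ ≤ ∫ x, (∑ i ∈ s, ε i * g i x) ^ 2 ∂μ := by
  classical
  induction s using Finset.induction_on with
  | empty => exact ⟨fun _ => 1, by simp, by simp⟩
  | insert a s ha ih =>
    obtain ⟨ε, h1, h2⟩ := ih fun i hi => hg i (Finset.mem_insert_of_mem hi)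
    have hF : MemLp (fun x => ∑ i ∈ s, ε i * g i x) 2 μ :=
      memLp_finsetSum _ fun i hi => (hg i (Finset.mem_insert_of_mem hi)).const_mul _
    have hga := hg a (Finset.mem_insert_self a s)
    set F : α → ℝ := fun x => ∑ i ∈ s, ε i * g i x with hFdef
    -- The new sign makes the cross term with the sum chosen so far nonnegative.
    set δ : ℝ := if 0 ≤ ∫ x, F x * g a x ∂μ then 1 else -1 with hδ
    have hδ1 : |δ| = 1 := by rw [hδ]; split_ifs <;> simp
    have hδ2 : 0 ≤ δ * ∫ x, F x * g a x ∂μ := by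
      rw [hδ]
      split_ifs with h
      · simpa using h
      · linarith [not_le.1 h]
    have hδ3 : δ ^ 2 = 1 := by rw [← sq_abs, hδ1, one_pow]
    refine ⟨Function.update ε a δ, fun i => ?_, ?_⟩
    · by_cases hi : i = a
      · subst hi; simpa using hδ1
      · rw [Function.update_of_ne hi]; exact h1 i
    · have e : ∀ x, (∑ i ∈ insert a s, Function.update ε a δ i * g i x) ^ 2 =
          F x ^ 2 + 2 * δ * (F x * g a x) + g a x ^ 2 := by
        intro x
        rw [Finset.sum_insert ha, Function.update_self]
        have : ∑ i ∈ s, Function.update ε a δ i * g i x = F x := by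
          refine Finset.sum_congr rfl fun i hi => ?_
          rw [Function.update_of_ne (by rintro rfl; exact ha hi)]
        rw [this]
        linear_combination (g a x) ^ 2 * hδ3
      have i1 : Integrable (fun x => F x ^ 2) μ := hF.integrable_sq
      have i12 : Integrable (fun x => F x ^ 2 + 2 * δ * (F x * g a x)) μ :=
        hF.integrable_sq.add ((hF.integrable_mul hga).const_mul _)
      have i2 : Integrable (fun x => 2 * δ * (F x * g a x)) μ := (hF.integrable_mul hga).const_mul _
      have i3 : Integrable (fun x => g a x ^ 2) μ := hga.integrable_sq
      simp only [e]
      rw [integral_add i12 i3, integral_add i1 i2, integral_const_mul, Finset.sum_insert ha]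
      linarith

theorem exists_nat_rpow_ge {s : ℝ} (hs : 0 < s) (K : ℝ) : ∃ L : ℕ, 0 < L ∧ K ≤ (L : ℝ) ^ s := by
  have h := ((tendsto_rpow_atTop hs).comp tendsto_natCast_atTop_atTop).eventually_ge_atTop K
  obtain ⟨L, h1, h2⟩ := (h.and (Filter.eventually_gt_atTop 0)).exists
  exact ⟨L, h2, h1⟩

end TwoWeight

namespace Cantor

open TwoWeight

/-- The words with the same first `m` digits as `b`, of the `L` generations from `m` on. -/
def block (b : ℕ → Bool) (m L : ℕ) : Finset ((k : ℕ) × (Fin k → Bool)) :=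
  (Finset.Ico m (m + L)).sigma fun _ => Finset.univ.filter fun w => Agree m (ext w) b

theorem mem_block {b : ℕ → Bool} {m L : ℕ} {v : (k : ℕ) × (Fin k → Bool)} :
    v ∈ block b m L ↔ (m ≤ v.1 ∧ v.1 < m + L) ∧ Agree m (ext v.2) b := by
  simp [block]

theorem sum_block (b : ℕ → Bool) (m L : ℕ) (g : ℕ → ℝ) :
    ∑ v ∈ block b m L, g v.1 = ∑ i ∈ Finset.range L, 2 ^ i * g (m + i) := by
  rw [block, Finset.sum_sigma, Finset.sum_Ico_eq_sum_range, Nat.add_sub_cancel_left]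
  refine Finset.sum_congr rfl fun i _ => ?_
  dsimp only
  rw [Finset.sum_const, card_agree b (Nat.le_add_right m i), Nat.add_sub_cancel_left, nsmul_eq_mul]
  push_cast
  rfl

/-- Each of the `L` generations tiles the Cantor set in the cell and so contributes the full mass
2^(-m). This factor `L` drives all the counterexamples on blocks. -/
theorem sum_block_half (b : ℕ → Bool) (m L : ℕ) :
    ∑ v ∈ block b m L, (1 / 2 : ℝ) ^ v.1 = L * (1 / 2) ^ m := by
  rw [sum_block b m L fun k => (1 / 2 : ℝ) ^ k]
  have : ∀ i ∈ Finset.range L, (2 : ℝ) ^ i * (1 / 2) ^ (m + i) = (1 / 2) ^ m := fun i _ => by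
    rw [pow_add, mul_left_comm, ← mul_pow]
    norm_num
  rw [Finset.sum_congr rfl this]
  simp

theorem interval_subset_of_mem_block {b : ℕ → Bool} {m L : ℕ} {v : (k : ℕ) × (Fin k → Bool)}
    (h : v ∈ block b m L) : interval v.2 ⊆ interval (pre b m) := by
  obtain ⟨⟨h1, -⟩, h2⟩ := mem_block.1 h
  have := interval_pre_subset (ext v.2) h1
  rwa [pre_ext, h2.pre_eq] at this

/-- The sequence with exactly `j` ones, at the beginning. -/
def ones (j : ℕ) : ℕ → Bool := fun i => decide (i < j)

/-- Pairwise disjoint Cantor intervals. -/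
def cell (j : ℕ) : Set ℝ := interval (pre (ones j) (j + 1))

theorem measurableSet_cell (j : ℕ) : MeasurableSet (cell j) := measurableSet_Icc

theorem disjoint_cell : Pairwise fun i j => Disjoint (cell i) (cell j) := by
  have key : ∀ i j, i < j → Disjoint (cell i) (cell j) := by
    intro i j hij
    refine Set.disjoint_left.2 fun x hx hy => ?_
    have ha : Agree i (ones i) (ones j) := fun n hn => by simp [ones, hn, hn.trans hij]
    have := dist_of_ne ha (by simp [ones, hij]) (Nat.lt_succ_self i) (show i < j + 1 by omega) hx hy
    rw [sub_self, abs_zero] at this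
    exact absurd this (not_le.2 (by positivity))
  intro i j hij
  rcases lt_or_gt_of_ne hij with h | h
  · exact key i j h
  · exact (key j i h).symm

theorem measure_restrict_cell_le (j : ℕ) : (measure.restrict (cell j)) univ ≤ 1 := by
  rw [Measure.restrict_apply_univ]
  exact prob_le_one

/-! ### Functions carried by finitely many zeros -/

theorem zero_injective : Function.Injective fun v : (k : ℕ) × (Fin k → Bool) => zero v.2 := by
  intro v v' h
  by_contra hne
  have h' : zero v.2 = zero v'.2 := h
  rcases le_total v.1 v'.1 with hle | hle
  · obtain ⟨c, hc⟩ := exists_point_between v.2 v'.2 hle hne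
    rw [← h', uIcc_self] at hc
    exact point_ne_zero _ _ c hc
  · obtain ⟨c, hc⟩ := exists_point_between v'.2 v.2 hle (Ne.symm hne)
    rw [h', uIcc_self] at hc
    exact point_ne_zero _ _ c hc

theorem sig_singleton (t : ℝ) (v : (k : ℕ) × (Fin k → Bool)) :
    (sig t).real {zero v.2} = mass t v.1 := by
  rw [measureReal_def, ← lintegral_indicator_one (measurableSet_singleton _), lintegral_sig',
    tsum_eq_single v]
  · simp [(mass_pos t v.1).le]
  · intro v' hne
    have : zero v'.2 ≠ zero v.2 := fun h => hne (zero_injective h)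
    simp [this]

/-- The function with values `c v` at finitely many zeros. -/
noncomputable def atoms (B : Finset ((k : ℕ) × (Fin k → Bool))) (c : (k : ℕ) × (Fin k → Bool) → ℝ) :
    ℝ → ℝ := fun y => ∑ v ∈ B, ({zero v.2} : Set ℝ).indicator (fun _ => c v) y

theorem measurable_atoms (B : Finset ((k : ℕ) × (Fin k → Bool)))
    (c : (k : ℕ) × (Fin k → Bool) → ℝ) : Measurable (atoms B c) :=
  Finset.measurable_sum _ fun _ _ => measurable_const.indicator (measurableSet_singleton _)

theorem atoms_zero (B : Finset ((k : ℕ) × (Fin k → Bool))) (c : (k : ℕ) × (Fin k → Bool) → ℝ)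
    (v : (k : ℕ) × (Fin k → Bool)) : atoms B c (zero v.2) = if v ∈ B then c v else 0 := by
  have e : ∀ u ∈ B, ({zero u.2} : Set ℝ).indicator (fun _ => c u) (zero v.2) =
      if v = u then c u else 0 := by
    intro u _
    by_cases h : v = u
    · subst h; simp
    · have : zero v.2 ≠ zero u.2 := fun h' => h (zero_injective h')
      simp [h, this]
  rw [atoms, Finset.sum_congr rfl e, Finset.sum_ite_eq]

theorem atoms_of_notMem {B : Finset ((k : ℕ) × (Fin k → Bool))}
    {c : (k : ℕ) × (Fin k → Bool) → ℝ} {y : ℝ} (h : ∀ v ∈ B, y ≠ zero v.2) : atoms B c y = 0 :=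
  Finset.sum_eq_zero fun v hv => indicator_of_notMem (show y ∉ ({zero v.2} : Set ℝ) from h v hv) _

theorem lintegral_atoms (t : ℝ) {B : Finset ((k : ℕ) × (Fin k → Bool))} {Φ : ℝ → ℝ≥0∞}
    (h : ∀ v ∉ B, Φ (zero v.2) = 0) :
    ∫⁻ y, Φ y ∂(sig t) = ∑ v ∈ B, ENNReal.ofReal (mass t v.1) * Φ (zero v.2) := by
  rw [lintegral_sig']
  exact tsum_eq_sum fun v hv => by rw [h v hv, mul_zero]

theorem hilbert_atoms {t : ℝ} (ht : 1 < t) (B : Finset ((k : ℕ) × (Fin k → Bool)))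
    (c : (k : ℕ) × (Fin k → Bool) → ℝ) (x : ℝ) :
    hilbert (sig t) (atoms B c) x = ∑ v ∈ B, mass t v.1 * (c v / (zero v.2 - x)) := by
  have := isFiniteMeasure_sig ht
  have e : ∀ y, atoms B c y / (y - x) =
      ∑ v ∈ B, ({zero v.2} : Set ℝ).indicator (fun _ => c v / (zero v.2 - x)) y := by
    intro y
    rw [atoms, Finset.sum_div]
    refine Finset.sum_congr rfl fun v _ => ?_
    by_cases hy : y = zero v.2
    · subst hy; simp
    · have hy' : y ∉ ({zero v.2} : Set ℝ) := hy
      rw [indicator_of_notMem hy', indicator_of_notMem hy', zero_div]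
  unfold hilbert
  simp only [e]
  rw [integral_finsetSum _ fun v _ => (integrable_const _).indicator (measurableSet_singleton _)]
  refine Finset.sum_congr rfl fun v _ => ?_
  rw [integral_indicator_const _ (measurableSet_singleton _), sig_singleton, smul_eq_mul]

theorem abs_kernel_le {k : ℕ} (w : Fin k → Bool) (c : ℕ → Bool) :
    1 / |point c - zero w| ≤ 3 ^ 10 * 3 ^ k := by
  obtain ⟨n, hn, -, h⟩ := exists_agree_zero k (ext w) c
  rw [pre_ext] at h
  refine h.trans (mul_le_mul_of_nonneg_left (pow_le_pow_right₀ (by norm_num) hn) (by positivity))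

/-- Outside a Cantor interval the kernel is bounded on the scale of that interval. -/
theorem abs_kernel_le_of_not_agree {k m : ℕ} {w : Fin k → Bool} {c : ℕ → Bool}
    (hw : m ≤ k → ¬ Agree m (ext w) c) : 1 / |point c - zero w| ≤ 3 ^ 10 * 3 ^ m := by
  obtain ⟨n, hn, ha, h⟩ := exists_agree_zero k (ext w) c
  rw [pre_ext] at h
  refine h.trans (mul_le_mul_of_nonneg_left (pow_le_pow_right₀ (by norm_num) ?_) (by positivity))
  by_contra hcon
  push Not at hcon
  exact hw (hcon.le.trans hn) (ha.mono hcon.le)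

/-- Criticality of the masses: an atom normalized so that its image has size about 1 on its Cantor
interval has the p-th power norm ω(I_w). The identity rests on (p - 1) q = p. -/
theorem mass_mul_rpow_div {p q : ℝ} (h : p.HolderConjugate q) (k : ℕ) :
    mass q k * ((1 / 3) ^ k / mass q k) ^ p = (1 / 2) ^ k := by
  have hm := mass_pos q k
  have h1 : mass q k ^ (p - 1) = ((1 / 2) ^ k) ^ (p - 1) * ((2 / 3) ^ k) ^ p := by
    have e : ((2 / 3 : ℝ) ^ q) ^ (p - 1) = (2 / 3) ^ p := by
      rw [← Real.rpow_mul (by norm_num), mul_comm, h.sub_one_mul_conj]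
    rw [mass_eq, pow_rpow_comm (by positivity), Real.div_rpow (by positivity) (by norm_num), e,
      div_pow, pow_rpow_comm (by norm_num), pow_rpow_comm (by norm_num),
      Real.div_rpow zero_le_one (by norm_num), Real.one_rpow, one_div, inv_pow]
    ring
  have h2 : (((1 : ℝ) / 3) ^ k) ^ p = ((1 / 2) ^ k) ^ p * ((2 / 3) ^ k) ^ p := by
    rw [← Real.mul_rpow (by positivity) (by positivity), ← mul_pow]
    norm_num
  have h3 : ((1 / 2 : ℝ) ^ k) ^ (p - 1) = ((1 / 2) ^ k) ^ p / (1 / 2) ^ k :=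
    Real.rpow_sub_one (by positivity) p
  have h4 : mass q k * (1 / mass q k ^ p) = 1 / mass q k ^ (p - 1) := by
    rw [Real.rpow_sub_one hm.ne']
    field_simp
  rw [Real.div_rpow (by positivity) hm.le, div_eq_mul_one_div, mul_left_comm, h4, h1, h2, h3]
  have a1 : ((1 / 2 : ℝ) ^ k) ^ p ≠ 0 := by positivity
  have a2 : ((2 / 3 : ℝ) ^ k) ^ p ≠ 0 := by positivity
  field_simp

/-- Seen from outside the cell the kernel does not exceed the scale 3^m of the cell, so the
generations decay like (2/3)^i and the bound is uniform in `L`. -/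
theorem sum_block_kernel_le {b c : ℕ → Bool} {m : ℕ} (L : ℕ) (hc : ¬ Agree m b c) :
    ∑ v ∈ block b m L, (1 / 3 : ℝ) ^ v.1 * (1 / |point c - zero v.2|) ≤ 3 ^ 11 := by
  refine (Finset.sum_le_sum (g := fun v => (1 / 3 : ℝ) ^ v.1 * (3 ^ 10 * 3 ^ m)) fun v hv => ?_).trans ?_
  · refine mul_le_mul_of_nonneg_left (abs_kernel_le_of_not_agree fun _ ha => hc ?_) (by positivity)
    exact (mem_block.1 hv).2.symm.trans ha
  · rw [sum_block b m L fun k => (1 / 3 : ℝ) ^ k * (3 ^ 10 * 3 ^ m)]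
    have e : ∀ i ∈ Finset.range L, (2 : ℝ) ^ i * ((1 / 3) ^ (m + i) * (3 ^ 10 * 3 ^ m)) =
        3 ^ 10 * (2 / 3) ^ i := fun i _ => by
      rw [pow_add, div_pow, div_pow, div_pow, one_pow, one_pow]
      field_simp
    rw [Finset.sum_congr rfl e, ← Finset.mul_sum]
    have := sum_le_hasSum (Finset.range L) (fun n _ => by positivity)
      (hasSum_geometric_of_lt_one (r := (2 / 3 : ℝ)) (by norm_num) (by norm_num))
    norm_num at this ⊢
    linarith

theorem memLp_cell {j : ℕ} {g : ℝ → ℝ} (hg : Measurable g) {C : ℝ} (h : ∀ c, |g (point c)| ≤ C)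
    (r : ℝ≥0∞) : MemLp g r (measure.restrict (cell j)) :=
  MemLp.of_bound hg.aestronglyMeasurable C (ae_restrict_of_ae (ae_of_point fun c => h c))

theorem abs_scaled_kernel_le {k : ℕ} (w : Fin k → Bool) (c : ℕ → Bool) :
    |(1 / 3) ^ k / (zero w - point c)| ≤ 3 ^ 10 := by
  have h := abs_kernel_le w c
  rw [abs_div, abs_of_pos (by positivity), abs_sub_comm, div_eq_mul_one_div]
  calc (1 / 3 : ℝ) ^ k * (1 / |point c - zero w|) ≤ (1 / 3) ^ k * (3 ^ 10 * 3 ^ k) :=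
        mul_le_mul_of_nonneg_left h (by positivity)
    _ = 3 ^ 10 := by rw [mul_left_comm, ← mul_pow]; norm_num

theorem abs_sub_le_of_mem_interval {k : ℕ} {w : Fin k → Bool} {x y : ℝ} (hx : x ∈ interval w)
    (hy : y ∈ interval w) : |x - y| ≤ (1 / 3) ^ k := by
  rw [one_div_pow, abs_le]
  constructor <;> linarith [hx.1, hx.2, hy.1, hy.2]

theorem half_pow_le_integral_sq {j L : ℕ} {v : (k : ℕ) × (Fin k → Bool)}
    (hv : v ∈ block (ones j) (j + 1) L) :
    (1 / 2 : ℝ) ^ v.1 ≤ ∫ x in cell j, ((1 / 3) ^ v.1 / (zero v.2 - x)) ^ 2 ∂measure := by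
  have hm : Measurable fun x => (1 / 3 : ℝ) ^ v.1 / (zero v.2 - x) :=
    measurable_const.div (measurable_const.sub measurable_id)
  have e : ∫ x in cell j, (interval v.2).indicator 1 x ∂measure = (1 / 2 : ℝ) ^ v.1 := by
    rw [integral_indicator_one (by exact measurableSet_Icc),
      measureReal_restrict_apply (by exact measurableSet_Icc),
      inter_eq_left.2 (show interval v.2 ⊆ cell j from interval_subset_of_mem_block hv), measureReal_interval]
  rw [← e]
  refine integral_mono_ae ((integrable_const _).indicator measurableSet_Icc)
    (memLp_cell hm (fun c => abs_scaled_kernel_le v.2 c) 2).integrable_sq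
    (ae_restrict_of_ae (ae_of_point fun c => ?_))
  by_cases hc : point c ∈ interval v.2
  · rw [indicator_of_mem hc, Pi.one_apply]
    dsimp only
    rw [← sq_abs, abs_div, abs_of_pos (by positivity)]
    have h1 := abs_sub_le_of_mem_interval (zero_mem_interval v.2) hc
    have h2 : 0 < |zero v.2 - point c| := abs_pos.2 (sub_ne_zero.2 (point_ne_zero _ _ c).symm)
    exact one_le_pow₀ ((one_le_div h2).2 h1)
  · rw [indicator_of_notMem hc]
    positivity

/-- The p-th power norm of the signed atoms is θ^p L 2^(-m), while the square norm of the image on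
the cell is at least θ² L 2^(-m). With θ a multiple of L^(-1/p), the former stays bounded and the
latter grows like L^(1-2/p). -/
theorem exists_block_sig {p q : ℝ} (h : p.HolderConjugate q) (hp : 2 < p) (j : ℕ) :
    ∃ f : ℝ → ℝ, Measurable f ∧ (∀ x, x ∉ cell j → f x = 0) ∧
      ∫⁻ y, ‖f y‖ₑ ^ p ∂(sig q) ≤ 2⁻¹ ^ j ∧
      (∀ c, ∫⁻ y, ‖f y / (y - point c)‖ₑ ∂(sig q) < ∞ ∧ (point c ∉ cell j →
        ∫⁻ y, ‖f y / (y - point c)‖ₑ ∂(sig q) ≤ (3 ^ 11 : ℝ≥0) * 2⁻¹ ^ j)) ∧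
      (j : ℝ≥0∞) ≤ ∫⁻ x in cell j, ‖hilbert (sig q) f x‖ₑ ^ p ∂measure := by
  have hp0 : 0 < p := by linarith
  have hq := h.symm.lt
  set m := j + 1 with hmdef
  -- The factors 4^j and 2^m absorb the 2^(-j) in θ and the mass of the cell. The target is j + 1
  -- rather than j, so that it is at least 1 and survives the power p/2 at the end.
  obtain ⟨L, hL0, hL⟩ := exists_nat_rpow_ge (s := 1 - 2 / p)
    (by rw [sub_pos, div_lt_one hp0]; exact hp) (4 ^ j * 2 ^ m * (j + 1))
  have hLpos : (0 : ℝ) < L := by exact_mod_cast hL0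
  set θ : ℝ := (1 / 2) ^ j * (L : ℝ) ^ (-(1 / p)) with hθ
  have hθ0 : 0 < θ := by positivity
  have hLp : (L : ℝ) ^ (-(1 / p)) ≤ 1 := by
    refine Real.rpow_le_one_of_one_le_of_nonpos (by exact_mod_cast hL0) ?_
    rw [neg_nonpos]
    positivity
  have hθ1 : θ ≤ (1 / 2) ^ j := mul_le_of_le_one_right (by positivity) hLp
  set B := block (ones j) m L with hB
  obtain ⟨ε, hε1, hε2⟩ := exists_signs_sq (μ := measure.restrict (cell j)) B
    (g := fun v x => (1 / 3 : ℝ) ^ v.1 / (zero v.2 - x)) fun v _ =>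
      memLp_cell (measurable_const.div (measurable_const.sub measurable_id))
        (fun c => abs_scaled_kernel_le v.2 c) 2
  set c : (k : ℕ) × (Fin k → Bool) → ℝ := fun v => θ * (ε v * ((1 / 3) ^ v.1 / mass q v.1)) with hc
  have hcabs : ∀ v, |c v| = θ * ((1 / 3) ^ v.1 / mass q v.1) := fun v => by
    have := mass_pos q v.1
    rw [hc]
    dsimp only
    rw [abs_mul θ, abs_mul (ε v), hε1, one_mul, abs_of_pos hθ0, abs_of_pos (by positivity)]
  have hkernel : ∀ x, ∫⁻ y, ‖atoms B c y / (y - x)‖ₑ ∂(sig q) =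
      ENNReal.ofReal (θ * ∑ v ∈ B, (1 / 3 : ℝ) ^ v.1 * (1 / |x - zero v.2|)) := by
    intro x
    rw [lintegral_atoms q (B := B) fun v hv => by simp [atoms_zero, hv], Finset.mul_sum,
      ENNReal.ofReal_sum_of_nonneg fun v _ => by positivity]
    refine Finset.sum_congr rfl fun v hv => ?_
    rw [atoms_zero, if_pos hv, Real.enorm_eq_ofReal_abs, ← ENNReal.ofReal_mul (mass_pos q v.1).le,
      abs_div, hcabs, abs_sub_comm]
    congr 1
    have := (mass_pos q v.1).ne'
    field_simp
  refine ⟨atoms B c, measurable_atoms B c, fun x hx => ?_, ?_, fun d => ⟨?_, fun hd => ?_⟩, ?_⟩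
  · refine atoms_of_notMem fun v hv => ?_
    rintro rfl
    exact hx (interval_subset_of_mem_block hv (zero_mem_interval v.2))
  · rw [lintegral_atoms q (B := B) fun v hv => by simp [atoms_zero, hv, hp0]]
    have e : ∀ v ∈ B, ENNReal.ofReal (mass q v.1) * ‖atoms B c (zero v.2)‖ₑ ^ p =
        ENNReal.ofReal (θ ^ p * (1 / 2) ^ v.1) := by
      intro v hv
      rw [atoms_zero, if_pos hv, ← ofReal_abs_rpow _ hp0.le, ← ENNReal.ofReal_mul (mass_pos q v.1).le,
        hcabs, Real.mul_rpow hθ0.le (by have := mass_pos q v.1; positivity), mul_left_comm,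
        mass_mul_rpow_div h]
    rw [Finset.sum_congr rfl e, ← ENNReal.ofReal_sum_of_nonneg fun v _ => by positivity,
      ← Finset.mul_sum, sum_block_half]
    have e2 : (2⁻¹ : ℝ≥0∞) ^ j = ENNReal.ofReal ((1 / 2) ^ j) := by
      rw [ENNReal.ofReal_pow (by norm_num), one_div, ENNReal.ofReal_inv_of_pos (by norm_num)]
      simp
    rw [e2]
    refine ENNReal.ofReal_le_ofReal ?_
    have e3 : θ ^ p * L = ((1 / 2) ^ j) ^ p := by
      rw [hθ, Real.mul_rpow (by positivity) (by positivity), ← Real.rpow_mul hLpos.le, neg_mul,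
        one_div_mul_cancel hp0.ne', Real.rpow_neg_one, mul_assoc, inv_mul_cancel₀ hLpos.ne', mul_one]
    rw [← mul_assoc, e3]
    have e4 : ((1 / 2 : ℝ) ^ j) ^ p ≤ 1 :=
      Real.rpow_le_one (by positivity) (pow_le_one₀ (by norm_num) (by norm_num)) hp0.le
    have e5 : (1 / 2 : ℝ) ^ m ≤ (1 / 2) ^ j :=
      pow_le_pow_of_le_one (by norm_num) (by norm_num) (by omega)
    calc ((1 / 2 : ℝ) ^ j) ^ p * (1 / 2) ^ m ≤ 1 * (1 / 2) ^ j :=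
          mul_le_mul e4 e5 (by positivity) zero_le_one
      _ = _ := one_mul _
  · rw [hkernel]
    exact ENNReal.ofReal_lt_top
  · rw [hkernel]
    have h1 := sum_block_kernel_le (b := ones j) (m := m) (c := d) L
      (fun ha => hd (point_mem_pre.2 ha))
    have e2 : ((3 ^ 11 : ℝ≥0) : ℝ≥0∞) * (2⁻¹ : ℝ≥0∞) ^ j = ENNReal.ofReal ((1 / 2) ^ j * 3 ^ 11) := by
      rw [ENNReal.ofReal_mul (by positivity), ENNReal.ofReal_pow (by norm_num), one_div,
        ENNReal.ofReal_inv_of_pos (by norm_num), mul_comm, ENNReal.ofReal_pow (by norm_num)]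
      simp
    rw [e2]
    exact ENNReal.ofReal_le_ofReal (mul_le_mul hθ1 h1
      (Finset.sum_nonneg fun v _ => by positivity) (by positivity))
  · have hH : ∀ x, hilbert (sig q) (atoms B c) x =
        θ * ∑ v ∈ B, ε v * ((1 / 3 : ℝ) ^ v.1 / (zero v.2 - x)) := by
      intro x
      rw [hilbert_atoms hq, Finset.mul_sum]
      refine Finset.sum_congr rfl fun v _ => ?_
      have := (mass_pos q v.1).ne'
      rw [hc]
      field_simp
    have hmem : MemLp (fun x => ∑ v ∈ B, ε v * ((1 / 3 : ℝ) ^ v.1 / (zero v.2 - x))) 2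
        (measure.restrict (cell j)) :=
      memLp_finsetSum _ fun v _ => (memLp_cell (measurable_const.div
        (measurable_const.sub measurable_id)) (fun c => abs_scaled_kernel_le v.2 c) 2).const_mul _
    have hlow : (L : ℝ) * (1 / 2) ^ m ≤
        ∫ x in cell j, (∑ v ∈ B, ε v * ((1 / 3 : ℝ) ^ v.1 / (zero v.2 - x))) ^ 2 ∂measure := by
      rw [← sum_block_half (ones j)]
      exact (Finset.sum_le_sum fun v hv => half_pow_le_integral_sq hv).trans hε2
    have hsq : ENNReal.ofReal (j + 1) ≤
        ∫⁻ x in cell j, ‖hilbert (sig q) (atoms B c) x‖ₑ ^ (2 : ℝ) ∂measure := by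
      calc ENNReal.ofReal (j + 1) ≤ ENNReal.ofReal (∫ x in cell j,
            (θ * ∑ v ∈ B, ε v * ((1 / 3 : ℝ) ^ v.1 / (zero v.2 - x))) ^ 2 ∂measure) := by
            refine ENNReal.ofReal_le_ofReal ?_
            simp only [mul_pow]
            rw [integral_const_mul]
            refine le_trans ?_ (mul_le_mul_of_nonneg_left hlow (by positivity))
            have e6 : θ ^ 2 * L = (L : ℝ) ^ (1 - 2 / p) / 4 ^ j := by
              rw [hθ, mul_pow, ← pow_mul, ← Real.rpow_natCast ((L : ℝ) ^ _), ← Real.rpow_mul hLpos.le,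
                sub_eq_add_neg, Real.rpow_add hLpos, Real.rpow_one]
              have e7 : -(1 / p) * ((2 : ℕ) : ℝ) = -(2 / p) := by push_cast; ring
              have e8 : ((1 : ℝ) / 2) ^ (j * 2) = 1 / 4 ^ j := by
                rw [mul_comm, pow_mul, one_div_pow, one_div_pow]; norm_num
              rw [e7, e8]
              ring
            rw [← mul_assoc, e6, one_div_pow, div_mul_div_comm, mul_one,
              le_div_iff₀ (by positivity)]
            linarith
        _ = _ := by
            rw [ofReal_integral_eq_lintegral_ofReal]
            · refine lintegral_congr fun x => ?_
              rw [hH, ← ofReal_abs_rpow _ (by norm_num)]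
              congr 1
              rw [Real.rpow_two, sq_abs]
            · exact (hmem.const_mul θ).integrable_sq
            · exact Filter.Eventually.of_forall fun x => sq_nonneg _
    have hHm : Measurable fun x => hilbert (sig q) (atoms B c) x := by
      simp only [hH]
      exact measurable_const.mul (Finset.measurable_sum _ fun v _ => measurable_const.mul
        (measurable_const.div (measurable_const.sub measurable_id)))
    calc (j : ℝ≥0∞) ≤ ENNReal.ofReal (j + 1) := by
          rw [← ENNReal.ofReal_natCast]
          exact ENNReal.ofReal_le_ofReal (by linarith)
      _ ≤ ENNReal.ofReal (j + 1) ^ (p / 2) := by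
          refine ENNReal.le_rpow_self_of_one_le ?_ (by linarith)
          rw [← ENNReal.ofReal_one]
          exact ENNReal.ofReal_le_ofReal (by linarith [(Nat.cast_nonneg j : (0 : ℝ) ≤ j)])
      _ ≤ (∫⁻ x in cell j, ‖hilbert (sig q) (atoms B c) x‖ₑ ^ (2 : ℝ) ∂measure) ^ (p / 2) :=
          ENNReal.rpow_le_rpow hsq (by linarith)
      _ ≤ ∫⁻ x in cell j, (‖hilbert (sig q) (atoms B c) x‖ₑ ^ (2 : ℝ)) ^ (p / 2) ∂measure :=
          lintegral_rpow_le_of_measure_le_one (measure_restrict_cell_le j) (by linarith)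
            (hHm.enorm.pow_const _).aemeasurable
      _ = _ := by
          refine lintegral_congr fun x => ?_
          rw [← ENNReal.rpow_mul, mul_div_cancel₀ _ two_ne_zero]

theorem exists_witness_sig {p q : ℝ} (h : p.HolderConjugate q) (hp : 2 < p) :
    ∃ F : ℝ → ℝ, Measurable F ∧ MemLp F (ENNReal.ofReal p) (sig q) ∧
      (∀ᵐ x ∂measure, Converges (sig q) F x) ∧
      ∫⁻ x, ENNReal.ofReal (|hilbert (sig q) F x| ^ p) ∂measure = ∞ := by
  choose f h1 h2 h3 h4 h5 using exists_block_sig h hp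
  exact exists_witness_of_blocks (by linarith) disjoint_cell measurableSet_cell h1 h2 h3
    (ae_of_point fun c => ⟨sig_singleton_point q c, fun i => h4 i c⟩) h5

end Cantor

/-! ### Large functions on the Cantor measure -/

namespace TwoWeight

/-- Convexity, as `y` is the mean of `x + y` and `-(x - y)`. In `exists_signs_rpow` it says that
averaging over one sign cannot destroy either summand. -/
theorem two_mul_abs_rpow_le {p : ℝ} (hp : 1 ≤ p) (x y : ℝ) :
    2 * |y| ^ p ≤ |x + y| ^ p + |x - y| ^ p := by
  have h1 : |y| ≤ (1 / 2 : ℝ) • |x + y| + (1 / 2 : ℝ) • |x - y| := by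
    have := abs_sub (x + y) (x - y)
    rw [show x + y - (x - y) = 2 * y by ring, abs_mul, abs_two] at this
    simp only [smul_eq_mul]
    linarith
  have h2 := (convexOn_rpow hp).2 (mem_Ici.2 (abs_nonneg (x + y))) (mem_Ici.2 (abs_nonneg (x - y)))
    (show (0 : ℝ) ≤ 1 / 2 by norm_num) (show (0 : ℝ) ≤ 1 / 2 by norm_num) (by norm_num)
  have h3 := Real.rpow_le_rpow (abs_nonneg y) h1 (by linarith : 0 ≤ p)
  simp only [smul_eq_mul] at h2 h3
  linarith

/-- Signs can be chosen such that, in an average sense, the diagonal of a matrix is a lower bound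
for the signed sums of its columns. -/
theorem exists_signs_rpow {ι : Type*} [DecidableEq ι] {p : ℝ} (hp : 1 ≤ p) (T B : Finset ι)
    {s : ι → ℝ} (hs : ∀ i, 0 ≤ s i) (A : ι → ι → ℝ) (D : ι → ℝ) :
    ∃ ε : ι → ℝ, (∀ i, |ε i| = 1) ∧
      ∑ v ∈ T, s v * (if v ∈ B then |A v v| ^ p else |D v| ^ p) ≤
        ∑ v ∈ T, s v * |D v + ∑ u ∈ B, ε u * A u v| ^ p := by
  induction B using Finset.induction_on generalizing D with
  | empty => exact ⟨fun _ => 1, by simp, by simp⟩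
  | insert a B ha ih =>
    -- If both signs failed, adding the two strict inequalities would contradict convexity. The row
    -- `a` keeps its diagonal entry, the rows not yet treated keep their `D`; the induction then
    -- continues with the chosen column absorbed into `D`.
    have key : ∃ δ : ℝ, |δ| = 1 ∧
        ∑ v ∈ T, s v * (if v ∈ insert a B then |A v v| ^ p else |D v| ^ p) ≤
        ∑ v ∈ T, s v * (if v ∈ B then |A v v| ^ p else |D v + δ * A a v| ^ p) := by
      by_contra hcon
      push Not at hcon
      have h1 := hcon 1 (by simp)
      have h2 := hcon (-1) (by simp)
      have h3 : ∑ v ∈ T, s v * (if v ∈ insert a B then |A v v| ^ p else |D v| ^ p) +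
          ∑ v ∈ T, s v * (if v ∈ insert a B then |A v v| ^ p else |D v| ^ p) ≤
          ∑ v ∈ T, s v * (if v ∈ B then |A v v| ^ p else |D v + 1 * A a v| ^ p) +
          ∑ v ∈ T, s v * (if v ∈ B then |A v v| ^ p else |D v + -1 * A a v| ^ p) := by
        rw [← Finset.sum_add_distrib, ← Finset.sum_add_distrib]
        refine Finset.sum_le_sum fun v _ => ?_
        rw [← mul_add, ← mul_add]
        refine mul_le_mul_of_nonneg_left ?_ (hs v)
        rw [one_mul, neg_one_mul, ← sub_eq_add_neg]
        by_cases hvB : v ∈ B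
        · simp [hvB]
        · by_cases hva : v = a
          · subst hva
            simp only [Finset.mem_insert_self, if_true, hvB, if_false]
            linarith [two_mul_abs_rpow_le hp (D v) (A v v)]
          · simp only [Finset.mem_insert, hva, hvB, or_self, if_false]
            have := two_mul_abs_rpow_le hp (A a v) (D v)
            rw [add_comm (A a v) (D v), abs_sub_comm (A a v) (D v)] at this
            linarith
      linarith
    obtain ⟨δ, hδ, hle⟩ := key
    obtain ⟨ε, h1, h2⟩ := ih fun v => D v + δ * A a v
    refine ⟨Function.update ε a δ, fun i => ?_, hle.trans (h2.trans (le_of_eq ?_))⟩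
    · by_cases hi : i = a
      · subst hi; simpa using hδ
      · rw [Function.update_of_ne hi]; exact h1 i
    · refine Finset.sum_congr rfl fun v _ => ?_
      rw [Finset.sum_insert ha, Function.update_self, add_assoc]
      congr 5
      refine Finset.sum_congr rfl fun u hu => ?_
      rw [Function.update_of_ne (by rintro rfl; exact ha hu)]

end TwoWeight

namespace Cantor

open TwoWeight

/-! ### Haar functions on the Cantor set -/

open Classical in
/-- The Haar function of a Cantor interval. -/
noncomputable def haar {k : ℕ} (w : Fin k → Bool) (y : ℝ) : ℝ :=
  if y ∈ interval w then (if y < zero w then 1 else -1) else 0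

theorem measurable_haar {k : ℕ} (w : Fin k → Bool) : Measurable (haar w) :=
  Measurable.ite measurableSet_Icc
    (Measurable.ite measurableSet_Iio measurable_const measurable_const) measurable_const

theorem abs_haar_le {k : ℕ} (w : Fin k → Bool) (y : ℝ) : |haar w y| ≤ 1 := by
  unfold haar
  split_ifs <;> simp

theorem haar_sq {k : ℕ} (w : Fin k → Bool) (y : ℝ) :
    haar w y * haar w y = (interval w).indicator 1 y := by
  unfold haar
  by_cases h : y ∈ interval w
  · rw [indicator_of_mem h, if_pos h]
    split_ifs <;> simp
  · simp [h]

theorem haar_point {k : ℕ} (w : Fin k → Bool) (c : ℕ → Bool) :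
    haar w (point c) = if Agree k (ext w) c then (if c k then -1 else 1) else 0 := by
  have h1 : point c ∈ interval w ↔ Agree k (ext w) c := by
    rw [← point_mem_pre, pre_ext]
  unfold haar
  by_cases ha : Agree k (ext w) c
  · rw [if_pos ha, if_pos (h1.2 ha)]
    have h2 := point_side c k
    rw [← ha.pre_eq, pre_ext] at h2
    have hz := (zero_spec w).1
    cases hc : c k
    · have : point c < zero w := (h2.1 hc).trans_lt hz.1
      simp [this]
    · have : ¬ point c < zero w := not_lt.2 (hz.2.le.trans (h2.2 hc))
      simp [this]
  · rw [if_neg ha, if_neg (fun h => ha (h1.1 h))]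

theorem integrable_haar_mul {k l : ℕ} (w : Fin k → Bool) (u : Fin l → Bool) :
    Integrable (fun y => haar w y * haar u y) measure := by
  refine Integrable.of_bound ((measurable_haar w).mul (measurable_haar u)).aestronglyMeasurable 1
    (Filter.Eventually.of_forall fun y => ?_)
  rw [Real.norm_eq_abs, abs_mul]
  exact mul_le_one₀ (abs_haar_le w y) (abs_nonneg _) (abs_haar_le u y)

theorem integral_haar {k : ℕ} (w : Fin k → Bool) : ∫ y, haar w y ∂measure = 0 := by
  have hi : ∀ v, Integrable ((interval (pre (Function.update (ext w) k v) (k + 1))).indicator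
      (1 : ℝ → ℝ)) measure := fun v => (integrable_const (1 : ℝ)).indicator measurableSet_Icc
  have hint : ∀ v, ∫ y, (interval (pre (Function.update (ext w) k v) (k + 1))).indicator
      (1 : ℝ → ℝ) y ∂measure = (1 / 2) ^ (k + 1) := fun v => by
    rw [integral_indicator_one (by exact measurableSet_Icc), measureReal_interval]
  have hag : ∀ v c, Agree (k + 1) (Function.update (ext w) k v) c ↔ Agree k (ext w) c ∧ c k = v := by
    intro v c
    constructor
    · intro h
      refine ⟨fun i hi => ?_, ?_⟩
      · have := h i (by omega)
        rwa [Function.update_of_ne hi.ne] at this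
      · have := h k (by omega)
        rw [Function.update_self] at this
        exact this.symm
    · rintro ⟨h, h'⟩ i hi
      rcases (Nat.lt_succ_iff.1 hi).lt_or_eq with hlt | rfl
      · rw [Function.update_of_ne hlt.ne]
        exact h i hlt
      · rw [Function.update_self, h']
  calc ∫ y, haar w y ∂measure
      = ∫ y, ((interval (pre (Function.update (ext w) k false) (k + 1))).indicator 1 y -
          (interval (pre (Function.update (ext w) k true) (k + 1))).indicator 1 y) ∂measure := by
        refine integral_congr_ae (ae_of_point fun c => ?_)
        dsimp only
        classical
        simp only [haar_point, indicator_apply, point_mem_pre, hag, Pi.one_apply]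
        by_cases ha : Agree k (ext w) c <;> cases hc : c k <;> simp [ha]
    _ = 0 := by rw [integral_sub (hi _) (hi _), hint, hint, sub_self]

/-- A Haar function is constant on the Cantor points of any strictly later Cantor interval, and
vanishes on those of the other intervals of its own generation. Orthogonality follows since Haar
functions have mean zero. -/
theorem haar_mul_eq {k l : ℕ} {u : Fin k → Bool} {w : Fin l → Bool} (hkl : k ≤ l)
    (hne : (⟨k, u⟩ : (k : ℕ) × (Fin k → Bool)) ≠ ⟨l, w⟩) (c : ℕ → Bool) :
    haar u (point c) * haar w (point c) = haar u (point (ext w)) * haar w (point c) := by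
  rw [haar_point w]
  split_ifs with h h1
  all_goals first
    | rw [mul_zero, mul_zero]
    | skip
  all_goals
    congr 1
    rcases hkl.lt_or_eq with hlt | rfl
    · rw [haar_point, haar_point, h k hlt]
      have : Agree k (ext u) c ↔ Agree k (ext u) (ext w) :=
        ⟨fun h2 => h2.trans (h.mono hkl).symm, fun h2 => h2.trans (h.mono hkl)⟩
      simp only [this]
    · have hn : ¬ Agree k (ext u) (ext w) := by
        intro h2
        have := h2.pre_eq
        rw [pre_ext, pre_ext] at this
        exact hne (by rw [this])
      rw [haar_point, haar_point, if_neg hn, if_neg fun h2 => hn (h2.trans h.symm)]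

theorem integral_haar_mul {u v : (k : ℕ) × (Fin k → Bool)} (hne : u ≠ v) :
    ∫ y, haar u.2 y * haar v.2 y ∂measure = 0 := by
  have key : ∀ {u v : (k : ℕ) × (Fin k → Bool)}, u ≠ v → u.1 ≤ v.1 →
      ∫ y, haar u.2 y * haar v.2 y ∂measure = 0 := by
    intro u v hne hle
    calc ∫ y, haar u.2 y * haar v.2 y ∂measure
        = ∫ y, haar u.2 (point (ext v.2)) * haar v.2 y ∂measure :=
          integral_congr_ae (ae_of_point fun c => haar_mul_eq hle hne c)
      _ = 0 := by rw [integral_const_mul, integral_haar, mul_zero]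
  rcases le_total u.1 v.1 with h | h
  · exact key hne h
  · simp only [mul_comm (haar u.2 _)]
    exact key hne.symm h

theorem integral_haar_self {k : ℕ} (w : Fin k → Bool) :
    ∫ y, haar w y * haar w y ∂measure = (1 / 2) ^ k := by
  simp only [haar_sq]
  rw [integral_indicator_one (by exact measurableSet_Icc), measureReal_interval]

theorem integral_sum_haar_sq (B : Finset ((k : ℕ) × (Fin k → Bool)))
    {ε : (k : ℕ) × (Fin k → Bool) → ℝ} (hε : ∀ v, |ε v| = 1) :
    ∫ y, (∑ v ∈ B, ε v * haar v.2 y) ^ 2 ∂measure = ∑ v ∈ B, (1 / 2 : ℝ) ^ v.1 := by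
  have e : ∀ y, (∑ v ∈ B, ε v * haar v.2 y) ^ 2 =
      ∑ u ∈ B, ∑ v ∈ B, ε u * ε v * (haar u.2 y * haar v.2 y) := by
    intro y
    rw [sq, Finset.sum_mul_sum]
    refine Finset.sum_congr rfl fun u _ => Finset.sum_congr rfl fun v _ => ?_
    ring
  have hi : ∀ u v : (k : ℕ) × (Fin k → Bool),
      Integrable (fun y => ε u * ε v * (haar u.2 y * haar v.2 y)) measure :=
    fun u v => (integrable_haar_mul u.2 v.2).const_mul _
  simp only [e]
  rw [integral_finsetSum _ fun u _ => integrable_finsetSum _ fun v _ => hi u v]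
  refine Finset.sum_congr rfl fun u hu => ?_
  rw [integral_finsetSum _ fun v _ => hi u v, Finset.sum_eq_single u]
  · rw [integral_const_mul, integral_haar_self, ← abs_mul_abs_self, hε]
    ring
  · intro v _ hne
    rw [integral_const_mul, integral_haar_mul hne.symm, mul_zero]
  · exact fun h => absurd hu h

theorem integrable_haar_kernel {k l : ℕ} (u : Fin k → Bool) (w : Fin l → Bool) :
    Integrable (fun y => haar u y / (y - zero w)) measure := by
  refine Integrable.of_bound ((measurable_haar u).div
    (measurable_id.sub_const _)).aestronglyMeasurable (3 ^ 10 * 3 ^ l) (ae_of_point fun c => ?_)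
  rw [Real.norm_eq_abs, abs_div]
  exact (div_le_div_of_nonneg_right (abs_haar_le u _) (abs_nonneg _)).trans (abs_kernel_le w c)

/-- The Haar function changes sign at the singularity of the kernel, so the integrand has one sign
and is at least 3^k in absolute value on a set of mass 2^(-k). -/
theorem le_abs_hilbert_haar {k : ℕ} (w : Fin k → Bool) :
    (3 / 2) ^ k ≤ |hilbert measure (haar w) (zero w)| := by
  have e : ∫ y, (3 : ℝ) ^ k * (interval w).indicator 1 y ∂measure = (3 / 2) ^ k := by
    rw [integral_const_mul, integral_indicator_one (by exact measurableSet_Icc),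
      measureReal_interval, ← mul_pow]
    norm_num
  rw [← e, ← abs_neg]
  refine le_trans ?_ (le_abs_self _)
  unfold hilbert
  rw [← integral_neg]
  refine integral_mono_ae (((integrable_const (1 : ℝ)).indicator measurableSet_Icc).const_mul _)
    (integrable_haar_kernel w w).neg (ae_of_point fun c => ?_)
  have hne : point c - zero w ≠ 0 := sub_ne_zero.2 (point_ne_zero _ w c)
  dsimp only
  by_cases hc : point c ∈ interval w
  · have h1 := abs_sub_le_of_mem_interval hc (zero_mem_interval w)
    have h2 : (3 : ℝ) ^ k ≤ 1 / |point c - zero w| := by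
      rw [le_div_iff₀ (abs_pos.2 hne)]
      calc (3 : ℝ) ^ k * |point c - zero w| ≤ 3 ^ k * (1 / 3) ^ k :=
            mul_le_mul_of_nonneg_left h1 (by positivity)
        _ = 1 := by rw [← mul_pow]; norm_num
    rw [indicator_of_mem hc, Pi.one_apply, mul_one]
    refine h2.trans (le_of_eq ?_)
    unfold haar
    rw [if_pos hc]
    split_ifs with h
    · rw [abs_of_neg (sub_neg.2 h), div_neg]
    · rw [abs_of_nonneg (sub_nonneg.2 (not_lt.1 h)), neg_div, neg_neg]
  · simp [haar, hc]

theorem mass_mul_three_halves (p : ℝ) (k : ℕ) : mass p k * ((3 / 2) ^ k) ^ p = (1 / 2) ^ k := by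
  rw [mass_eq, pow_rpow_comm (by norm_num), ← mul_pow, div_mul_eq_mul_div,
    ← Real.mul_rpow (by norm_num) (by norm_num)]
  norm_num

/-- By orthogonality the signed Haar sum has square norm θ² L 2^(-m), which also controls its norm
in L^p. At the zeros the diagonal alone yields θ^p L 2^(-m). With θ a multiple of L^(-1/2), the
latter grows like L^(1-p/2). -/
theorem exists_block_measure {p : ℝ} (hp : 1 < p) (hp2 : p < 2) (j : ℕ) :
    ∃ f : ℝ → ℝ, Measurable f ∧ (∀ x, x ∉ cell j → f x = 0) ∧
      ∫⁻ y, ‖f y‖ₑ ^ p ∂measure ≤ 2⁻¹ ^ j ∧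
      (∀ k (w : Fin k → Bool), ∫⁻ y, ‖f y / (y - zero w)‖ₑ ∂measure < ∞ ∧ (zero w ∉ cell j →
        ∫⁻ y, ‖f y / (y - zero w)‖ₑ ∂measure ≤ (3 ^ 11 : ℝ≥0) * 2⁻¹ ^ j)) ∧
      (j : ℝ≥0∞) ≤ ∫⁻ x in cell j, ‖hilbert measure f x‖ₑ ^ p ∂(sig p) := by
  classical
  have hp0 : 0 < p := by linarith
  set m := j + 1 with hmdef
  obtain ⟨L, hL0, hL⟩ := exists_nat_rpow_ge (s := 1 - p / 2) (by linarith) (j * ((6 ^ j) ^ p * 2 ^ m))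
  have hLpos : (0 : ℝ) < L := by exact_mod_cast hL0
  -- The factor 6^(-j) beats the kernel size 3^m outside the cell, m = j + 1, and leaves the 2^(-j)
  -- needed for gluing.
  set θ : ℝ := (1 / 6) ^ j * (L : ℝ) ^ (-(1 / 2) : ℝ) with hθ
  have hθ0 : 0 < θ := by positivity
  have hθsq : θ ^ 2 * L = (1 / 36) ^ j := by
    rw [hθ, mul_pow, ← pow_mul, ← Real.rpow_natCast ((L : ℝ) ^ _), ← Real.rpow_mul hLpos.le,
      show (-(1 / 2) : ℝ) * ((2 : ℕ) : ℝ) = -1 by push_cast; norm_num, Real.rpow_neg_one, mul_assoc,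
      inv_mul_cancel₀ hLpos.ne', mul_one, mul_comm j, pow_mul]
    norm_num
  set B := block (ones j) m L with hB
  obtain ⟨ε, hε1, hε2⟩ := exists_signs_rpow hp.le B B (s := fun v => mass p v.1)
    (fun v => (mass_pos p v.1).le) (fun u v => hilbert measure (haar u.2) (zero v.2)) (fun _ => 0)
  set f : ℝ → ℝ := fun y => θ * ∑ v ∈ B, ε v * haar v.2 y with hf
  have hfm : Measurable f := measurable_const.mul
    (Finset.measurable_sum _ fun v _ => measurable_const.mul (measurable_haar v.2))
  have hsupp : ∀ x, x ∉ cell j → f x = 0 := by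
    intro x hx
    have : ∀ v ∈ B, ε v * haar v.2 x = 0 := fun v hv => by
      have : x ∉ interval v.2 := fun h => hx (interval_subset_of_mem_block hv h)
      simp [haar, this]
    rw [hf]
    dsimp only
    rw [Finset.sum_eq_zero this, mul_zero]
  have hsum_int : Integrable (fun y => (∑ v ∈ B, ε v * haar v.2 y) ^ 2) measure := by
    have : MemLp (fun y => ∑ v ∈ B, ε v * haar v.2 y) 2 measure :=
      memLp_finsetSum _ fun v _ => (MemLp.of_bound (measurable_haar v.2).aestronglyMeasurable 1
        (Filter.Eventually.of_forall fun y => abs_haar_le v.2 y)).const_mul _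
    exact this.integrable_sq
  have hL2 : ∫⁻ y, ‖f y‖ₑ ^ (2 : ℝ) ∂measure ≤ ENNReal.ofReal ((1 / 36) ^ j) := by
    have e1 : ∫⁻ y, ‖f y‖ₑ ^ (2 : ℝ) ∂measure = ENNReal.ofReal (∫ y, f y ^ 2 ∂measure) := by
      rw [ofReal_integral_eq_lintegral_ofReal]
      · refine lintegral_congr fun x => ?_
        rw [← ofReal_abs_rpow _ (by norm_num), Real.rpow_two, sq_abs]
      · simp only [hf, mul_pow]
        exact hsum_int.const_mul _
      · exact Filter.Eventually.of_forall fun x => sq_nonneg _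
    rw [e1]
    refine ENNReal.ofReal_le_ofReal ?_
    simp only [hf, mul_pow]
    rw [integral_const_mul, integral_sum_haar_sq B hε1, hB, sum_block_half, ← mul_assoc, hθsq]
    exact mul_le_of_le_one_right (by positivity) (pow_le_one₀ (by norm_num) (by norm_num))
  have huniv : measure univ ≤ 1 := prob_le_one
  have hL1 : ∫⁻ y, ‖f y‖ₑ ∂measure ≤ ENNReal.ofReal ((1 / 6) ^ j) := by
    have h1 := (lintegral_rpow_le_of_measure_le_one huniv (r := 2) (by norm_num)
      hfm.enorm.aemeasurable).trans hL2
    have e : ENNReal.ofReal ((1 / 36) ^ j) = ENNReal.ofReal ((1 / 6) ^ j) ^ (2 : ℝ) := by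
      rw [ENNReal.ofReal_rpow_of_nonneg (by positivity) (by norm_num), Real.rpow_two, ← pow_mul,
        mul_comm j, pow_mul]
      norm_num
    rw [e] at h1
    exact (ENNReal.rpow_le_rpow_iff (by norm_num)).1 h1
  have hker : ∀ {k : ℕ} (w : Fin k → Bool) (K : ℝ), 0 ≤ K →
      (∀ c, point c ∈ cell j → 1 / |point c - zero w| ≤ K) →
      ∫⁻ y, ‖f y / (y - zero w)‖ₑ ∂measure ≤ ENNReal.ofReal K * ENNReal.ofReal ((1 / 6) ^ j) := by
    intro k w K hK h
    refine le_trans ?_ (mul_le_mul_right hL1 _)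
    rw [← lintegral_const_mul _ hfm.enorm]
    refine lintegral_mono_ae (ae_of_point fun c => ?_)
    by_cases hc : point c ∈ cell j
    · rw [Real.enorm_eq_ofReal_abs, Real.enorm_eq_ofReal_abs, ← ENNReal.ofReal_mul hK, abs_div,
        div_eq_mul_one_div, mul_comm]
      exact ENNReal.ofReal_le_ofReal (mul_le_mul_of_nonneg_right (h c hc) (abs_nonneg _))
    · simp [hsupp _ hc]
  refine ⟨f, hfm, hsupp, ?_, fun k w => ⟨?_, fun hw => ?_⟩, ?_⟩
  · have h1 := (lintegral_rpow_le_of_measure_le_one huniv (r := 2 / p)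
      (by rw [one_le_div hp0]; exact hp2.le) (hfm.enorm.pow_const p).aemeasurable)
    have e1 : ∀ y, (‖f y‖ₑ ^ p) ^ (2 / p) = ‖f y‖ₑ ^ (2 : ℝ) := fun y => by
      rw [← ENNReal.rpow_mul, mul_div_cancel₀ _ hp0.ne']
    simp only [e1] at h1
    have h2 := h1.trans hL2
    have e2 : (2⁻¹ : ℝ≥0∞) ^ j = ENNReal.ofReal ((1 / 2) ^ j) := by
      rw [ENNReal.ofReal_pow (by norm_num), one_div, ENNReal.ofReal_inv_of_pos (by norm_num)]
      simp
    rw [e2]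
    refine (ENNReal.rpow_le_rpow_iff (show 0 < 2 / p by positivity)).1 (h2.trans ?_)
    rw [ENNReal.ofReal_rpow_of_nonneg (by positivity) (by positivity)]
    refine ENNReal.ofReal_le_ofReal ?_
    calc (1 / 36 : ℝ) ^ j ≤ (1 / 4) ^ j := pow_le_pow_left₀ (by norm_num) (by norm_num) j
      _ = ((1 / 2 : ℝ) ^ j) ^ (2 : ℝ) := by
          rw [Real.rpow_two, ← pow_mul, mul_comm j, pow_mul]; norm_num
      _ ≤ ((1 / 2 : ℝ) ^ j) ^ (2 / p) := by
          refine Real.rpow_le_rpow_of_exponent_ge (by positivity)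
            (pow_le_one₀ (by norm_num) (by norm_num)) ?_
          exact div_le_self (by norm_num) hp.le
  · exact (hker w (3 ^ 10 * 3 ^ k) (by positivity) fun c _ => abs_kernel_le w c).trans_lt
      (ENNReal.mul_lt_top ENNReal.ofReal_lt_top ENNReal.ofReal_lt_top)
  · refine (hker w (3 ^ 10 * 3 ^ m) (by positivity) fun c hc =>
      abs_kernel_le_of_not_agree fun hmk ha => hw ?_).trans (le_of_eq ?_)
    · have h1 : zero w ∈ interval (pre (ext w) m) := by
        refine interval_pre_subset (ext w) hmk ?_
        rw [pre_ext]
        exact zero_mem_interval w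
      have h2 : Agree m (ones j) c := point_mem_pre.1 hc
      rwa [(ha.trans h2.symm).pre_eq] at h1
    · have e2 : ((3 ^ 11 : ℝ≥0) : ℝ≥0∞) * (2⁻¹ : ℝ≥0∞) ^ j = ENNReal.ofReal ((1 / 2) ^ j * 3 ^ 11) := by
        rw [ENNReal.ofReal_mul (by positivity), ENNReal.ofReal_pow (by norm_num), one_div,
          ENNReal.ofReal_inv_of_pos (by norm_num), mul_comm, ENNReal.ofReal_pow (by norm_num)]
        simp
      rw [e2, ← ENNReal.ofReal_mul (by positivity)]
      congr 1
      have : (3 : ℝ) ^ j * (1 / 6) ^ j = (1 / 2) ^ j := by rw [← mul_pow]; norm_num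
      rw [hmdef, pow_succ, ← this]
      ring
  · have hH : ∀ {k : ℕ} (w : Fin k → Bool), hilbert measure f (zero w) =
        θ * ∑ u ∈ B, ε u * hilbert measure (haar u.2) (zero w) := by
      intro k w
      unfold hilbert
      have e : ∀ y, f y / (y - zero w) = θ * ∑ u ∈ B, ε u * (haar u.2 y / (y - zero w)) := by
        intro y
        rw [hf]
        dsimp only
        rw [mul_div_assoc, Finset.sum_div]
        simp only [mul_div_assoc]
      simp only [e]
      rw [integral_const_mul, integral_finsetSum _ fun u _ => (integrable_haar_kernel u.2 w).const_mul _]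
      simp only [integral_const_mul]
    have hlow : (j : ℝ) ≤ ∑ v ∈ B, mass p v.1 * |hilbert measure f (zero v.2)| ^ p := by
      have e1 : ∀ v ∈ B, mass p v.1 * |hilbert measure f (zero v.2)| ^ p =
          θ ^ p * (mass p v.1 * |0 + ∑ u ∈ B, ε u * hilbert measure (haar u.2) (zero v.2)| ^ p) := by
        intro v _
        rw [hH, abs_mul, abs_of_pos hθ0, Real.mul_rpow hθ0.le (abs_nonneg _), zero_add]
        ring
      rw [Finset.sum_congr rfl e1, ← Finset.mul_sum]
      refine le_trans ?_ (mul_le_mul_of_nonneg_left hε2 (by positivity))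
      have e2 : (L : ℝ) * (1 / 2) ^ m ≤ ∑ v ∈ B, mass p v.1 *
          (if v ∈ B then |hilbert measure (haar v.2) (zero v.2)| ^ p else |(0 : ℝ)| ^ p) := by
        rw [← sum_block_half (ones j)]
        refine Finset.sum_le_sum fun v hv => ?_
        rw [if_pos hv, ← mass_mul_three_halves p]
        exact mul_le_mul_of_nonneg_left (Real.rpow_le_rpow (by positivity)
          (le_abs_hilbert_haar v.2) hp0.le) (mass_pos p v.1).le
      refine le_trans ?_ (mul_le_mul_of_nonneg_left e2 (by positivity))
      have e3 : θ ^ p * L = (L : ℝ) ^ (1 - p / 2) / (6 ^ j) ^ p := by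
        rw [hθ, Real.mul_rpow (by positivity) (by positivity), ← Real.rpow_mul hLpos.le, one_div_pow,
          Real.div_rpow zero_le_one (by positivity), Real.one_rpow, sub_eq_add_neg,
          Real.rpow_add hLpos, Real.rpow_one, show -(1 / 2) * p = -(p / 2) by ring]
        ring
      rw [← mul_assoc, e3, one_div_pow, div_mul_div_comm, mul_one, le_div_iff₀ (by positivity)]
      exact hL
    rw [← ENNReal.ofReal_natCast, ← lintegral_indicator (measurableSet_cell j), lintegral_sig']
    refine (ENNReal.ofReal_le_ofReal hlow).trans ?_
    rw [ENNReal.ofReal_sum_of_nonneg fun v _ => mul_nonneg (mass_pos p v.1).le (by positivity)]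
    refine le_trans (Finset.sum_le_sum fun v hv => ?_) (ENNReal.sum_le_tsum B)
    have hmem : zero v.2 ∈ cell j := interval_subset_of_mem_block hv (zero_mem_interval v.2)
    rw [indicator_of_mem hmem, ENNReal.ofReal_mul (mass_pos p v.1).le, ofReal_abs_rpow _ hp0.le]

theorem exists_witness_measure {p : ℝ} (hp : 1 < p) (hp2 : p < 2) :
    ∃ F : ℝ → ℝ, Measurable F ∧ MemLp F (ENNReal.ofReal p) measure ∧
      (∀ᵐ x ∂(sig p), Converges measure F x) ∧
      ∫⁻ x, ENNReal.ofReal (|hilbert measure F x| ^ p) ∂(sig p) = ∞ := by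
  have := isFiniteMeasure_sig hp
  choose f h1 h2 h3 h4 h5 using exists_block_measure hp hp2
  exact exists_witness_of_blocks hp.le disjoint_cell measurableSet_cell h1 h2 h3
    (ae_sig fun k w => ⟨(converges_one (zero_spec w).1).1, fun i => h4 i k w⟩) h5

end Cantor

/-! ### The quadratic Muckenhoupt constants and the main theorem -/

namespace TwoWeight

theorem isInterval_Icc {a b : ℝ} (h : a < b) : IsInterval (Icc a b) :=
  ⟨ordConnected_Icc, Metric.isBounded_Icc a b, by rw [interior_Icc]; exact nonempty_Ioo.2 h⟩

theorem isInterval_Ioo {a b : ℝ} (h : a < b) : IsInterval (Ioo a b) :=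
  ⟨ordConnected_Ioo, Metric.isBounded_Ioo a b, by rw [interior_Ioo]; exact nonempty_Ioo.2 h⟩

theorem center_Icc {a b : ℝ} (h : a ≤ b) : center (Icc a b) = (a + b) / 2 := by
  rw [center, csInf_Icc h, csSup_Icc h]

theorem center_Ioo {a b : ℝ} (h : a < b) : center (Ioo a b) = (a + b) / 2 := by
  rw [center, csInf_Ioo h, csSup_Ioo h]

/-- If, along a sequence of finite families, the `p`-th power of the left side of the quadratic
inequality grows faster than that of the right side, then the quadratic constant is infinite. -/
theorem quadraticMuckenhoupt_eq_top {γ : Type*} {p : ℝ} (hp : 0 < p) {σ ω : Measure ℝ}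
    (B : ℕ → Finset γ) {I : γ → Set ℝ} {f : γ → ℝ → ℝ≥0∞} (hI : ∀ v, IsInterval (I v))
    (hf : ∀ v, Measurable (f v)) {a b : ℝ} (hab : a < b) {D : ℝ≥0}
    (hlow : ∀ K : ℕ, (K : ℝ≥0∞) ^ b ≤ ∫⁻ x, (∑ v ∈ B K, ((I v).indicator
      (fun _ => ∫⁻ y in (I v)ᶜ, f v y / ENNReal.ofReal |y - center (I v)| ∂σ) x) ^ 2) ^ (p / 2) ∂ω)
    (hup : ∀ K : ℕ, ∫⁻ y, (∑ v ∈ B K, f v y ^ 2) ^ (p / 2) ∂σ ≤ D * (K : ℝ≥0∞) ^ a) :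
    quadraticMuckenhoupt p σ ω = ∞ := by
  rw [quadraticMuckenhoupt, sInf_eq_top]
  intro C hC
  by_contra hCtop
  lift C to ℝ≥0 using hCtop
  -- A finite constant would force K^(b-a) ≤ C^p D; this `K` violates it.
  obtain ⟨K, hK0, hK⟩ := exists_nat_rpow_ge (sub_pos.2 hab) ((C ^ p * D : ℝ≥0) + 1 : ℝ)
  have h1 := hC (B K).card (fun i => I ((B K).equivFin.symm i)) (fun i => f ((B K).equivFin.symm i))
    (fun i => hI _) (fun i => hf _)
  have e : ∀ g : γ → ℝ≥0∞, ∑ i, g ((B K).equivFin.symm i) = ∑ v ∈ B K, g v := fun g => by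
    rw [Equiv.sum_comp (B K).equivFin.symm (fun v : B K => g v), Finset.sum_coe_sort]
  have e1 : ∀ x, ∑ i, ((I ((B K).equivFin.symm i)).indicator (fun _ =>
      ∫⁻ y in (I ((B K).equivFin.symm i))ᶜ, f ((B K).equivFin.symm i) y /
        ENNReal.ofReal |y - center (I ((B K).equivFin.symm i))| ∂σ) x) ^ 2 =
      ∑ v ∈ B K, ((I v).indicator
      (fun _ => ∫⁻ y in (I v)ᶜ, f v y / ENNReal.ofReal |y - center (I v)| ∂σ) x) ^ 2 :=
    fun x => e fun v => ((I v).indicator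
      (fun _ => ∫⁻ y in (I v)ᶜ, f v y / ENNReal.ofReal |y - center (I v)| ∂σ) x) ^ 2
  have e2 : ∀ y, ∑ i, f ((B K).equivFin.symm i) y ^ 2 = ∑ v ∈ B K, f v y ^ 2 :=
    fun y => e fun v => f v y ^ 2
  simp only [e1, e2] at h1
  have h2 := ENNReal.rpow_le_rpow h1 hp.le
  rw [ENNReal.mul_rpow_of_nonneg _ _ hp.le, ← ENNReal.rpow_mul, ← ENNReal.rpow_mul,
    one_div_mul_cancel hp.ne', ENNReal.rpow_one, ENNReal.rpow_one] at h2
  have h3 := (hlow K).trans (h2.trans (mul_le_mul_right (hup K) _))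
  have hKne : (K : ℝ≥0) ≠ 0 := by exact_mod_cast hK0.ne'
  have h4 : (K : ℝ≥0) ^ b ≤ C ^ p * (D * (K : ℝ≥0) ^ a) := by
    rw [← ENNReal.coe_le_coe]
    rwa [ENNReal.coe_mul, ENNReal.coe_mul, ENNReal.coe_rpow_of_ne_zero hKne,
      ENNReal.coe_rpow_of_ne_zero hKne, ENNReal.coe_rpow_of_nonneg _ hp.le, ENNReal.coe_natCast]
  have hKpos : (0 : ℝ) < K := by exact_mod_cast hK0
  have h5 : (K : ℝ) ^ b ≤ (C ^ p * D : ℝ≥0) * (K : ℝ) ^ a := by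
    rw [← mul_assoc] at h4
    exact_mod_cast h4
  rw [← div_le_iff₀ (by positivity), ← Real.rpow_sub hKpos] at h5
  linarith

end TwoWeight

namespace Cantor

open TwoWeight

/-- The words of length less than `K`. -/
def words (K : ℕ) : Finset ((k : ℕ) × (Fin k → Bool)) := (Finset.range K).sigma fun _ => Finset.univ

theorem sum_words_half (K : ℕ) : ∑ v ∈ words K, ENNReal.ofReal ((1 / 2) ^ v.1) = K := by
  rw [words, Finset.sum_sigma]
  have : ∀ k, ∑ _w : Fin k → Bool, ENNReal.ofReal ((1 / 2) ^ k) = 1 := fun k => by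
    rw [Finset.sum_const, Finset.card_univ, Fintype.card_fun, Fintype.card_bool, Fintype.card_fin,
      nsmul_eq_mul, ← ENNReal.ofReal_natCast, ← ENNReal.ofReal_mul (by positivity)]
    push_cast
    rw [← mul_pow]
    norm_num
  simp only [this]
  simp

/-- The left or the right third of an interval. -/
def third {k : ℕ} (w : Fin k → Bool) (b : Bool) : Set ℝ :=
  if b then Icc (leftEnd w + 2 / 3 ^ (k + 1)) (leftEnd w + 1 / 3 ^ k)
  else Icc (leftEnd w) (leftEnd w + 1 / 3 ^ (k + 1))

theorem third_facts {k : ℕ} (w : Fin k → Bool) (b : Bool) :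
    IsInterval (third w b) ∧ center (third w b) ∈ third w b ∧ third w b ⊆ interval w ∧
      zero w ∉ third w b := by
  have h0 : (0 : ℝ) < 1 / 3 ^ (k + 1) := by positivity
  have h1 := one_div_pow_succ k
  have e1 : (3 : ℝ) / 3 ^ (k + 1) = 3 * (1 / 3 ^ (k + 1)) := by ring
  have e2 : (2 : ℝ) / 3 ^ (k + 1) = 2 * (1 / 3 ^ (k + 1)) := by ring
  have hz := (zero_spec w).1
  unfold third gap interval at *
  rw [h1, e1, e2] at *
  cases b
  · rw [if_neg (by simp), center_Icc (by linarith)]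
    refine ⟨isInterval_Icc (by linarith), ⟨by linarith, by linarith⟩,
      Icc_subset_Icc le_rfl (by linarith), fun h => ?_⟩
    linarith [h.2, hz.1]
  · rw [if_pos rfl, center_Icc (by linarith)]
    refine ⟨isInterval_Icc (by linarith), ⟨by linarith, by linarith⟩,
      Icc_subset_Icc (by linarith) le_rfl, fun h => ?_⟩
    linarith [h.1, hz.2]

theorem point_mem_third (c : ℕ → Bool) (k : ℕ) : point c ∈ third (pre c k) (c k) := by
  have h := point_side c k
  have h1 := mem_interval_point c k
  unfold third
  cases hc : c k
  · exact ⟨h1.1, h.1 hc⟩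
  · exact ⟨h.2 hc, h1.2⟩

/-- Every Cantor point lies in one third from each of the K generations, and each such third
receives at least 1 from its normalized atom: the left side is at least K^(p/2). On the right the
atoms are disjoint, so it is 2^(p/2) K. Thirds are used because the atom must lie outside the
interval. -/
theorem quadraticMuckenhoupt_sig {p q : ℝ} (h : p.HolderConjugate q) (hp : 2 < p) :
    quadraticMuckenhoupt p (sig q) measure = ∞ := by
  have hp0 : 0 < p := by linarith
  set a : ℕ → ℝ := fun k => (1 / 3) ^ k / mass q k with ha
  have ha0 : ∀ k, 0 ≤ a k := fun k => div_nonneg (by positivity) (mass_pos q k).le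
  set f : ((k : ℕ) × (Fin k → Bool)) × Bool → ℝ → ℝ≥0∞ := fun u =>
    ({zero u.1.2} : Set ℝ).indicator fun _ => ENNReal.ofReal (a u.1.1) with hf
  refine quadraticMuckenhoupt_eq_top hp0 (fun K => words K ×ˢ Finset.univ)
    (I := fun u => third u.1.2 u.2) (f := f) (fun u => (third_facts u.1.2 u.2).1)
    (fun u => measurable_const.indicator (measurableSet_singleton _))
    (a := 1) (b := p / 2) (by linarith) (D := 2 ^ (p / 2)) (fun K => ?_) (fun K => ?_)
  · have hin : ∀ u : ((k : ℕ) × (Fin k → Bool)) × Bool, 1 ≤ ∫⁻ y in (third u.1.2 u.2)ᶜ,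
        f u y / ENNReal.ofReal |y - center (third u.1.2 u.2)| ∂(sig q) := by
      rintro ⟨⟨k, w⟩, b⟩
      obtain ⟨h1, h2, h3, h4⟩ := third_facts w b
      rw [← lintegral_indicator h1.measurableSet.compl, lintegral_sig']
      refine le_trans ?_ (ENNReal.le_tsum ⟨k, w⟩)
      have hne : 0 < |zero w - center (third w b)| :=
        abs_pos.2 (sub_ne_zero.2 fun e => h4 (e ▸ h2))
      rw [indicator_of_mem (show zero w ∈ (third w b)ᶜ from h4)]
      simp only [hf, indicator_of_mem (mem_singleton _)]
      rw [← ENNReal.ofReal_div_of_pos hne, ← ENNReal.ofReal_mul (mass_pos q k).le,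
        ENNReal.one_le_ofReal, ha, ← mul_div_assoc, mul_div_cancel₀ _ (mass_pos q k).ne',
        one_le_div hne]
      exact abs_sub_le_of_mem_interval (zero_mem_interval w) (h3 h2)
    calc (K : ℝ≥0∞) ^ (p / 2) = ∫⁻ _x, (K : ℝ≥0∞) ^ (p / 2) ∂measure := by simp
      _ ≤ _ := by
        refine lintegral_mono_ae (ae_of_point fun c => ENNReal.rpow_le_rpow ?_ (by linarith))
        rw [Finset.sum_product, words, Finset.sum_sigma]
        calc (K : ℝ≥0∞) = ∑ k ∈ Finset.range K, 1 := by simp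
          _ ≤ _ := by
            refine Finset.sum_le_sum fun k _ => ?_
            refine le_trans ?_ (Finset.single_le_sum (fun _ _ => zero_le)
              (Finset.mem_univ (pre c k)))
            refine le_trans ?_ (Finset.single_le_sum (fun _ _ => zero_le)
              (Finset.mem_univ (c k)))
            rw [indicator_of_mem (point_mem_third c k)]
            exact one_le_pow₀ (hin (⟨k, pre c k⟩, c k))
  · have hsum : ∀ v : (k : ℕ) × (Fin k → Bool), ∑ u ∈ words K ×ˢ Finset.univ, f u (zero v.2) ^ 2 =
        if v ∈ words K then 2 * ENNReal.ofReal (a v.1) ^ 2 else 0 := by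
      intro v
      have h1 : ∀ u b, u ≠ v → f (u, b) (zero v.2) ^ 2 = 0 := fun u b hu => by
        have : zero v.2 ∉ ({zero u.2} : Set ℝ) := fun e => hu (zero_injective e).symm
        simp only [hf, indicator_of_notMem this]
        norm_num
      rw [Finset.sum_product]
      split_ifs with hv
      · rw [Finset.sum_eq_single_of_mem v hv fun u _ hu => Finset.sum_eq_zero fun b _ => h1 u b hu]
        simp [hf, two_mul]
      · exact Finset.sum_eq_zero fun u hu => Finset.sum_eq_zero fun b _ =>
          h1 u b fun e => hv (e ▸ hu)
    rw [lintegral_atoms q (B := words K) fun v hv => by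
      rw [hsum, if_neg hv, ENNReal.zero_rpow_of_pos (by linarith)]]
    rw [ENNReal.rpow_one, ← sum_words_half, Finset.mul_sum]
    refine le_of_eq (Finset.sum_congr rfl fun v hv => ?_)
    rw [hsum, if_pos hv, ENNReal.mul_rpow_of_nonneg _ _ (by linarith), ← ENNReal.rpow_natCast,
      ← ENNReal.rpow_mul, Nat.cast_ofNat, mul_div_cancel₀ _ two_ne_zero,
      ENNReal.ofReal_rpow_of_nonneg (ha0 _) hp0.le, mul_left_comm,
      ← ENNReal.ofReal_mul (mass_pos q _).le, mass_mul_rpow_div h,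
      ENNReal.coe_rpow_of_nonneg _ (by linarith)]
    rfl

theorem gap_facts {k : ℕ} (w : Fin k → Bool) :
    IsInterval (gap w) ∧ center (gap w) ∈ interval w := by
  have h0 : (0 : ℝ) < 1 / 3 ^ (k + 1) := by positivity
  have e2 : (2 : ℝ) / 3 ^ (k + 1) = 2 * (1 / 3 ^ (k + 1)) := by ring
  have hlt : leftEnd w + 1 / 3 ^ (k + 1) < leftEnd w + 2 / 3 ^ (k + 1) := by rw [e2]; linarith
  refine ⟨isInterval_Ioo hlt, gap_subset w ?_⟩
  rw [gap, center_Ioo hlt]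
  constructor <;> linarith

/-- With gaps as intervals and indicators of Cantor intervals as functions, each atom receives at
least (3/2)^k from its own gap, so the left side is at least K. On the right, K indicators overlap
at each Cantor point, which gives K^(p/2). -/
theorem quadraticMuckenhoupt_measure {p : ℝ} (hp : 1 < p) (hp2 : p < 2) :
    quadraticMuckenhoupt p measure (sig p) = ∞ := by
  have hp0 : 0 < p := by linarith
  set f : (k : ℕ) × (Fin k → Bool) → ℝ → ℝ≥0∞ := fun v => (interval v.2).indicator 1 with hf
  refine quadraticMuckenhoupt_eq_top hp0 words (I := fun v => gap v.2) (f := f)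
    (fun v => (gap_facts v.2).1) (fun v => measurable_one.indicator measurableSet_Icc)
    (a := p / 2) (b := 1) (by linarith) (D := 1) (fun K => ?_) (fun K => ?_)
  · have hin : ∀ v : (k : ℕ) × (Fin k → Bool), ENNReal.ofReal ((3 / 2) ^ v.1) ≤
        ∫⁻ y in (gap v.2)ᶜ, f v y / ENNReal.ofReal |y - center (gap v.2)| ∂measure := by
      rintro ⟨k, w⟩
      obtain ⟨h1, h2⟩ := gap_facts w
      have e : ENNReal.ofReal ((3 / 2) ^ k) =
          ∫⁻ y, (interval w).indicator (fun _ => ENNReal.ofReal (3 ^ k)) y ∂measure := by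
        rw [lintegral_indicator_const (by exact measurableSet_Icc), measure_interval,
          ← ENNReal.ofReal_ofNat, ← ENNReal.ofReal_inv_of_pos (by norm_num),
          ← ENNReal.ofReal_pow (by norm_num), ← ENNReal.ofReal_mul (by positivity), ← mul_pow]
        norm_num
      rw [← lintegral_indicator h1.measurableSet.compl, e]
      refine lintegral_mono_ae (ae_of_point fun c => ?_)
      rw [indicator_of_mem (show point c ∈ (gap w)ᶜ from point_notMem_gap w c)]
      by_cases hc : point c ∈ interval w
      · simp only [hf, indicator_of_mem hc, Pi.one_apply]
        rw [ENNReal.le_div_iff_mul_le (Or.inr one_ne_zero) (Or.inr ENNReal.one_ne_top),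
          ← ENNReal.ofReal_mul (by positivity), ENNReal.ofReal_le_one]
        calc (3 : ℝ) ^ k * |point c - center (gap w)| ≤ 3 ^ k * (1 / 3) ^ k :=
              mul_le_mul_of_nonneg_left (abs_sub_le_of_mem_interval hc h2) (by positivity)
          _ = 1 := by rw [← mul_pow]; norm_num
      · rw [indicator_of_notMem hc]
        exact zero_le
    rw [ENNReal.rpow_one, ← sum_words_half, lintegral_sig']
    refine le_trans (Finset.sum_le_sum fun v hv => ?_) (ENNReal.sum_le_tsum (words K))
    rw [← mass_mul_three_halves p, ENNReal.ofReal_mul (mass_pos p _).le]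
    refine mul_le_mul_right ?_ _
    rw [← ENNReal.ofReal_rpow_of_nonneg (by positivity) hp0.le]
    calc ENNReal.ofReal ((3 / 2) ^ v.1) ^ p
        = (ENNReal.ofReal ((3 / 2) ^ v.1) ^ 2) ^ (p / 2) := by
          rw [← ENNReal.rpow_natCast, ← ENNReal.rpow_mul, Nat.cast_ofNat,
            mul_div_cancel₀ _ two_ne_zero]
      _ ≤ _ := by
          refine ENNReal.rpow_le_rpow ?_ (by linarith)
          refine le_trans ?_ (Finset.single_le_sum (fun _ _ => zero_le) hv)
          rw [indicator_of_mem (zero_spec v.2).1]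
          exact pow_le_pow_left₀ zero_le (hin v) 2
  · rw [ENNReal.coe_one, one_mul]
    calc _ ≤ ∫⁻ _y, (K : ℝ≥0∞) ^ (p / 2) ∂measure := by
          refine lintegral_mono_ae (ae_of_point fun c => ENNReal.rpow_le_rpow ?_ (by linarith))
          rw [words, Finset.sum_sigma]
          calc _ ≤ ∑ k ∈ Finset.range K, (1 : ℝ≥0∞) := by
                refine Finset.sum_le_sum fun k _ => ?_
                rw [Finset.sum_eq_single (pre c k)]
                · simp [hf, mem_interval_point]
                · intro w _ hw
                  have : point c ∉ interval w := fun hc => by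
                    rw [← pre_ext w, point_mem_pre] at hc
                    exact hw (by rw [← hc.pre_eq, pre_ext])
                  simp [hf, this]
                · exact fun hh => absurd (Finset.mem_univ _) hh
            _ = K := by simp
      _ = (K : ℝ≥0∞) ^ (p / 2) := by simp

theorem T1Failure_sig {p q : ℝ} (h : p.HolderConjugate q) (hp : 2 < p) :
    T1Failure p (sig q) measure := by
  have := isFiniteMeasure_sig h.symm.lt
  obtain ⟨F, h1, h2, h3, h4⟩ := exists_witness_sig h hp
  exact ⟨quadraticMuckenhoupt_sig h hp, not_hilbertBounded h.pos h1 h2 h3 h4, F, h2, h3, h4⟩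

theorem T1Failure_measure {p : ℝ} (hp : 1 < p) (hp2 : p < 2) : T1Failure p measure (sig p) := by
  obtain ⟨F, h1, h2, h3, h4⟩ := exists_witness_measure hp hp2
  exact ⟨quadraticMuckenhoupt_measure hp hp2,
    not_hilbertBounded (zero_lt_one.trans hp) h1 h2 h3 h4, F, h2, h3, h4⟩

end Cantor

theorem mainTheorem1 (p : ℝ) (hp : 1 < p) (hp2 : p ≠ 2) :
    (∀ (k : ℕ) (w : Fin k → Bool),
      (∀ z ∈ Cantor.gap w, TwoWeight.Converges Cantor.measure 1 z) ∧
      ∃! z : ℝ, z ∈ Cantor.gap w ∧ TwoWeight.hilbert Cantor.measure 1 z = 0) ∧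
    TwoWeight.T1Hypotheses p (Cantor.sigma p) Cantor.measure ∧
    TwoWeight.T1Hypotheses p Cantor.measure (Cantor.sigma p.conjExponent) ∧
    (2 < p → TwoWeight.T1Failure p (Cantor.sigma p) Cantor.measure) ∧
    (p < 2 → TwoWeight.T1Failure p Cantor.measure (Cantor.sigma p.conjExponent)) := by
  have h := Real.HolderConjugate.conjExponent hp
  -- The exponent conjugate to p' is p, so the discrete measure of the dual pair has mass exponent
  -- p.
  rw [Cantor.sigma_eq, Cantor.sigma_eq, h.symm.conjExponent_eq]
  exact ⟨fun k w => ⟨fun z hz => Cantor.converges_one hz, Cantor.existsUnique_zero w⟩,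
    Cantor.T1Hypotheses_sig h, Cantor.T1Hypotheses_measure h, Cantor.T1Failure_sig h,
    Cantor.T1Failure_measure hp⟩
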